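/- Let $M$ be a smooth (Hausdorff, second countable, boundaryless) $n$-manifold which is integrably parallelizable, i.e. $M$ carries an atlas $A=\{(U_\alpha,x_\alpha)\}$ of smooth charts such that the differentials of all transition maps are the identity. Let $v_i=\partial/\partial x^i$ be the resulting global frame of $TM$, let $g$ be the (flat) Riemannian metric on $M$ for which $(v_i)$ is orthonormal, and orient $M$ by $(v_i)$. Let $(x,\xi)$ be the induced coordinates on $T^*M$ ($\xi^i$ being the coefficient of $dx^i$). Then there is a Calabi–Yau structure $(J,\omega,\Omega)$ on $T^*M$ (that is, $(T^*M,J,\omega)$ is Kähler, and $\Omega$ is a nowhere vanishing holomorphic $n$-form, of norm $1$ on unitary frames) which is given by the global coordinate frame: $$J\tfrac{\partial}{\partial x^i}=\tfrac{\partial}{\partial \xi^i},\quad J\tfrac{\partial}{\partial \xi^i}=-\tfrac{\partial}{\partial x^i},\quad \omega=\sum_i dx^i\wedge d\xi^i,\quad \Omega=(dx^1+\sqrt{-1}\,d\xi^1)\wedge\dots\wedge(dx^n+\sqrt{-1}\,d\xi^n).$$ Assume moreover that $M$ is connected. Let $\theta\in(-\pi,\pi]$, $1\le r\le\infty$, $f\in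 C^{r+1}([0,1]\times M)$, $f_t=f(t,\cdot)$, and $\Lambda_t=\mathrm{graph}(df_t)\subset T^*M$, oriented by $M$. Consider the space of $\theta$-positive Lagrangians, i.e. embedded oriented $C^r$ Lagrangian submanifolds $\Gamma\cong M$ of $T^*M$ with $\mathrm{Re}(e^{-\sqrt{-1}\theta}\Omega)|_\Gamma>0$. A tangent vector at $\Gamma$ is a $C^r$ function $h$ on $\Gamma$ with $\int_\Gamma h\,\mathrm{Re}(e^{-\sqrt{-1}\theta}\Omega)=0$ if $M$ is compact, and with compact support if $M$ is not compact. A $C^r$ path $(\Lambda_t)_{t\in[0,1]}$ of $\theta$-positive Lagrangians, parametrised by diffeomorphisms $g_t:M\to\Lambda_t$, has velocity $h_t$ if $g_t^*\iota_{dg_t/dt}\omega=d(h_t\circ g_t)$, with $h_t$ a tangent vector at $\Lambda_t$ (with supports in one compact set, for all $t$, if $M$ is not compact). "Path in the space of positive Lagrangians" below means a path having such a velocity. It is a geodesic (for the Levi–Civita connection of Solomon's metric $(h,k)=\int_\Gamma hk\,\mathrm{Re}(e^{-\sqrt{-1}\theta}\Omega)$) if $\partial_t(h_t\circ g_t)+d(h_t\circ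 g_t)(\zeta_t)=0$ on $[0,1]\times M$, where $\iota_{\zeta_t}g_t^*\mathrm{Re}(e^{-\sqrt{-1}\theta}\Omega)=-g_t^*\iota_{dg_t/dt}\mathrm{Re}(e^{-\sqrt{-1}\theta}\Omega)$. Call $f$ normalised if the functions $-\partial_tf_t$, carried to $\Lambda_t$ by the projection, are tangent vectors at $\Lambda_t$ (with supports in one compact set, for all $t$, if $M$ is not compact). Then: (i) If $(\Lambda_t)$ is a path in the space of $\theta$-positive Lagrangians, then there is a function $c\in C^{r+1}([0,1])$ of $t$ alone such that $f+c$ is normalised; note that $\mathrm{graph}(d(f_t+c(t)))=\Lambda_t$. (ii) If $f+kt$ is normalised for some constant $k\in\mathbb R$, then $(\Lambda_t)$ is a geodesic in the space of $\theta$-positive Lagrangians if and only if $f$ satisfies the Riemannian degenerate special Lagrangian equation (DSL) of phase $\theta$ on $[0,1]\times M$: for every orthonormal frame $e=(e_1,\dots,e_n)$ of $(M,g)$, with $\bar e=(\partial_t,e)$, $$\mathrm{Im}\Big(e^{-\sqrt{-1}\theta}\det\big(\mathrm{diag}(0,1,\dots,1)+\sqrt{-1}\,\mathrm{Hess}f(\bar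 e,\bar e)\big)\Big)=0\quad\text{and}\quad \mathrm{Re}\Big(e^{-\sqrt{-1}\theta}\det\big(I+\sqrt{-1}\,\mathrm{Hess}f_t(e,e)\big)\Big)>0,$$ the Hessians being the Riemannian Hessians of $dt^2+g$ and $g$. -/

import Mathlib

open Set Topology
open scoped Manifold ContDiff

noncomputable section

namespace PosLag

/-- The model space `ℝⁿ` with its Euclidean norm. -/
abbrev Rn (n : ℕ) : Type := EuclideanSpace ℝ (Fin n)

/-- The `i`-th standard basis vector of `ℝⁿ`. -/
def stdVec (n : ℕ) (i : Fin n) : Rn n := EuclideanSpace.single i (1 : ℝ)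

/-- The differential `df|_p` of a real function, as a covector. -/
def dFun {n : ℕ} {M : Type*} [TopologicalSpace M] [ChartedSpace (Rn n) M] (f : M → ℝ) (p : M) :
    TangentSpace (𝓡 n) p →L[ℝ] ℝ :=
  mfderiv (𝓡 n) 𝓘(ℝ, ℝ) f p

/-! ### Charts with values in a vector space, complex coordinates, Calabi–Yau structures -/

section CalabiYau

variable {V : Type*} [NormedAddCommGroup V] [NormedSpace ℝ V] {H : Type*} [TopologicalSpace H]
  (I : ModelWithCorners ℝ V H) {X : Type*} [TopologicalSpace X] [ChartedSpace H X]

/-- `φ` is a smooth coordinate system on the open set `φ.source`, with values in `W`. -/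
structure IsSmoothChart {W : Type*} [NormedAddCommGroup W] [NormedSpace ℝ W]
    (φ : OpenPartialHomeomorph X W) : Prop where
  smooth : ContMDiffOn I 𝓘(ℝ, W) ∞ φ φ.source
  smooth_symm : ContMDiffOn 𝓘(ℝ, W) I ∞ φ.symm φ.target

/-- The differentials `(dz₁ v, …, dzₙ v)` of complex valued functions `φ = (z₁, …, zₙ)`. -/
def coordDiff {n : ℕ} (φ : X → Fin n → ℂ) (x : X) (v : TangentSpace I x) : Fin n → ℂ :=
  mfderiv I 𝓘(ℝ, Fin n → ℂ) φ x v

/-- `φ = (z₁, …, zₙ)` is a smooth coordinate system which is holomorphic for the almost complex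
structure `J`, that is, `dφ ∘ J = √-1 dφ`. -/
structure IsHolomorphicChart {n : ℕ} (J : ∀ x : X, TangentSpace I x →L[ℝ] TangentSpace I x)
    (φ : OpenPartialHomeomorph X (Fin n → ℂ)) : Prop where
  isSmoothChart : IsSmoothChart I φ
  dJ : ∀ x ∈ φ.source, ∀ v : TangentSpace I x,
    coordDiff I φ x (J x v) = Complex.I • coordDiff I φ x v

/-- The expression in the coordinate system `φ` of a field `om` of alternating 2-forms,
that is, its pullback by `φ⁻¹`. -/
def localForm {W : Type*} [NormedAddCommGroup W] [NormedSpace ℝ W]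
    (om : ∀ x : X, (TangentSpace I x) [⋀^Fin 2]→L[ℝ] ℝ) (φ : OpenPartialHomeomorph X W) (y : W) :
    W [⋀^Fin 2]→L[ℝ] ℝ :=
  (om (φ.symm y)).compContinuousLinearMap (mfderiv 𝓘(ℝ, W) I φ.symm y)

variable (X) in
/-- A Calabi–Yau structure `(J, ω, Ω)` of complex dimension `n` on the manifold `X`:
`(X, J, ω)` is Kähler, and `Ω` is a nowhere vanishing holomorphic `n`-form, normalised by
`|Ω| = 1` on unitary frames of the Kähler metric `ω(·, J·)`
(equivalently, `ωⁿ/n! = (-1)^{n(n-1)/2} (√-1/2)ⁿ Ω ∧ conj Ω`). -/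
structure CalabiYauStructure (n : ℕ) where
  /-- the complex structure -/
  J : ∀ x : X, TangentSpace I x →L[ℝ] TangentSpace I x
  /-- the Kähler form -/
  omega : ∀ x : X, (TangentSpace I x) [⋀^Fin 2]→L[ℝ] ℝ
  /-- the holomorphic volume form -/
  Omega : ∀ x : X, (TangentSpace I x) [⋀^Fin n]→L[ℝ] ℂ
  J_sq : ∀ (x : X) (v : TangentSpace I x), J x (J x v) = -v
  /-- `J` is integrable: there are holomorphic coordinates around every point. -/
  integrable : ∀ x : X, ∃ φ : OpenPartialHomeomorph X (Fin n → ℂ),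
    x ∈ φ.source ∧ IsHolomorphicChart I J φ
  /-- `ω` is smooth and closed. -/
  omega_closed : ∀ x : X, ∃ φ : OpenPartialHomeomorph X V, x ∈ φ.source ∧ IsSmoothChart I φ ∧
    ContDiffOn ℝ ∞ (localForm I omega φ) φ.target ∧
    ∀ y ∈ φ.target, extDeriv (localForm I omega φ) y = 0
  omega_J : ∀ (x : X) (u v : TangentSpace I x), omega x ![J x u, J x v] = omega x ![u, v]
  omega_pos : ∀ (x : X) (v : TangentSpace I x), v ≠ 0 → 0 < omega x ![v, J x v]
  /-- `Ω` is holomorphic: in holomorphic coordinates around any point,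
  `Ω = F(z) dz₁ ∧ ⋯ ∧ dzₙ` with `F` holomorphic. -/
  Omega_holomorphic : ∀ x : X, ∃ φ : OpenPartialHomeomorph X (Fin n → ℂ),
    x ∈ φ.source ∧ IsHolomorphicChart I J φ ∧
    ∃ F : (Fin n → ℂ) → ℂ, DifferentiableOn ℂ F φ.target ∧
      ∀ y ∈ φ.source, ∀ u : Fin n → TangentSpace I y,
        Omega y u = F (φ y) * Matrix.det (Matrix.of fun i j : Fin n =>
          coordDiff I φ y (u j) i)
  Omega_ne_zero : ∀ x : X, Omega x ≠ 0
  Omega_normalised : ∀ (x : X) (u : Fin n → TangentSpace I x),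
    (∀ i j, omega x ![u i, J x (u j)] = if i = j then 1 else 0) →
    (∀ i j, omega x ![u i, u j] = 0) → ‖Omega x u‖ = 1

end CalabiYau

/-! ### The space of positive Lagrangians, velocities and geodesics -/

section PositiveLagrangians

variable {V : Type*} [NormedAddCommGroup V] [NormedSpace ℝ V] {H : Type*} [TopologicalSpace H]
  {I : ModelWithCorners ℝ V H} {X : Type*} [TopologicalSpace X] [ChartedSpace H X] {n : ℕ}
  {L : Type*} [TopologicalSpace L] [ChartedSpace (Rn n) L]

variable (I X n) in
/-- An oriented `n`-dimensional submanifold of `X` is recorded as the set of its positively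
oriented tangent frames `(x; u₁, …, uₙ)`. (Every such set used below is of the form
`orientedImage o g` for an embedding `g`.) -/
abbrev FrameSet := Set (Σ x : X, Fin n → TangentSpace I x)

/-- The underlying set of points of an oriented submanifold. -/
def points (Γ : FrameSet I X n) : Set X := Sigma.fst '' Γ

variable (I) in
/-- The image of the oriented manifold `(L, o)` under `g : L → X`, with the pushed forward
orientation. -/
def orientedImage (o : ∀ p : L, Orientation ℝ (TangentSpace (𝓡 n) p) (Fin n)) (g : L → X) :
    FrameSet I X n :=
  {z | ∃ (p : L) (b : Module.Basis (Fin n) ℝ (TangentSpace (𝓡 n) p)), b.orientation = o p ∧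
    z = ⟨g p, fun i => mfderiv (𝓡 n) I g p (b i)⟩}

/-- `g : L → X` is an embedding of class `C^r` with oriented image `Γ`, i.e. `Γ` is an embedded
oriented submanifold and `g` an oriented diffeomorphism from `L` to `Γ`. -/
structure IsParametrization (o : ∀ p : L, Orientation ℝ (TangentSpace (𝓡 n) p) (Fin n)) (r : ℕ∞)
    (Γ : FrameSet I X n) (g : L → X) : Prop where
  contMDiff : ContMDiff (𝓡 n) I r g
  isEmbedding : IsEmbedding g
  immersion : ∀ p : L, Function.Injective (mfderiv (𝓡 n) I g p)
  image_eq : orientedImage I o g = Γ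

/-- The real `n`-form `Re (e^{-√-1 θ} Ω)`. -/
def reForm (Y : CalabiYauStructure I X n) (θ : ℝ) (x : X) (u : Fin n → TangentSpace I x) : ℝ :=
  (Complex.exp (-(θ : ℂ) * Complex.I) * Y.Omega x u).re

/-- `Γ` is a `θ`-positive Lagrangian diffeomorphic to `L`, of class `C^r`: it is
parametrised by `L`, `ω` vanishes on it, and `Re (e^{-√-1 θ} Ω)` is positive on it. -/
def IsPositiveLagrangian (Y : CalabiYauStructure I X n) (θ : ℝ)
    (o : ∀ p : L, Orientation ℝ (TangentSpace (𝓡 n) p) (Fin n)) (r : ℕ∞)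
    (Γ : FrameSet I X n) : Prop :=
  (∃ g : L → X, IsParametrization o r Γ g ∧ ∀ (p : L) (u v : TangentSpace (𝓡 n) p),
    Y.omega (g p) ![mfderiv (𝓡 n) I g p u, mfderiv (𝓡 n) I g p v] = 0) ∧
  ∀ z ∈ Γ, 0 < reForm Y θ z.1 z.2

/-- The integral `∫_L k |g^* Re (e^{-√-1 θ} Ω)|`, by means of a partition of unity `ρ`
subordinate to the charts of `L`. For a parametrisation `g` of a `θ`-positive Lagrangian `Γ`
and `k = h ∘ g` this is `∫_Γ h Re (e^{-√-1 θ} Ω)`. -/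
def formIntegral (Y : CalabiYauStructure I X n) (θ : ℝ) (g : L → X)
    (ρ : SmoothPartitionOfUnity L (𝓡 n) L univ) (k : L → ℝ) : ℝ :=
  ∑ᶠ i : L, ∫ y in (extChartAt (𝓡 n) i).target,
    ρ i ((extChartAt (𝓡 n) i).symm y) * k ((extChartAt (𝓡 n) i).symm y) *
      |reForm Y θ (g ((extChartAt (𝓡 n) i).symm y)) (fun j =>
        mfderiv (𝓡 n) I g ((extChartAt (𝓡 n) i).symm y)
          (mfderiv 𝓘(ℝ, Rn n) (𝓡 n) (extChartAt (𝓡 n) i).symm y (stdVec n j)))|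

/-- The function `h` on `Γ` (only its values on `Γ` matter) is a tangent vector at `Γ` to the
space of positive Lagrangians: it is `C^r` on `Γ`, with `∫_Γ h Re (e^{-√-1 θ} Ω) = 0` if
`Γ ≅ L` is compact, and with compact support in `Γ` if not. (None of this
depends on the parametrisation or on the partition of unity.) -/
def IsTangentVector (Y : CalabiYauStructure I X n) (θ : ℝ)
    (o : ∀ p : L, Orientation ℝ (TangentSpace (𝓡 n) p) (Fin n)) (r : ℕ∞)
    (Γ : FrameSet I X n) (h : X → ℝ) : Prop :=
  ∀ g : L → X, IsParametrization o r Γ g →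
    ContMDiff (𝓡 n) 𝓘(ℝ, ℝ) r (h ∘ g) ∧
    (CompactSpace L → ∀ ρ : SmoothPartitionOfUnity L (𝓡 n) L univ,
      ρ.IsSubordinate (fun i => (chartAt (Rn n) i).source) →
        formIntegral Y θ g ρ (h ∘ g) = 0) ∧
    (¬ CompactSpace L → HasCompactSupport (h ∘ g))

/-- `h` is a field of tangent vectors along the path `(Λ_t)`, `0 ≤ t ≤ 1`; if `L` is not compact
the supports of the `h_t` lie in one compact set. -/
structure IsTangentField (Y : CalabiYauStructure I X n) (θ : ℝ)
    (o : ∀ p : L, Orientation ℝ (TangentSpace (𝓡 n) p) (Fin n)) (r : ℕ∞)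
    (Λ : ℝ → FrameSet I X n) (h : ℝ → X → ℝ) : Prop where
  tangent : ∀ t ∈ Icc (0 : ℝ) 1, IsTangentVector Y θ o r (Λ t) (h t)
  support : ¬ CompactSpace L → ∃ K : Set X, IsCompact K ∧
    ∀ t ∈ Icc (0 : ℝ) 1, ∀ x ∈ points (Λ t), x ∉ K → h t x = 0

variable (I) in
/-- The velocity `dg_t/dt` at `p` of a family of maps `g_t`, `0 ≤ t ≤ 1` (one-sided at the end
points). -/
def timeDeriv (g : ℝ → L → X) (t : ℝ) (p : L) : TangentSpace I (g t p) :=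
  mfderivWithin 𝓘(ℝ, ℝ) I (fun s => g s p) (Icc 0 1) t (1 : ℝ)

/-- `(Λ_t)`, `0 ≤ t ≤ 1`, is a `C^r` path in (a Hamiltonian isotopy class of) the
space of `θ`-positive Lagrangians, `g_t : L → Λ_t` is a family of diffeomorphisms, and
`h_t = dΛ_t/dt` is the velocity of the path: `g_t^* ι_{dg_t/dt} ω = d(h_t ∘ g_t)`, where `h_t`
is a tangent vector at `Λ_t`. -/
structure IsPathWithVelocity (Y : CalabiYauStructure I X n) (θ : ℝ)
    (o : ∀ p : L, Orientation ℝ (TangentSpace (𝓡 n) p) (Fin n)) (r : ℕ∞)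
    (Λ : ℝ → FrameSet I X n) (g : ℝ → L → X) (h : ℝ → X → ℝ) : Prop where
  positiveLagrangian : ∀ t ∈ Icc (0 : ℝ) 1, IsPositiveLagrangian Y θ o r (Λ t)
  parametrization : ∀ t ∈ Icc (0 : ℝ) 1, IsParametrization o r (Λ t) (g t)
  contMDiffOn : ContMDiffOn (𝓘(ℝ, ℝ).prod (𝓡 n)) I r
    (fun z : ℝ × L => g z.1 z.2) (Icc 0 1 ×ˢ univ)
  contMDiffOn_velocity : ContMDiffOn (𝓘(ℝ, ℝ).prod (𝓡 n)) 𝓘(ℝ, ℝ) r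
    (fun z : ℝ × L => h z.1 (g z.1 z.2)) (Icc 0 1 ×ˢ univ)
  tangentField : IsTangentField Y θ o r Λ h
  velocity : ∀ t ∈ Icc (0 : ℝ) 1, ∀ (p : L) (u : TangentSpace (𝓡 n) p),
    Y.omega (g t p) ![timeDeriv I g t p, mfderiv (𝓡 n) I (g t) p u]
      = dFun (h t ∘ g t) p u

/-- `ζ` is the value at `p` of the vector field `ζ_t` on `L` with
`ι_{ζ_t} g_t^* Re (e^{-√-1 θ} Ω) = - g_t^* ι_{dg_t/dt} Re (e^{-√-1 θ} Ω)`.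
(The contracted vector is put in the `i`-th slot on both sides; `i` is arbitrary, by
antisymmetry.) -/
def IsCorrectionVector (Y : CalabiYauStructure I X n) (θ : ℝ) (g : ℝ → L → X) (t : ℝ) (p : L)
    (ζ : TangentSpace (𝓡 n) p) : Prop :=
  ∀ (u : Fin n → TangentSpace (𝓡 n) p) (i : Fin n),
    reForm Y θ (g t p) (fun j => mfderiv (𝓡 n) I (g t) p (Function.update u i ζ j))
      = - reForm Y θ (g t p)
          (Function.update (fun j => mfderiv (𝓡 n) I (g t) p (u j)) i (timeDeriv I g t p))

/-- `(Λ_t)` is a path in the space of `θ`-positive Lagrangians. -/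
def IsPath (Y : CalabiYauStructure I X n) (θ : ℝ)
    (o : ∀ p : L, Orientation ℝ (TangentSpace (𝓡 n) p) (Fin n)) (r : ℕ∞)
    (Λ : ℝ → FrameSet I X n) : Prop :=
  ∃ (g : ℝ → L → X) (h : ℝ → X → ℝ), IsPathWithVelocity Y θ o r Λ g h

/-- `(Λ_t)` is a geodesic in the space of `θ`-positive Lagrangians: the covariant derivative
`D h_t/dt = (∂_t (h_t ∘ g_t) + g_t^* dh_t (ζ_t)) ∘ g_t⁻¹` of its velocity `h_t = dΛ_t/dt`
vanishes. -/
def IsGeodesic (Y : CalabiYauStructure I X n) (θ : ℝ)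
    (o : ∀ p : L, Orientation ℝ (TangentSpace (𝓡 n) p) (Fin n)) (r : ℕ∞)
    (Λ : ℝ → FrameSet I X n) : Prop :=
  ∃ (g : ℝ → L → X) (h : ℝ → X → ℝ), IsPathWithVelocity Y θ o r Λ g h ∧
    ∀ t ∈ Icc (0 : ℝ) 1, ∀ p : L, ∃ ζ : TangentSpace (𝓡 n) p,
      IsCorrectionVector Y θ g t p ζ ∧
      derivWithin (fun s => h s (g s p)) (Icc 0 1) t
        + dFun (h t ∘ g t) p ζ = 0

end PositiveLagrangians

/-! ### The Riemannian Hessian and the Riemannian DSL -/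

section RiemannianDSL

variable {n : ℕ} {M : Type*} [TopologicalSpace M] [ChartedSpace (Rn n) M] [IsManifold (𝓡 n) ∞ M]

variable (n M) in
/-- Smooth Riemannian metrics on `M`. -/
abbrev RiemMetric :=
  Bundle.ContMDiffRiemannianMetric (𝓡 n) ∞ (Rn n) (fun p : M => TangentSpace (𝓡 n) p)

/-- The coefficients `g_{ij}` of the metric in the preferred chart at `p`. -/
def metricMatrix (g : RiemMetric n M) (p : M) (y : Rn n) : Matrix (Fin n) (Fin n) ℝ :=
  Matrix.of fun i j => g.inner ((extChartAt (𝓡 n) p).symm y)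
    (mfderiv 𝓘(ℝ, Rn n) (𝓡 n) (extChartAt (𝓡 n) p).symm y (stdVec n i))
    (mfderiv 𝓘(ℝ, Rn n) (𝓡 n) (extChartAt (𝓡 n) p).symm y (stdVec n j))

/-- The Christoffel symbols `Γ^k_{ij}` of the Levi-Civita connection in the preferred chart
at `p`. -/
def christoffel (g : RiemMetric n M) (p : M) (y : Rn n) (k i j : Fin n) : ℝ :=
  (1 / 2 : ℝ) * ∑ l : Fin n, (metricMatrix g p y)⁻¹ k l *
    (fderiv ℝ (fun w => metricMatrix g p w j l) y (stdVec n i)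
      + fderiv ℝ (fun w => metricMatrix g p w i l) y (stdVec n j)
      - fderiv ℝ (fun w => metricMatrix g p w i j) y (stdVec n l))

/-- The components `(Hess u)(∂_i, ∂_j) = ∂_i ∂_j u - Γ^k_{ij} ∂_k u` at `p` of the Riemannian
Hessian, in the preferred chart at `p`. -/
def hessMatrix (g : RiemMetric n M) (u : M → ℝ) (p : M) (i j : Fin n) : ℝ :=
  let y₀ : Rn n := extChartAt (𝓡 n) p p
  let w : Rn n → ℝ := u ∘ (extChartAt (𝓡 n) p).symm
  fderiv ℝ (fun y => fderiv ℝ w y (stdVec n j)) y₀ (stdVec n i)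
    - ∑ k : Fin n, christoffel g p y₀ k i j * fderiv ℝ w y₀ (stdVec n k)

/-- The components of a tangent vector at `p` in the preferred chart at `p`. -/
def chartVec (p : M) (a : TangentSpace (𝓡 n) p) : Rn n :=
  mfderiv (𝓡 n) 𝓘(ℝ, Rn n) (extChartAt (𝓡 n) p) p a

/-- The Riemannian Hessian `(Hess u)_p (a, b)` with respect to the metric `g`. -/
def riemHess (g : RiemMetric n M) (u : M → ℝ) (p : M) (a b : TangentSpace (𝓡 n) p) : ℝ :=
  ∑ i : Fin n, ∑ j : Fin n,
    chartVec p a i * chartVec p b j * hessMatrix g u p i j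

/-- `∂_t f`, one-sided at the end points of `[0,1]`. -/
def dt (f : ℝ → M → ℝ) (t : ℝ) (p : M) : ℝ := derivWithin (fun s => f s p) (Icc 0 1) t

/-- The matrix `(Hess f)(ē, ē)` at `(t, p)` in the frame `ē = (∂_t, e₁, …, eₙ)`, the Hessian
being that of the product metric `dt² + g` on `[0,1] × M` (for which `∇∂_t = 0`). -/
def spaceTimeHess (g : RiemMetric n M) (f : ℝ → M → ℝ) (t : ℝ) (p : M)
    (e : Fin n → TangentSpace (𝓡 n) p) : Matrix (Unit ⊕ Fin n) (Unit ⊕ Fin n) ℝ :=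
  Matrix.fromBlocks
    (Matrix.of fun _ _ => derivWithin (fun s => dt f s p) (Icc 0 1) t)
    (Matrix.of fun _ j => dFun (dt f t) p (e j))
    (Matrix.of fun i _ => dFun (dt f t) p (e i))
    (Matrix.of fun i j => riemHess g (f t) p (e i) (e j))

/-- The diagonal matrix `diag(0, 1, …, 1)`. -/
def degId (n : ℕ) : Matrix (Unit ⊕ Fin n) (Unit ⊕ Fin n) ℂ := Matrix.fromBlocks 0 0 0 1

/-- `f` satisfies the Riemannian DSL of phase `θ` on `[0,1] × M`: in every orthonormal frame
`e` of `(M, g)`, with `ē = (∂_t, e)`,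
`Im (e^{-√-1 θ} det (diag(0,1,…,1) + √-1 Hess f(ē, ē))) = 0` and
`Re (e^{-√-1 θ} det (1 + √-1 Hess f_t(e, e))) > 0`. -/
def RiemannianDSL (g : RiemMetric n M) (θ : ℝ) (f : ℝ → M → ℝ) : Prop :=
  ∀ t ∈ Icc (0 : ℝ) 1, ∀ (p : M) (e : Fin n → TangentSpace (𝓡 n) p),
    (∀ i j, g.inner p (e i) (e j) = if i = j then 1 else 0) →
    (Complex.exp (-(θ : ℂ) * Complex.I) *
      (degId n + Complex.I • (spaceTimeHess g f t p e).map Complex.ofReal).det).im = 0 ∧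
    0 < (Complex.exp (-(θ : ℂ) * Complex.I) *
      (1 + Complex.I • (Matrix.of fun i j : Fin n =>
        ((riemHess g (f t) p (e i) (e j) : ℝ) : ℂ))).det).re

end RiemannianDSL

/-! ### Integrably parallelizable manifolds and their cotangent bundles -/

section Cotangent

variable {n : ℕ} {M : Type*} [TopologicalSpace M] [ChartedSpace (Rn n) M]

/-- `A` is an integrable `{1}`-structure on the smooth manifold `M`: an atlas of smooth charts
such that the differentials of all transition maps are the identity. -/
structure IsIntegrableParallelization (A : Set (OpenPartialHomeomorph M (Rn n))) : Prop where
  smooth : A ⊆ IsManifold.maximalAtlas (𝓡 n) ∞ M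
  cover : ∀ p : M, ∃ φ ∈ A, p ∈ φ.source
  transition : ∀ φ ∈ A, ∀ ψ ∈ A, ∀ p ∈ φ.source ∩ ψ.source,
    fderiv ℝ (ψ ∘ φ.symm) (φ p) = ContinuousLinearMap.id ℝ (Rn n)

variable [IsManifold (𝓡 n) ∞ M]

variable (n M) in
/-- The total space of the cotangent bundle `T^*M` (with Mathlib's structure of a smooth vector
bundle over `M`, hence of a smooth manifold). -/
abbrev CotangentBundle :=
  Bundle.TotalSpace (Rn n →L[ℝ] ℝ) (fun p : M => TangentSpace (𝓡 n) p →L[ℝ] ℝ)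

variable (n) in
/-- The model with corners of `T^*M`. -/
abbrev cotModel : ModelWithCorners ℝ (Rn n × (Rn n →L[ℝ] ℝ)) (ModelProd (Rn n) (Rn n →L[ℝ] ℝ)) :=
  (𝓡 n).prod 𝓘(ℝ, Rn n →L[ℝ] ℝ)

/-- The coordinate vector `∂/∂xⁱ` at `p` of the chart `φ`. -/
def coordVec (φ : OpenPartialHomeomorph M (Rn n)) (p : M) (i : Fin n) : TangentSpace (𝓡 n) p :=
  (mfderiv (𝓡 n) 𝓘(ℝ, Rn n) φ p).inverse (stdVec n i)

/-- The coordinates `(x, ξ)` on `T^*M` induced by the coordinates `x = φ` on `M`, a covector being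
`∑ ξⁱ dxⁱ`, written as the complex coordinates `zᵢ = xᵢ + √-1 ξᵢ`. -/
def cotCoord (φ : OpenPartialHomeomorph M (Rn n)) (q : CotangentBundle n M) : Fin n → ℂ :=
  fun i => ⟨(φ q.proj : Rn n) i, q.2 (coordVec φ q.proj i)⟩

/-- The differentials `dzᵢ = dxᵢ + √-1 dξᵢ` of the induced coordinates on `T^*M`. -/
def dz (φ : OpenPartialHomeomorph M (Rn n)) (q : CotangentBundle n M)
    (u : TangentSpace (cotModel n) q) (i : Fin n) : ℂ :=
  coordDiff (cotModel n) (cotCoord φ) q u i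

/-- The Calabi–Yau structure on `T^*M` is the one of the global frame
`vᵢ = ∂/∂xⁱ`, `wᵢ = ∂/∂ξⁱ` of the coordinates induced by the charts in `A`:
`J vᵢ = wᵢ`, `J wᵢ = -vᵢ`, `ω = ∑ vᵢ^* ∧ wᵢ^*`,
`Ω = (v₁^* + √-1 w₁^*) ∧ ⋯ ∧ (vₙ^* + √-1 wₙ^*)`. -/
structure IsFrameCalabiYau (A : Set (OpenPartialHomeomorph M (Rn n)))
    (Y : CalabiYauStructure (cotModel n) (CotangentBundle n M) n) : Prop where
  J_eq : ∀ φ ∈ A, ∀ q : CotangentBundle n M, q.proj ∈ φ.source →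
    ∀ (u : TangentSpace (cotModel n) q) (i : Fin n),
      dz φ q (Y.J q u) i = Complex.I * dz φ q u i
  omega_eq : ∀ φ ∈ A, ∀ q : CotangentBundle n M, q.proj ∈ φ.source →
    ∀ u w : TangentSpace (cotModel n) q,
      Y.omega q ![u, w] = ∑ i : Fin n,
        ((dz φ q u i).re * (dz φ q w i).im - (dz φ q u i).im * (dz φ q w i).re)
  Omega_eq : ∀ φ ∈ A, ∀ q : CotangentBundle n M, q.proj ∈ φ.source →
    ∀ u : Fin n → TangentSpace (cotModel n) q,
      Y.Omega q u = Matrix.det (Matrix.of fun i j : Fin n => dz φ q (u j) i)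

/-- `g` is the (flat) metric on `M` for which the global frame `vᵢ = ∂/∂xⁱ` is orthonormal. -/
def IsFrameMetric (A : Set (OpenPartialHomeomorph M (Rn n))) (g : RiemMetric n M) : Prop :=
  ∀ φ ∈ A, ∀ p ∈ φ.source, ∀ i j : Fin n,
    g.inner p (coordVec φ p i) (coordVec φ p j) = if i = j then 1 else 0

/-- `o` is the orientation of `M` for which the global frame `vᵢ = ∂/∂xⁱ` is positive. -/
def IsFrameOrientation (A : Set (OpenPartialHomeomorph M (Rn n)))
    (o : ∀ p : M, Orientation ℝ (TangentSpace (𝓡 n) p) (Fin n)) : Prop :=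
  ∀ φ ∈ A, ∀ p ∈ φ.source, ∀ b : Module.Basis (Fin n) ℝ (TangentSpace (𝓡 n) p),
    (∀ i, b i = coordVec φ p i) → b.orientation = o p

/-- The section `p ↦ (p, df|_p)` of `T^*M`. -/
def dSection (f : M → ℝ) (p : M) : CotangentBundle n M :=
  ⟨p, dFun f p⟩

/-- The path of oriented submanifolds `Λ_t = graph(df_t)` of `T^*M`, oriented by `M`. -/
def gradGraph (o : ∀ p : M, Orientation ℝ (TangentSpace (𝓡 n) p) (Fin n)) (f : ℝ → M → ℝ)
    (t : ℝ) : FrameSet (cotModel n) (CotangentBundle n M) n :=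
  orientedImage (cotModel n) o (dSection (f t))

/-- The potential `f_t` of the path `graph(df_t)` is normalised: the functions `-∂_t f_t`,
carried to `graph(df_t)` by the projection `T^*M → M`, are tangent vectors to the space
of positive Lagrangians along the path. -/
def IsNormalised (Y : CalabiYauStructure (cotModel n) (CotangentBundle n M) n) (θ : ℝ)
    (o : ∀ p : M, Orientation ℝ (TangentSpace (𝓡 n) p) (Fin n)) (r : ℕ∞) (f : ℝ → M → ℝ) : Prop :=
  IsTangentField Y θ o r (gradGraph o f) (fun t q => -dt f t q.proj)

end Cotangent

end PosLag

end

open PosLag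

open Set Topology MeasureTheory
open scoped Manifold ContDiff

set_option linter.unusedSectionVars false

noncomputable section

/-! The transition maps of `A` have identity differential, so two charts of `A` differ locally by a
translation. Hence the `dxᵢ`, the `∂/∂xᵢ` and the fibre coordinates `ξⁱ` do not depend on the chart,
and `dz = dx + √-1 dξ` is a global coframe of `T^*M`. The Calabi–Yau structure is the pullback of
the flat structure of `ℂⁿ` by this coframe. In the induced charts it has constant coefficients,
which gives integrability, closedness and holomorphy. Likewise the Hessian of the flat metric is the
matrix of second derivatives in a chart of `A` (`riemHess_eq`).

Write `c = e^{-√-1 θ}`, `H = Hess f_t`, `B = 1 + √-1 H`, `a` for the gradient of `∂_t f` and `s =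
∂_t² f`. A parametrisation `g_t` of `graph(df_t)` is `df_t` composed with its base component `γ_t`.
In the coordinates `z`, its space derivative is `B dγ_t` and its time derivative is `B v + √-1 a`,
with `v = dγ_t/dt`. By symmetry of second derivatives, `g_t^* ι_{dg_t/dt} ω` reduces to `-d(∂_t f_t
∘ γ_t)` (`IsGraphFamily.omega_timeDeriv`). On a connected `M` the velocity is therefore `b(t) - ∂_t
f_t` (`exists_velocity_eq`), and adding to `f` a primitive of `-b` proves (i).

For (ii), put `w = v + dγ_t(ζ)`. Cramer's rule turns the equation defining `ζ` into `w_j Re(c det B)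
= Im(c adj(B) a)_j` (`re_det_updateCol`). A Schur complement gives `√-1 s det B + aᵀ adj(B) a` for
the determinant of the DSL, so the imaginary part after multiplication by `c` is `(s + a·w) Re(c det
B)` (`im_det_degId_add`). Now `s + a·w` is the time derivative of `∂_t f_t ∘ γ_t` plus its
differential on `ζ`, which is minus the covariant derivative of the velocity as soon as `b` is
constant (`IsGraphFamily.localDSL_eq`). Positivity makes the other factor nonzero.

Normalisation makes `b` constant: the velocity and `-∂_t f_t - k` are tangent vectors at the same
`Λ_t` and differ by `b(t) + k`. A constant tangent vector vanishes, by its integral if `M` is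
compact and by its support if not (`eq_zero_of_isTangentVector`). -/

namespace PosLag

/-! ### Flat forms on `ℂⁿ`. -/

section StandardForms

variable (n : ℕ)

/-- The standard symplectic form of `ℂⁿ`. -/
def stdOmega : (Fin n → ℂ) [⋀^Fin 2]→L[ℝ] ℝ where
  toFun u := ∑ i : Fin n, ((u 0 i).re * (u 1 i).im - (u 0 i).im * (u 1 i).re)
  map_update_add' {d} m i x y := by
    -- The field quantifies over all decidability instances; they coincide, and the simplifier needs
    -- the canonical one.
    have : d = instDecidableEqFin 2 := Subsingleton.elim _ _
    subst this
    fin_cases i <;> simp [-Finset.sum_sub_distrib, ← Finset.sum_add_distrib] <;>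
      exact Finset.sum_congr rfl fun j _ => by ring
  map_update_smul' {d} m i c x := by
    have : d = instDecidableEqFin 2 := Subsingleton.elim _ _
    subst this
    fin_cases i <;> simp [-Finset.sum_sub_distrib, Finset.mul_sum] <;>
      exact Finset.sum_congr rfl fun j _ => by ring
  cont := by fun_prop
  map_eq_zero_of_eq' v i j hv hij := by
    have : v 0 = v 1 := by
      fin_cases i <;> fin_cases j <;> simp_all
    simp only [this]
    refine Finset.sum_eq_zero fun k _ => by ring

/-- The standard complex volume form of `ℂⁿ`. -/
def stdVol : (Fin n → ℂ) [⋀^Fin n]→L[ℝ] ℂ where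
  toFun u := (Matrix.of fun i j : Fin n => u j i).det
  map_update_add' {d} m i x y := by
    have := (Matrix.detRowAlternating (n := Fin n) (R := ℂ)).map_update_add m i x y
    have h : d = instDecidableEqFin n := Subsingleton.elim _ _
    subst h
    rw [← Matrix.det_transpose, ← Matrix.det_transpose (Matrix.of fun i_1 j => Function.update m i x j i_1),
      ← Matrix.det_transpose (Matrix.of fun i_1 j => Function.update m i y j i_1)]
    exact this
  map_update_smul' {d} m i c x := by
    have := (Matrix.detRowAlternating (n := Fin n) (R := ℂ)).map_update_smul m i (c : ℂ) x
    have h : d = instDecidableEqFin n := Subsingleton.elim _ _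
    subst h
    rw [← Matrix.det_transpose, ← Matrix.det_transpose (Matrix.of fun i_1 j => Function.update m i x j i_1)]
    have e : (c : ℂ) • x = c • x := by ext; simp
    rw [e] at this
    rw [← Complex.coe_smul]
    exact this
  cont := by
    exact Continuous.matrix_det (by fun_prop)
  map_eq_zero_of_eq' v i j hv hij := by
    refine Matrix.det_zero_of_column_eq hij fun k => ?_
    simp [hv]

lemma stdVol_apply (u : Fin n → Fin n → ℂ) :
    stdVol n u = (Matrix.of fun i j : Fin n => u j i).det := rfl

end StandardForms

/-! ### Determinant identities linking the geodesic equation and the DSL. -/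

section Determinants

variable {n : ℕ}

/-- The new column is `B y` with `y = w + √-1 B⁻¹ a`, so `B` factors out of the matrix and Cramer's
rule expands what is left along `adj U`. As `U` and `w` are real, only `c det B` and `c adj(B) a`
are split into real and imaginary parts. Taking `U = 1` isolates one equation for each `w j`. -/
lemma re_det_updateCol (c : ℂ) (U : Matrix (Fin n) (Fin n) ℝ) (a w : Fin n → ℝ) (i : Fin n)
    (B : Matrix (Fin n) (Fin n) ℂ) (hB : B.det ≠ 0) :
    (c * ((B * U.map Complex.ofReal).updateCol i
      (B.mulVec (fun j => (w j : ℂ)) + Complex.I • fun j => (a j : ℂ))).det).re =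
    ∑ j, U.adjugate i j *
      (w j * (c * B.det).re - (c * B.adjugate.mulVec (fun j => (a j : ℂ)) j).im) := by
  set y : Fin n → ℂ := (fun j => (w j : ℂ)) +
    (Complex.I / B.det) • B.adjugate.mulVec (fun j => (a j : ℂ)) with hy
  have h1 : B.mulVec (fun j => (w j : ℂ)) + Complex.I • (fun j => (a j : ℂ)) = B.mulVec y := by
    rw [hy, Matrix.mulVec_add, Matrix.mulVec_smul, Matrix.mulVec_mulVec, Matrix.mul_adjugate,
      Matrix.smul_mulVec, Matrix.one_mulVec, smul_smul, div_mul_cancel₀ _ hB]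
  have h2 : (B * U.map Complex.ofReal).updateCol i (B.mulVec y)
      = B * (U.map Complex.ofReal).updateCol i y := by
    ext k l
    by_cases h : l = i
    · subst h
      simp [Matrix.mul_apply, Matrix.mulVec, dotProduct]
    · simp [Matrix.mul_apply, h]
  have h3 : ((U.map Complex.ofReal).updateCol i y).det = ∑ j, (U.adjugate i j : ℂ) * y j := by
    rw [← Matrix.cramer_apply, Matrix.cramer_eq_adjugate_mulVec]
    have : (U.map Complex.ofReal).adjugate = U.adjugate.map Complex.ofReal :=
      (RingHom.map_adjugate Complex.ofRealHom U).symm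
    rw [this]
    rfl
  rw [h1, h2, Matrix.det_mul, h3, Finset.mul_sum, Finset.mul_sum, Complex.re_sum]
  refine Finset.sum_congr rfl fun j _ => ?_
  have h4 : c * (B.det * ((U.adjugate i j : ℂ) * y j)) =
      ((U.adjugate i j : ℝ) : ℂ) * ((w j : ℝ) * (c * B.det) +
        Complex.I * (c * B.adjugate.mulVec (fun j => (a j : ℂ)) j)) := by
    simp only [hy, Pi.add_apply, Pi.smul_apply, smul_eq_mul]
    field_simp
  rw [h4, Complex.re_ofReal_mul, Complex.add_re, Complex.re_ofReal_mul, Complex.I_mul_re]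
  ring

/-- Schur complement with respect to the invertible block `B`; the two factors `√-1` of the
off-diagonal blocks turn its minus sign into a plus. -/
lemma det_degId_add (s : ℝ) (a : Fin n → ℝ) (H : Matrix (Fin n) (Fin n) ℝ)
    (hB : (1 + Complex.I • H.map Complex.ofReal : Matrix (Fin n) (Fin n) ℂ).det ≠ 0) :
    (degId n + Complex.I • (Matrix.fromBlocks (Matrix.of fun _ _ : Unit => s)
      (Matrix.of fun _ j => a j) (Matrix.of fun i _ => a i) H).map Complex.ofReal).det =
    Complex.I * s * (1 + Complex.I • H.map Complex.ofReal : Matrix (Fin n) (Fin n) ℂ).det +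
      ∑ j, a j * (1 + Complex.I • H.map Complex.ofReal :
        Matrix (Fin n) (Fin n) ℂ).adjugate.mulVec (fun j => (a j : ℂ)) j := by
  set B := (1 + Complex.I • H.map Complex.ofReal : Matrix (Fin n) (Fin n) ℂ)
  have h : degId n + Complex.I • (Matrix.fromBlocks (Matrix.of fun _ _ : Unit => s)
      (Matrix.of fun _ j => a j) (Matrix.of fun i _ => a i) H).map Complex.ofReal =
      Matrix.fromBlocks (Matrix.of fun _ _ : Unit => Complex.I * s)
      (Matrix.of fun _ j => Complex.I * a j) (Matrix.of fun i _ => Complex.I * a i) B := by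
    rw [degId, Matrix.fromBlocks_map, Matrix.fromBlocks_smul, Matrix.fromBlocks_add]
    congr 1 <;> ext <;> simp
  have : Invertible B := Matrix.invertibleOfIsUnitDet B (isUnit_iff_ne_zero.2 hB)
  rw [h, Matrix.det_fromBlocks₂₂, Matrix.det_unique (n := Unit)]
  simp only [Matrix.sub_apply, Matrix.of_apply, Matrix.mul_apply, Matrix.mulVec, dotProduct,
    Matrix.invOf_eq_nonsing_inv, Matrix.inv_def, Ring.inverse_eq_inv', Matrix.smul_apply,
    smul_eq_mul]
  rw [mul_sub, mul_comm B.det, sub_eq_add_neg]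
  congr 1
  rw [Finset.mul_sum, ← Finset.sum_neg_distrib]
  simp only [Finset.mul_sum, Finset.sum_mul, ← Finset.sum_neg_distrib]
  rw [Finset.sum_comm]
  refine Finset.sum_congr rfl fun i _ => Finset.sum_congr rfl fun j _ => ?_
  field_simp
  rw [Complex.I_sq]
  ring

/-- The hypothesis `hw` is the equation of the correction vector. It replaces `Im(c adj(B) a)` by a
multiple of `w`, after which the phase `Re(c det B)` factors out. -/
lemma im_det_degId_add (c : ℂ) (s : ℝ) (a w : Fin n → ℝ) (H : Matrix (Fin n) (Fin n) ℝ)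
    (hB : (1 + Complex.I • H.map Complex.ofReal : Matrix (Fin n) (Fin n) ℂ).det ≠ 0)
    (hw : ∀ j, w j * (c * (1 + Complex.I • H.map Complex.ofReal :
        Matrix (Fin n) (Fin n) ℂ).det).re - (c * (1 + Complex.I • H.map Complex.ofReal :
        Matrix (Fin n) (Fin n) ℂ).adjugate.mulVec (fun j => (a j : ℂ)) j).im = 0) :
    (c * (degId n + Complex.I • (Matrix.fromBlocks (Matrix.of fun _ _ : Unit => s)
      (Matrix.of fun _ j => a j) (Matrix.of fun i _ => a i) H).map Complex.ofReal).det).im =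
    (s + ∑ j, a j * w j) * (c * (1 + Complex.I • H.map Complex.ofReal :
        Matrix (Fin n) (Fin n) ℂ).det).re := by
  rw [det_degId_add s a H hB]
  set B := (1 + Complex.I • H.map Complex.ofReal : Matrix (Fin n) (Fin n) ℂ)
  have h1 : c * (Complex.I * s * B.det + ∑ j, a j * B.adjugate.mulVec (fun j => (a j : ℂ)) j) =
      Complex.I * ((s : ℝ) * (c * B.det)) +
        ∑ j, (a j : ℂ) * (c * B.adjugate.mulVec (fun j => (a j : ℂ)) j) := by
    rw [mul_add, Finset.mul_sum]
    congr 1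
    · ring
    · exact Finset.sum_congr rfl fun j _ => by ring
  rw [h1, Complex.add_im, Complex.I_mul_im, Complex.re_ofReal_mul, Complex.im_sum, add_mul,
    Finset.sum_mul]
  congr 1
  refine Finset.sum_congr rfl fun j _ => ?_
  rw [Complex.im_ofReal_mul, mul_assoc]
  congr 1
  linarith [hw j]

lemma map_ofReal_mul {k l m : Type*} [Fintype l] (X : Matrix k l ℝ) (Y : Matrix l m ℝ) :
    (X * Y).map Complex.ofReal = X.map Complex.ofReal * Y.map Complex.ofReal :=
  Matrix.map_mul (f := Complex.ofRealHom)

lemma transpose_mul_map_ofReal {m : Type*} [Fintype m] [DecidableEq m] {P : Matrix m m ℝ}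
    (hP : P.transpose * P = 1) :
    (P.map Complex.ofReal).transpose * P.map Complex.ofReal = 1 := by
  rw [← Matrix.transpose_map, ← map_ofReal_mul, hP]
  simp

/-- The matrix on the left is congruent, by an orthogonal `Q`, to the one on the right, and `(det
Q)² = 1`. Transposes rather than adjoints are used, since `Q` is real. -/
lemma det_one_add_congr (P H : Matrix (Fin n) (Fin n) ℝ) (hP : P.transpose * P = 1) :
    (1 + Complex.I • (P.transpose * H * P).map Complex.ofReal : Matrix (Fin n) (Fin n) ℂ).det =
    (1 + Complex.I • H.map Complex.ofReal : Matrix (Fin n) (Fin n) ℂ).det := by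
  set Q : Matrix (Fin n) (Fin n) ℂ := P.map Complex.ofReal
  have hQ : Q.transpose * Q = 1 := transpose_mul_map_ofReal hP
  have h : (1 + Complex.I • (P.transpose * H * P).map Complex.ofReal : Matrix (Fin n) (Fin n) ℂ) =
      Q.transpose * (1 + Complex.I • H.map Complex.ofReal) * Q := by
    rw [mul_add, add_mul, mul_one, hQ]
    congr 1
    rw [Matrix.mul_smul, Matrix.smul_mul]
    congr 1
    rw [map_ofReal_mul, map_ofReal_mul, Matrix.transpose_map]
  have hd : Q.det * Q.det = 1 := by simpa using congrArg Matrix.det hQ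
  rw [h, Matrix.det_mul, Matrix.det_mul, Matrix.det_transpose, mul_right_comm, hd, one_mul]

/-- Congruence by the orthogonal matrix `1 ⊕ P` fixes `diag(0,1,…,1)`. This makes the DSL
independent of the orthonormal frame. -/
lemma det_degId_add_congr (s : ℝ) (a : Fin n → ℝ) (P H : Matrix (Fin n) (Fin n) ℝ)
    (hP : P.transpose * P = 1) :
    (degId n + Complex.I • (Matrix.fromBlocks (Matrix.of fun _ _ : Unit => s)
      (Matrix.of fun _ j => ∑ i, a i * P i j) (Matrix.of fun j _ => ∑ i, a i * P i j)
      (P.transpose * H * P)).map Complex.ofReal).det =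
    (degId n + Complex.I • (Matrix.fromBlocks (Matrix.of fun _ _ : Unit => s)
      (Matrix.of fun _ j => a j) (Matrix.of fun i _ => a i) H).map Complex.ofReal).det := by
  set R : Matrix (Unit ⊕ Fin n) (Unit ⊕ Fin n) ℝ := Matrix.fromBlocks 1 0 0 P with hR
  set Q : Matrix (Unit ⊕ Fin n) (Unit ⊕ Fin n) ℂ := R.map Complex.ofReal with hQdef
  have hR1 : R.transpose * R = 1 := by
    rw [hR, Matrix.fromBlocks_transpose, Matrix.fromBlocks_multiply]
    simp [hP]
  have hQ : Q.transpose * Q = 1 := transpose_mul_map_ofReal hR1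
  have hd : Q.det * Q.det = 1 := by simpa using congrArg Matrix.det hQ
  have hQb : Q = Matrix.fromBlocks 1 0 0 (P.map Complex.ofReal) := by
    rw [hQdef, hR, Matrix.fromBlocks_map]
    simp
  have hPc : (P.map Complex.ofReal).transpose * P.map Complex.ofReal = 1 :=
    transpose_mul_map_ofReal hP
  have hdeg : Q.transpose * degId n * Q = degId n := by
    rw [hQb, degId, Matrix.fromBlocks_transpose, Matrix.fromBlocks_multiply,
      Matrix.fromBlocks_multiply]
    simp [hPc]
  set X := Matrix.fromBlocks (Matrix.of fun _ _ : Unit => s)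
      (Matrix.of fun _ j => a j) (Matrix.of fun i _ => a i) H with hX
  have hXR : Matrix.fromBlocks (Matrix.of fun _ _ : Unit => s)
      (Matrix.of fun _ j => ∑ i, a i * P i j) (Matrix.of fun j _ => ∑ i, a i * P i j)
      (P.transpose * H * P) = R.transpose * X * R := by
    rw [hR, hX, Matrix.fromBlocks_transpose, Matrix.fromBlocks_multiply,
      Matrix.fromBlocks_multiply]
    congr 1 <;> ext i j <;> simp [Matrix.mul_apply, mul_comm]
  have hm : (R.transpose * X * R).map Complex.ofReal
      = Q.transpose * X.map Complex.ofReal * Q := by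
    rw [map_ofReal_mul, map_ofReal_mul, Matrix.transpose_map]
  have h : degId n + Complex.I • (R.transpose * X * R).map Complex.ofReal =
      Q.transpose * (degId n + Complex.I • X.map Complex.ofReal) * Q := by
    rw [mul_add, add_mul, hdeg, hm, Matrix.mul_smul, Matrix.smul_mul]
  rw [hXR, h, Matrix.det_mul, Matrix.det_mul, Matrix.det_transpose, mul_right_comm, hd, one_mul]

end Determinants

/-! ### Coordinate frames, and their independence of the chart of the parallelization. -/

section Charts

variable {n : ℕ} {M : Type*} [TopologicalSpace M] [ChartedSpace (Rn n) M] [IsManifold (𝓡 n) ∞ M]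
  {φ ψ : OpenPartialHomeomorph M (Rn n)} {p : M}

lemma mdifferentiable_of_mem_maximalAtlas (h : φ ∈ IsManifold.maximalAtlas (𝓡 n) ∞ M) :
    φ.MDifferentiable (𝓡 n) (𝓡 n) :=
  ⟨(contMDiffOn_of_mem_maximalAtlas h).mdifferentiableOn (by simp),
    (contMDiffOn_symm_of_mem_maximalAtlas h).mdifferentiableOn (by simp)⟩

/-- The differential of a chart, with values in `ℝⁿ`. -/
def chartDiff (φ : M → Rn n) (p : M) : TangentSpace (𝓡 n) p →L[ℝ] Rn n :=
  mfderiv (𝓡 n) 𝓘(ℝ, Rn n) φ p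

/-- The differential of a smooth chart at a point of its domain. -/
def chartEquiv (h : φ ∈ IsManifold.maximalAtlas (𝓡 n) ∞ M) (hp : p ∈ φ.source) :
    TangentSpace (𝓡 n) p ≃L[ℝ] Rn n :=
  (mdifferentiable_of_mem_maximalAtlas h).mfderiv hp

lemma coe_chartEquiv (h : φ ∈ IsManifold.maximalAtlas (𝓡 n) ∞ M) (hp : p ∈ φ.source) :
    (chartEquiv h hp : TangentSpace (𝓡 n) p →L[ℝ] Rn n) = chartDiff φ p := rfl

lemma chartEquiv_apply (h : φ ∈ IsManifold.maximalAtlas (𝓡 n) ∞ M) (hp : p ∈ φ.source)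
    (v : TangentSpace (𝓡 n) p) : chartEquiv h hp v = chartDiff φ p v := rfl

lemma coe_chartEquiv_symm (h : φ ∈ IsManifold.maximalAtlas (𝓡 n) ∞ M) (hp : p ∈ φ.source) :
    ((chartEquiv h hp).symm : Rn n →L[ℝ] TangentSpace (𝓡 n) p) =
      mfderiv 𝓘(ℝ, Rn n) (𝓡 n) φ.symm (φ p) := rfl

lemma coordVec_eq (h : φ ∈ IsManifold.maximalAtlas (𝓡 n) ∞ M) (hp : p ∈ φ.source) (i : Fin n) :
    coordVec φ p i = (chartEquiv h hp).symm (stdVec n i) := by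
  change (chartDiff φ p).inverse (stdVec n i) = _
  rw [← coe_chartEquiv h hp, ContinuousLinearMap.inverse_equiv]
  rfl

lemma chartDiff_coordVec (h : φ ∈ IsManifold.maximalAtlas (𝓡 n) ∞ M) (hp : p ∈ φ.source)
    (i : Fin n) : chartDiff φ p (coordVec φ p i) = stdVec n i := by
  rw [coordVec_eq h hp]
  exact (chartEquiv h hp).apply_symm_apply _

/-- The coordinate frame of a smooth chart. -/
def coordBasis (h : φ ∈ IsManifold.maximalAtlas (𝓡 n) ∞ M) (hp : p ∈ φ.source) :
    Module.Basis (Fin n) ℝ (TangentSpace (𝓡 n) p) :=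
  (EuclideanSpace.basisFun (Fin n) ℝ).toBasis.map (chartEquiv h hp).symm.toLinearEquiv

lemma coordBasis_apply (h : φ ∈ IsManifold.maximalAtlas (𝓡 n) ∞ M) (hp : p ∈ φ.source)
    (i : Fin n) : coordBasis h hp i = coordVec φ p i := by
  rw [coordVec_eq h hp]
  simp [coordBasis, stdVec]

lemma sum_smul_stdVec (x : Rn n) : ∑ i, x i • stdVec n i = x := by
  have := (EuclideanSpace.basisFun (Fin n) ℝ).sum_repr x
  simpa [stdVec] using this

lemma stdVec_apply (i j : Fin n) : stdVec n i j = if j = i then 1 else 0 := by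
  simp [stdVec]

lemma eq_sum_coordVec (h : φ ∈ IsManifold.maximalAtlas (𝓡 n) ∞ M) (hp : p ∈ φ.source)
    (v : TangentSpace (𝓡 n) p) :
    v = ∑ i, chartDiff φ p v i • coordVec φ p i := by
  apply (chartEquiv h hp).injective
  rw [map_sum]
  simp only [map_smul, chartEquiv_apply, chartDiff_coordVec h hp]
  exact (sum_smul_stdVec _).symm

variable {A : Set (OpenPartialHomeomorph M (Rn n))}

/-- Near `p` the chart `ψ` is the transition map after `φ`, and the transition map has identity
differential. All the global frames rest on this. -/
lemma IsIntegrableParallelization.chartDiff_eq (hA : IsIntegrableParallelization A)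
    (hφ : φ ∈ A) (hψ : ψ ∈ A) (hp : p ∈ φ.source) (hp' : p ∈ ψ.source) :
    chartDiff ψ p = chartDiff φ p := by
  have hd := mdifferentiable_of_mem_maximalAtlas (hA.smooth hφ)
  have hd' := mdifferentiable_of_mem_maximalAtlas (hA.smooth hψ)
  have h1 : mfderiv (𝓡 n) 𝓘(ℝ, Rn n) (ψ ∘ φ.symm) (φ p) = ContinuousLinearMap.id ℝ (Rn n) := by
    rw [mfderiv_eq_fderiv]
    exact hA.transition φ hφ ψ hψ p ⟨hp, hp'⟩
  have h2 : (ψ ∘ φ.symm) ∘ φ =ᶠ[𝓝 p] ψ := by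
    filter_upwards [φ.open_source.mem_nhds hp] with x hx
    simp [φ.left_inv hx]
  have h3 : MDifferentiableAt (𝓡 n) 𝓘(ℝ, Rn n) (ψ ∘ φ.symm) (φ p) := by
    refine MDifferentiableAt.comp (φ p) (I' := 𝓡 n) ?_ (hd.mdifferentiableAt_symm (φ.map_source hp))
    rw [φ.left_inv hp]
    exact hd'.mdifferentiableAt hp'
  unfold chartDiff
  rw [← h2.mfderiv_eq, mfderiv_comp p h3 (hd.mdifferentiableAt hp), h1]
  rfl

lemma IsIntegrableParallelization.coordVec_eq (hA : IsIntegrableParallelization A)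
    (hφ : φ ∈ A) (hψ : ψ ∈ A) (hp : p ∈ φ.source) (hp' : p ∈ ψ.source) (i : Fin n) :
    coordVec ψ p i = coordVec φ p i := by
  rw [PosLag.coordVec_eq (hA.smooth hψ) hp', PosLag.coordVec_eq (hA.smooth hφ) hp]
  congr 2
  exact ContinuousLinearEquiv.coe_injective (hA.chartDiff_eq hφ hψ hp hp')

end Charts

/-! ### The complex coordinates on the cotangent bundle. -/

section CotangentCharts

variable {n : ℕ} {M : Type*} [TopologicalSpace M] [ChartedSpace (Rn n) M] [IsManifold (𝓡 n) ∞ M]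
  {φ ψ : OpenPartialHomeomorph M (Rn n)} {p : M}

/-- The base component of the complex coordinates. -/
def basePart (n : ℕ) : (Fin n → ℂ) →L[ℝ] Rn n :=
  (EuclideanSpace.equiv (Fin n) ℝ).symm.toContinuousLinearMap ∘L
    ContinuousLinearMap.pi fun i => Complex.reCLM ∘L ContinuousLinearMap.proj i

/-- The fibre component of the complex coordinates, as a covector. -/
def fibrePart (n : ℕ) : (Fin n → ℂ) →L[ℝ] (Rn n →L[ℝ] ℝ) :=
  ∑ i, (Complex.imCLM ∘L ContinuousLinearMap.proj i).smulRight
    (EuclideanSpace.proj i : Rn n →L[ℝ] ℝ)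

@[simp] lemma basePart_apply (z : Fin n → ℂ) (i : Fin n) : basePart n z i = (z i).re := rfl

lemma fibrePart_apply (z : Fin n → ℂ) (x : Rn n) : fibrePart n z x = ∑ i, (z i).im * x i := by
  simp [fibrePart]

/-- The trivialization of the hom bundle turns the covector into the derivative read in tangent
coordinates, which is smooth in the parameter with the loss of one derivative. -/
lemma contMDiffAt_dFun {EN : Type*} [NormedAddCommGroup EN] [NormedSpace ℝ EN] {HN : Type*}
    [TopologicalSpace HN] {J : ModelWithCorners ℝ EN HN} {N : Type*} [TopologicalSpace N]
    [ChartedSpace HN N] [IsManifold J 1 N] {m k : WithTop ℕ∞} {x₀ : N} (f : N → M → ℝ) (g : N → M)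
    (hf : ContMDiffAt (J.prod (𝓡 n)) 𝓘(ℝ, ℝ) k (Function.uncurry f) (x₀, g x₀))
    (hg : ContMDiffAt J (𝓡 n) m g x₀) (hmk : m + 1 ≤ k) :
    ContMDiffAt J (cotModel n) m (fun x => (⟨g x, dFun (f x) (g x)⟩ : CotangentBundle n M)) x₀ := by
  have : IsManifold (𝓡 n) 1 M := IsManifold.of_le (n := ∞) (by simp)
  refine (contMDiffAt_hom_bundle (E₁ := fun p : M => TangentSpace (𝓡 n) p) (E₂ := Bundle.Trivial M ℝ) _).2 ⟨hg, ?_⟩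
  have := ContMDiffAt.mfderiv f g hf hg hmk
  refine this.congr_of_eventuallyEq (Filter.Eventually.of_forall fun x => ?_)
  ext v
  simp [inTangentCoordinates, ContinuousLinearMap.inCoordinates]
  rfl

/-- The complex coordinates induced by a smooth chart, as a chart of the cotangent bundle. -/
def cotChartSymm (φ : OpenPartialHomeomorph M (Rn n)) (z : Fin n → ℂ) : CotangentBundle n M :=
  ⟨φ.symm (basePart n z), dFun (fun p => fibrePart n z (φ p)) (φ.symm (basePart n z))⟩

lemma dFun_clm_comp (h : φ ∈ IsManifold.maximalAtlas (𝓡 n) ∞ M) (hp : p ∈ φ.source)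
    (l : Rn n →L[ℝ] ℝ) : dFun (fun p => l (φ p)) p = l ∘L chartDiff φ p := by
  have h1 := (mdifferentiable_of_mem_maximalAtlas h).mdifferentiableAt hp
  unfold dFun chartDiff
  change mfderiv (𝓡 n) 𝓘(ℝ, ℝ) (l ∘ φ) p = _
  have h2 : MDifferentiableAt 𝓘(ℝ, Rn n) 𝓘(ℝ, ℝ) l (φ p) :=
    l.differentiableAt.mdifferentiableAt
  rw [mfderiv_comp p h2 h1, mfderiv_eq_fderiv, l.fderiv]
  rfl

/-- The covector `∑ ξⁱ dxⁱ` is the differential of `p ↦ ∑ ξⁱ xᵢ(p)`, a function depending smoothly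
on `ξ`; so `contMDiffAt_dFun` applies. -/
lemma contMDiffAt_cotChartSymm (h : φ ∈ IsManifold.maximalAtlas (𝓡 n) ∞ M) {z : Fin n → ℂ}
    (hz : basePart n z ∈ φ.target) :
    ContMDiffAt 𝓘(ℝ, Fin n → ℂ) (cotModel n) ∞ (cotChartSymm φ) z := by
  refine contMDiffAt_dFun (k := ∞) (fun z p => fibrePart n z (φ p))
    (fun z => φ.symm (basePart n z)) ?_ ?_ (by simp)
  · have h1 : ContMDiffAt (𝓘(ℝ, Fin n → ℂ).prod (𝓡 n)) 𝓘(ℝ, Rn n →L[ℝ] ℝ) ∞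
        (fun x : (Fin n → ℂ) × M => fibrePart n x.1) (z, φ.symm (basePart n z)) :=
      (fibrePart n).contMDiff.contMDiffAt.comp _ contMDiffAt_fst
    have h2 : ContMDiffAt (𝓘(ℝ, Fin n → ℂ).prod (𝓡 n)) 𝓘(ℝ, Rn n) ∞
        (fun x : (Fin n → ℂ) × M => φ x.2) (z, φ.symm (basePart n z)) :=
      (contMDiffAt_of_mem_maximalAtlas h (φ.map_target hz)).comp (z, φ.symm (basePart n z))
        contMDiffAt_snd
    exact h1.clm_apply h2
  · exact (contMDiffAt_symm_of_mem_maximalAtlas h hz).comp z (basePart n).contMDiff.contMDiffAt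

/-- The vector `∂/∂xᵢ` is the image of a constant vector under the differential of `φ.symm`, and
that differential varies smoothly. -/
lemma contMDiffAt_coordVec (h : φ ∈ IsManifold.maximalAtlas (𝓡 n) ∞ M) (hp : p ∈ φ.source)
    (i : Fin n) : ContMDiffAt (𝓡 n) ((𝓡 n).prod 𝓘(ℝ, Rn n)) ∞
      (fun p => (⟨p, coordVec φ p i⟩ : TangentBundle (𝓡 n) M)) p := by
  have hφp := φ.map_source hp
  have : IsManifold (𝓡 n) 1 M := IsManifold.of_le (n := ∞) (by simp)
  have h1 : ContMDiffAt 𝓘(ℝ, Rn n) 𝓘(ℝ, Rn n →L[ℝ] Rn n) ∞ (inTangentCoordinates 𝓘(ℝ, Rn n) (𝓡 n)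
      id φ.symm (fun y => mfderiv 𝓘(ℝ, Rn n) (𝓡 n) φ.symm y) (φ p)) (φ p) :=
    ContMDiffAt.mfderiv_const (n := ∞) (contMDiffAt_symm_of_mem_maximalAtlas h hφp) (by simp)
  have hφ : ContMDiffAt (𝓡 n) 𝓘(ℝ, Rn n) ∞ φ p := contMDiffAt_of_mem_maximalAtlas h hp
  have h2 := ContMDiffAt.clm_apply_of_inCoordinates (IB₁ := 𝓘(ℝ, Rn n)) (IB₂ := 𝓡 n)
    (IM := 𝓡 n) (E₁ := fun y : Rn n => TangentSpace 𝓘(ℝ, Rn n) y)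
    (E₂ := fun y : M => TangentSpace (𝓡 n) y) (b₁ := φ) (b₂ := fun y => φ.symm (φ y))
    (ϕ := fun y => mfderiv 𝓘(ℝ, Rn n) (𝓡 n) φ.symm (φ y)) (v := fun _ => stdVec n i)
    (m₀ := p) (n := ∞) (h1.comp p hφ) ?_ ((contMDiffAt_symm_of_mem_maximalAtlas h hφp).comp p hφ)
  -- The base point obtained is `φ.symm (φ y)`, which is `y` only on the domain of the chart.
  · refine h2.congr_of_eventuallyEq ?_
    filter_upwards [φ.open_source.mem_nhds hp] with y hy
    rw [coordVec_eq h hy, ← ContinuousLinearEquiv.coe_coe, coe_chartEquiv_symm h hy]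
    exact Bundle.TotalSpace.ext (φ.left_inv hy).symm (by congr 1; rw [φ.left_inv hy]; rfl)
  · rw [Bundle.contMDiffAt_totalSpace]
    refine ⟨hφ, ?_⟩
    simp only [trivializationAt_model_space_apply]
    exact contMDiffAt_const

lemma contMDiffAt_cotCoord (h : φ ∈ IsManifold.maximalAtlas (𝓡 n) ∞ M) {q : CotangentBundle n M}
    (hq : q.proj ∈ φ.source) :
    ContMDiffAt (cotModel n) 𝓘(ℝ, Fin n → ℂ) ∞ (cotCoord φ) q := by
  have hproj : ContMDiffAt (cotModel n) (𝓡 n) ∞ (fun q : CotangentBundle n M => q.proj) q :=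
    Bundle.contMDiff_proj _ q
  have h0 : ContMDiffAt (cotModel n) 𝓘(ℝ, Rn n) ∞ (fun q : CotangentBundle n M => φ q.proj) q :=
    (contMDiffAt_of_mem_maximalAtlas h hq).comp q hproj
  rw [contMDiffAt_pi_space]
  intro i
  have h1 : ContMDiffAt (cotModel n) 𝓘(ℝ, ℝ) ∞
      (fun q : CotangentBundle n M => (φ q.proj : Rn n) i) q :=
    (EuclideanSpace.proj i : Rn n →L[ℝ] ℝ).contMDiff.contMDiffAt.comp q h0
  have h2 : ContMDiffAt (cotModel n) 𝓘(ℝ, ℝ) ∞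
      (fun q : CotangentBundle n M => q.2 (coordVec φ q.proj i)) q := by
    have h3 := ContMDiffAt.clm_bundle_apply (IM := cotModel n) (IB := 𝓡 n) (n := ∞)
      (E₁ := fun p : M => TangentSpace (𝓡 n) p) (E₂ := Bundle.Trivial M ℝ) (F₂ := ℝ)
      (F₁ := Rn n) (M := CotangentBundle n M) (b := fun q => q.proj) (ϕ := fun q => q.2)
      (v := fun q => coordVec φ q.proj i) (x := q) contMDiffAt_id
      ((contMDiffAt_coordVec h hq i).comp q hproj)
    have := (Bundle.contMDiffAt_totalSpace.1 h3).2
    exact this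
  have h4 : ContMDiffAt (cotModel n) 𝓘(ℝ, ℂ) ∞ (fun q : CotangentBundle n M =>
      Complex.equivRealProdCLM.symm ((φ q.proj : Rn n) i, q.2 (coordVec φ q.proj i))) q :=
    (Complex.equivRealProdCLM.symm : ℝ × ℝ →L[ℝ] ℂ).contMDiffAt.comp q (h1.prodMk_space h2)
  refine h4.congr_of_eventuallyEq (Filter.Eventually.of_forall fun q => ?_)
  apply Complex.ext <;> simp [cotCoord]

/-- The complex coordinates induced by a smooth chart, as a chart of the cotangent bundle. -/
def cotChart (h : φ ∈ IsManifold.maximalAtlas (𝓡 n) ∞ M) :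
    OpenPartialHomeomorph (CotangentBundle n M) (Fin n → ℂ) where
  toFun := cotCoord φ
  invFun := cotChartSymm φ
  source := {q | q.proj ∈ φ.source}
  target := {z | basePart n z ∈ φ.target}
  map_source' q hq := φ.map_source hq
  map_target' z hz := φ.map_target hz
  left_inv' q hq := by
    obtain ⟨p, l⟩ := q
    have hp : p ∈ φ.source := hq
    have h1 : basePart n (cotCoord φ ⟨p, l⟩) = φ p := rfl
    have h2 : φ.symm (φ p) = p := φ.left_inv hp
    unfold cotChartSymm
    rw [h1, h2]
    congr 1
    rw [dFun_clm_comp h hp]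
    ext v
    -- A covector is recovered from its values `ξⁱ` on the coordinate frame.
    conv_rhs => rw [eq_sum_coordVec h hp v]
    rw [ContinuousLinearMap.comp_apply, fibrePart_apply, map_sum]
    exact Finset.sum_congr rfl fun i _ => by rw [map_smul, mul_comm]; rfl
  right_inv' z hz := by
    have hz' : basePart n z ∈ φ.target := hz
    have hp := φ.map_target hz'
    ext i
    apply Complex.ext
    · change (φ (φ.symm (basePart n z))) i = _
      rw [φ.right_inv hz']
      rfl
    · change dFun (fun p => fibrePart n z (φ p)) (φ.symm (basePart n z)) (coordVec φ _ i) = _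
      rw [dFun_clm_comp h hp, ContinuousLinearMap.comp_apply]
      rw [chartDiff_coordVec h hp, fibrePart_apply]
      simp [stdVec_apply]
  open_source := φ.open_source.preimage (Bundle.contMDiff_proj (n := ∞) (IB := 𝓡 n) _).continuous
  open_target := φ.open_target.preimage (basePart n).continuous
  continuousOn_toFun q hq := (contMDiffAt_cotCoord h hq).continuousAt.continuousWithinAt
  continuousOn_invFun z hz := (contMDiffAt_cotChartSymm h hz).continuousAt.continuousWithinAt

lemma isSmoothChart_cotChart (h : φ ∈ IsManifold.maximalAtlas (𝓡 n) ∞ M) :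
    IsSmoothChart (cotModel n) (cotChart h) where
  smooth _ hq := (contMDiffAt_cotCoord h hq).contMDiffWithinAt
  smooth_symm _ hz := (contMDiffAt_cotChartSymm h hz).contMDiffWithinAt

end CotangentCharts

/-! ### Constant forms and smooth charts. -/

lemma extDeriv_eq_zero_of_eventuallyEq_const {W F : Type*} [NormedAddCommGroup W]
    [NormedSpace ℝ W] [NormedAddCommGroup F] [NormedSpace ℝ F] {k : ℕ}
    {om : W → W [⋀^Fin k]→L[ℝ] F} {c : W [⋀^Fin k]→L[ℝ] F} {y : W}
    (h : om =ᶠ[𝓝 y] fun _ => c) : extDeriv om y = 0 := by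
  ext v
  rw [extDeriv, h.fderiv_eq, fderiv_const_apply,
    ContinuousAlternatingMap.alternatizeUncurryFin_apply]
  simp

section SmoothCharts

variable {V : Type*} [NormedAddCommGroup V] [NormedSpace ℝ V] {H : Type*} [TopologicalSpace H]
  {I : ModelWithCorners ℝ V H} {X : Type*} [TopologicalSpace X] [ChartedSpace H X]
  {W : Type*} [NormedAddCommGroup W] [NormedSpace ℝ W] {φ : OpenPartialHomeomorph X W}

lemma IsSmoothChart.mdifferentiable (h : IsSmoothChart I φ) : φ.MDifferentiable I 𝓘(ℝ, W) :=
  ⟨h.smooth.mdifferentiableOn (by simp), h.smooth_symm.mdifferentiableOn (by simp)⟩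

lemma IsSmoothChart.trans_continuousLinearEquiv (h : IsSmoothChart I φ) {W' : Type*}
    [NormedAddCommGroup W'] [NormedSpace ℝ W'] (e : W ≃L[ℝ] W') :
    IsSmoothChart I (φ.transHomeomorph e.toHomeomorph) where
  smooth := (e : W →L[ℝ] W').contMDiff.comp_contMDiffOn h.smooth
  smooth_symm := h.smooth_symm.comp (e.symm : W' →L[ℝ] W).contMDiff.contMDiffOn
    fun _ hx => hx

end SmoothCharts

/-! ### The global coframe `dz` of the cotangent bundle. -/

section FrameDifferential

variable {n : ℕ} {M : Type*} [TopologicalSpace M] [ChartedSpace (Rn n) M] [IsManifold (𝓡 n) ∞ M]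
  {φ ψ : OpenPartialHomeomorph M (Rn n)} {A : Set (OpenPartialHomeomorph M (Rn n))}

lemma clm_coordDiff_cotCoord (h : φ ∈ IsManifold.maximalAtlas (𝓡 n) ∞ M) {q : CotangentBundle n M}
    (hq : q.proj ∈ φ.source) {W : Type*} [NormedAddCommGroup W] [NormedSpace ℝ W]
    (l : (Fin n → ℂ) →L[ℝ] W) (u : TangentSpace (cotModel n) q) :
    l (coordDiff (cotModel n) (cotCoord φ) q u) =
      (mfderiv (cotModel n) 𝓘(ℝ, W) (l ∘ cotCoord φ) q u) := by
  have h1 : MDifferentiableAt (cotModel n) 𝓘(ℝ, Fin n → ℂ) (cotCoord φ) q :=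
    (contMDiffAt_cotCoord h hq).mdifferentiableAt (by simp)
  have h2 : MDifferentiableAt 𝓘(ℝ, Fin n → ℂ) 𝓘(ℝ, W) l (cotCoord φ q) :=
    l.differentiableAt.mdifferentiableAt
  rw [mfderiv_comp q h2 h1, mfderiv_eq_fderiv, l.fderiv]
  rfl

lemma basePart_coordDiff (h : φ ∈ IsManifold.maximalAtlas (𝓡 n) ∞ M) {q : CotangentBundle n M}
    (hq : q.proj ∈ φ.source) (u : TangentSpace (cotModel n) q) :
    basePart n (coordDiff (cotModel n) (cotCoord φ) q u) =
      chartDiff φ q.proj (mfderiv (cotModel n) (𝓡 n) (fun q : CotangentBundle n M => q.proj) q u) := by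
  rw [clm_coordDiff_cotCoord h hq]
  have h1 : MDifferentiableAt (cotModel n) (𝓡 n) (fun q : CotangentBundle n M => q.proj) q :=
    (Bundle.contMDiff_proj (n := ∞) _ q).mdifferentiableAt (by simp)
  have h2 := (mdifferentiable_of_mem_maximalAtlas h).mdifferentiableAt hq
  change mfderiv (cotModel n) 𝓘(ℝ, Rn n) (φ ∘ fun q : CotangentBundle n M => q.proj) q u = _
  rw [mfderiv_comp q h2 h1]
  rfl

/-- The real parts agree because the `dxᵢ` do. The imaginary parts agree because `ξⁱ` is evaluation
at a coordinate vector, and the coordinate vectors of the two charts coincide over a neighbourhood,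
not only at `q`. -/
lemma IsIntegrableParallelization.coordDiff_eq (hA : IsIntegrableParallelization A) (hφ : φ ∈ A)
    (hψ : ψ ∈ A) {q : CotangentBundle n M} (hq : q.proj ∈ φ.source) (hq' : q.proj ∈ ψ.source)
    (u : TangentSpace (cotModel n) q) :
    coordDiff (cotModel n) (cotCoord ψ) q u = coordDiff (cotModel n) (cotCoord φ) q u := by
  ext i
  apply Complex.ext
  · have h1 := congrArg (fun x : Rn n => x i) (basePart_coordDiff (hA.smooth hψ) hq' u)
    have h2 := congrArg (fun x : Rn n => x i) (basePart_coordDiff (hA.smooth hφ) hq u)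
    simp only [basePart_apply] at h1 h2
    rw [h1, h2, hA.chartDiff_eq hφ hψ hq hq']
  · have h1 := clm_coordDiff_cotCoord (hA.smooth hψ) hq'
      (Complex.imCLM ∘L ContinuousLinearMap.proj i) u
    have h2 := clm_coordDiff_cotCoord (hA.smooth hφ) hq
      (Complex.imCLM ∘L ContinuousLinearMap.proj i) u
    refine h1.trans (Eq.trans ?_ h2.symm)
    rw [Filter.EventuallyEq.mfderiv_eq]
    · rfl
    have h3 : Continuous (fun q : CotangentBundle n M => q.proj) :=
      (Bundle.contMDiff_proj (n := ∞) (IB := 𝓡 n) _).continuous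
    filter_upwards [(φ.open_source.preimage h3).mem_nhds hq,
      (ψ.open_source.preimage h3).mem_nhds hq'] with x hx hx'
    change x.2 (coordVec ψ x.proj i) = x.2 (coordVec φ x.proj i)
    rw [hA.coordVec_eq hφ hψ hx hx']

/-- The differential of the complex coordinates induced by a smooth chart. -/
def cotChartEquiv (h : φ ∈ IsManifold.maximalAtlas (𝓡 n) ∞ M) {q : CotangentBundle n M}
    (hq : q.proj ∈ φ.source) : TangentSpace (cotModel n) q ≃L[ℝ] (Fin n → ℂ) :=
  (isSmoothChart_cotChart h).mdifferentiable.mfderiv (x := q) hq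

lemma cotChartEquiv_apply (h : φ ∈ IsManifold.maximalAtlas (𝓡 n) ∞ M) {q : CotangentBundle n M}
    (hq : q.proj ∈ φ.source) (u : TangentSpace (cotModel n) q) :
    cotChartEquiv h hq u = coordDiff (cotModel n) (cotCoord φ) q u := rfl

/-- A chart of the parallelization around `p`. -/
def IsIntegrableParallelization.chart (hA : IsIntegrableParallelization A) (p : M) :
    OpenPartialHomeomorph M (Rn n) := (hA.cover p).choose

lemma IsIntegrableParallelization.chart_mem (hA : IsIntegrableParallelization A) (p : M) :
    hA.chart p ∈ A := (hA.cover p).choose_spec.1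

lemma IsIntegrableParallelization.mem_chart_source (hA : IsIntegrableParallelization A) (p : M) :
    p ∈ (hA.chart p).source := (hA.cover p).choose_spec.2

/-- The coframe `(dz₁, …, dzₙ)` of the cotangent bundle of an integrably parallelized manifold. -/
def IsIntegrableParallelization.coframe (hA : IsIntegrableParallelization A)
    (q : CotangentBundle n M) : TangentSpace (cotModel n) q ≃L[ℝ] (Fin n → ℂ) :=
  cotChartEquiv (hA.smooth (hA.chart_mem q.proj)) (hA.mem_chart_source q.proj)

lemma IsIntegrableParallelization.coframe_apply (hA : IsIntegrableParallelization A)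
    {q : CotangentBundle n M} (hφ : φ ∈ A) (hq : q.proj ∈ φ.source)
    (u : TangentSpace (cotModel n) q) :
    hA.coframe q u = coordDiff (cotModel n) (cotCoord φ) q u :=
  (cotChartEquiv_apply _ _ _).trans (hA.coordDiff_eq hφ (hA.chart_mem _) hq (hA.mem_chart_source _) u)

lemma IsIntegrableParallelization.coframe_eq_dz (hA : IsIntegrableParallelization A)
    {q : CotangentBundle n M} (hφ : φ ∈ A) (hq : q.proj ∈ φ.source)
    (u : TangentSpace (cotModel n) q) :
    hA.coframe q u = dz φ q u :=
  hA.coframe_apply hφ hq u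

end FrameDifferential

/-! ### The Calabi–Yau structure pulled back from `ℂⁿ`. -/

section CalabiYauConstruction

variable {n : ℕ} {M : Type*} [TopologicalSpace M] [ChartedSpace (Rn n) M] [IsManifold (𝓡 n) ∞ M]
  {φ ψ : OpenPartialHomeomorph M (Rn n)} {A : Set (OpenPartialHomeomorph M (Rn n))}

/-- Multiplication by `√-1` on `ℂⁿ`. -/
def mulI (n : ℕ) : (Fin n → ℂ) →L[ℝ] (Fin n → ℂ) :=
  ContinuousLinearMap.pi fun i => (ContinuousLinearMap.mul ℝ ℂ Complex.I) ∘L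
    ContinuousLinearMap.proj i

@[simp] lemma mulI_apply (z : Fin n → ℂ) : mulI n z = Complex.I • z := rfl

lemma stdOmega_compContinuousLinearMap {W : Type*} [AddCommGroup W] [Module ℝ W]
    [TopologicalSpace W] (l : W →L[ℝ] (Fin n → ℂ)) (u w : W) :
    (stdOmega n).compContinuousLinearMap l ![u, w] =
      ∑ i, ((l u i).re * (l w i).im - (l u i).im * (l w i).re) := rfl

lemma norm_stdVol_eq_one (u : Fin n → Fin n → ℂ)
    (h : ∀ i j, ∑ k, (starRingEnd ℂ) (u i k) * u j k = if i = j then 1 else 0) :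
    ‖stdVol n u‖ = 1 := by
  rw [stdVol_apply]
  set U : Matrix (Fin n) (Fin n) ℂ := Matrix.of fun i j : Fin n => u j i
  have hU : U.conjTranspose * U = 1 := by
    ext i j
    rw [Matrix.mul_apply, Matrix.one_apply, ← h i j]
    rfl
  have h2 := congrArg Matrix.det hU
  rw [Matrix.det_mul, Matrix.det_conjTranspose, Matrix.det_one] at h2
  have h3 := congrArg norm h2
  rw [norm_mul, norm_star, norm_one] at h3
  nlinarith [norm_nonneg U.det]

lemma IsIntegrableParallelization.isHolomorphicChart (hA : IsIntegrableParallelization A)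
    (hφ : φ ∈ A) : IsHolomorphicChart (cotModel n)
      (fun q => (hA.coframe q).symm.toContinuousLinearMap ∘L mulI n ∘L
        (hA.coframe q).toContinuousLinearMap) (cotChart (hA.smooth hφ)) where
  isSmoothChart := isSmoothChart_cotChart _
  dJ q hq v := by
    change coordDiff (cotModel n) (cotCoord φ) q _ = Complex.I • coordDiff (cotModel n) (cotCoord φ) q _
    rw [← hA.coframe_apply hφ hq, ← hA.coframe_apply hφ hq]
    simp

/-- The coframe is the differential of the coordinates `z`, and `z` composed with the inverse chart
is the linear map `e.symm`. So the form has constant coefficients, and closedness follows. -/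
lemma IsIntegrableParallelization.localForm_eq (hA : IsIntegrableParallelization A)
    (hφ : φ ∈ A) {W : Type*} [NormedAddCommGroup W] [NormedSpace ℝ W] (e : (Fin n → ℂ) ≃L[ℝ] W)
    {y : W} (hy : y ∈ ((cotChart (hA.smooth hφ)).transHomeomorph e.toHomeomorph).target) :
    localForm (cotModel n)
      (fun q => (stdOmega n).compContinuousLinearMap (hA.coframe q).toContinuousLinearMap)
      ((cotChart (hA.smooth hφ)).transHomeomorph e.toHomeomorph) y =
    (stdOmega n).compContinuousLinearMap (e.symm : W →L[ℝ] (Fin n → ℂ)) := by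
  set χ := (cotChart (hA.smooth hφ)).transHomeomorph e.toHomeomorph
  have hχ : IsSmoothChart (cotModel n) χ :=
    (isSmoothChart_cotChart (hA.smooth hφ)).trans_continuousLinearEquiv e
  have hq : (χ.symm y).proj ∈ φ.source := χ.map_target hy
  have h1 : MDifferentiableAt (cotModel n) 𝓘(ℝ, Fin n → ℂ) (cotCoord φ) (χ.symm y) :=
    (contMDiffAt_cotCoord (hA.smooth hφ) hq).mdifferentiableAt (by simp)
  have h2 : MDifferentiableAt 𝓘(ℝ, W) (cotModel n) χ.symm y :=
    hχ.mdifferentiable.mdifferentiableAt_symm hy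
  have h3 : cotCoord φ ∘ χ.symm =ᶠ[𝓝 y] e.symm := by
    filter_upwards [χ.open_target.mem_nhds hy] with x hx
    exact (cotChart (hA.smooth hφ)).right_inv hx
  have h4 := h3.mfderiv_eq (I := 𝓘(ℝ, W)) (I' := 𝓘(ℝ, Fin n → ℂ))
  rw [mfderiv_comp y h1 h2, mfderiv_eq_fderiv (f := e.symm), e.symm.fderiv] at h4
  ext v
  change (stdOmega n) (fun i => hA.coframe (χ.symm y)
    (mfderiv 𝓘(ℝ, W) (cotModel n) χ.symm y (v i))) = (stdOmega n) fun i => e.symm (v i)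
  congr 1
  funext i
  refine (hA.coframe_apply hφ hq _).trans ?_
  exact congrArg (fun L : W →L[ℝ] (Fin n → ℂ) => L (v i)) h4

lemma IsIntegrableParallelization.extDeriv_localForm (hA : IsIntegrableParallelization A)
    (hφ : φ ∈ A) {W : Type*} [NormedAddCommGroup W] [NormedSpace ℝ W] (e : (Fin n → ℂ) ≃L[ℝ] W)
    {y : W} (hy : y ∈ ((cotChart (hA.smooth hφ)).transHomeomorph e.toHomeomorph).target) :
    extDeriv (localForm (cotModel n)
      (fun q => (stdOmega n).compContinuousLinearMap (hA.coframe q).toContinuousLinearMap)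
      ((cotChart (hA.smooth hφ)).transHomeomorph e.toHomeomorph)) y = 0 := by
  refine extDeriv_eq_zero_of_eventuallyEq_const
    (c := (stdOmega n).compContinuousLinearMap (e.symm : W →L[ℝ] (Fin n → ℂ))) ?_
  filter_upwards [OpenPartialHomeomorph.open_target _ |>.mem_nhds hy] with z hz
  exact hA.localForm_eq hφ _ hz

/-- The Calabi–Yau structure on the cotangent bundle of an integrably parallelized manifold. -/
def IsIntegrableParallelization.calabiYau (hA : IsIntegrableParallelization A) :
    CalabiYauStructure (cotModel n) (CotangentBundle n M) n where
  J q := (hA.coframe q).symm.toContinuousLinearMap ∘L mulI n ∘L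
    (hA.coframe q).toContinuousLinearMap
  omega q := (stdOmega n).compContinuousLinearMap (hA.coframe q).toContinuousLinearMap
  Omega q := (stdVol n).compContinuousLinearMap (hA.coframe q).toContinuousLinearMap
  J_sq q v := by
    simp [smul_smul]
  integrable q := ⟨cotChart (hA.smooth (hA.chart_mem q.proj)), hA.mem_chart_source _,
    hA.isHolomorphicChart (hA.chart_mem q.proj)⟩
  omega_closed q := by
    -- The chart must take values in the model vector space and not in `ℂⁿ`; the coframe at `q`
    -- supplies the linear isomorphism between the two.
    refine ⟨(cotChart (hA.smooth (hA.chart_mem q.proj))).transHomeomorph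
      (hA.coframe q).symm.toHomeomorph, hA.mem_chart_source _,
      (isSmoothChart_cotChart _).trans_continuousLinearEquiv _, ?_, ?_⟩
    · exact contDiffOn_const.congr fun y hy => hA.localForm_eq (hA.chart_mem q.proj) _ hy
    · intro y hy
      exact hA.extDeriv_localForm (hA.chart_mem q.proj) _ hy
  omega_J q u v := by
    rw [stdOmega_compContinuousLinearMap, stdOmega_compContinuousLinearMap]
    refine Finset.sum_congr rfl fun i _ => ?_
    simp
    ring
  omega_pos q v hv := by
    have h0 : hA.coframe q v ≠ 0 := by simpa using hv
    obtain ⟨i, hi⟩ := Function.ne_iff.1 h0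
    rw [stdOmega_compContinuousLinearMap]
    simp only [ContinuousLinearMap.comp_apply, ContinuousLinearEquiv.coe_coe,
      ContinuousLinearEquiv.apply_symm_apply, mulI_apply, Pi.smul_apply, smul_eq_mul,
      Complex.I_mul_re, Complex.I_mul_im]
    -- Each summand of `ω(v, Jv)` is `|dzⱼ v|²`.
    refine Finset.sum_pos' (fun j _ => by
      nlinarith [mul_self_nonneg (hA.coframe q v j).re,
        mul_self_nonneg (hA.coframe q v j).im]) ⟨i, Finset.mem_univ _, ?_⟩
    have := Complex.normSq_pos.2 hi
    rw [Complex.normSq_apply] at this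
    linarith
  Omega_holomorphic q := ⟨cotChart (hA.smooth (hA.chart_mem q.proj)), hA.mem_chart_source _,
    hA.isHolomorphicChart (hA.chart_mem q.proj), fun _ => 1, differentiableOn_const _, fun y hy u => by
      rw [one_mul, ContinuousAlternatingMap.compContinuousLinearMap_apply, stdVol_apply]
      congr 1
      ext i j
      exact congrFun (hA.coframe_apply (hA.chart_mem q.proj) hy (u j)) i⟩
  Omega_ne_zero q h := by
    have h1 : (stdVol n).compContinuousLinearMap (hA.coframe q).toContinuousLinearMap
        (fun j => (hA.coframe q).symm (Pi.single j 1)) = 0 := by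
      rw [h]
      rfl
    have h2 : (stdVol n) (fun j => Pi.single j 1) = 0 :=
      (congrArg (stdVol n) (funext fun j =>
        ((hA.coframe q).apply_symm_apply _).symm)).trans h1
    rw [stdVol_apply] at h2
    have h3 : (Matrix.of fun i j : Fin n => (Pi.single j 1 : Fin n → ℂ) i) = 1 := by
      ext i j
      simp [Pi.single_apply, Matrix.one_apply]
    rw [h3, Matrix.det_one] at h2
    exact one_ne_zero h2
  Omega_normalised q u h1 h2 := by
    -- The Hermitian product of `ℂⁿ` has real part `ω(·, J·)` and imaginary part `ω`, so the two
    -- hypotheses together say that the frame is unitary.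
    refine norm_stdVol_eq_one _ fun i j => ?_
    have h1 := h1 i j
    have h2 := h2 i j
    rw [stdOmega_compContinuousLinearMap] at h1 h2
    simp only [ContinuousLinearMap.comp_apply, ContinuousLinearEquiv.coe_coe,
      ContinuousLinearEquiv.apply_symm_apply, mulI_apply, Pi.smul_apply, smul_eq_mul,
      Complex.I_mul_re, Complex.I_mul_im] at h1 h2
    apply Complex.ext
    · rw [Complex.re_sum, apply_ite Complex.re, Complex.one_re, Complex.zero_re, ← h1]
      refine Finset.sum_congr rfl fun k _ => ?_
      simp
    · rw [Complex.im_sum, apply_ite Complex.im, Complex.one_im, Complex.zero_im, ite_self, ← h2]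
      refine Finset.sum_congr rfl fun k _ => ?_
      simp
      ring

lemma IsIntegrableParallelization.isFrameCalabiYau (hA : IsIntegrableParallelization A) :
    IsFrameCalabiYau A hA.calabiYau where
  J_eq φ hφ q hq u i := by
    rw [← hA.coframe_eq_dz hφ hq, ← hA.coframe_eq_dz hφ hq]
    simp [calabiYau]
  omega_eq φ hφ q hq u w := by
    rw [← hA.coframe_eq_dz hφ hq, ← hA.coframe_eq_dz hφ hq]
    exact stdOmega_compContinuousLinearMap _ u w
  Omega_eq φ hφ q hq u := by
    have : (fun i j : Fin n => dz φ q (u j) i) = fun i j => hA.coframe q (u j) i := by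
      ext i j
      rw [← hA.coframe_eq_dz hφ hq]
    rw [this]
    rfl

end CalabiYauConstruction

/-! ### The flat metric and the orientation of the coordinate frame. -/

section FrameMetric

variable {n : ℕ} {M : Type*} [TopologicalSpace M] [ChartedSpace (Rn n) M] [IsManifold (𝓡 n) ∞ M]
  {φ ψ : OpenPartialHomeomorph M (Rn n)} {A : Set (OpenPartialHomeomorph M (Rn n))} {p : M}

/-- The coframe `(dx₁, …, dxₙ)` of an integrably parallelized manifold. -/
def IsIntegrableParallelization.baseCoframe (hA : IsIntegrableParallelization A)
    (p : M) : TangentSpace (𝓡 n) p ≃L[ℝ] Rn n :=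
  chartEquiv (hA.smooth (hA.chart_mem p)) (hA.mem_chart_source p)

lemma IsIntegrableParallelization.coe_baseCoframe (hA : IsIntegrableParallelization A)
    (hφ : φ ∈ A) (hp : p ∈ φ.source) :
    (hA.baseCoframe p : TangentSpace (𝓡 n) p →L[ℝ] Rn n) = chartDiff φ p :=
  hA.chartDiff_eq hφ (hA.chart_mem p) hp (hA.mem_chart_source p)

/-- The pullback of the inner product of `ℝⁿ` by a linear map. -/
def pullbackInner {T : Type*} [AddCommGroup T] [Module ℝ T] [TopologicalSpace T]
    [IsTopologicalAddGroup T] [ContinuousSMul ℝ T] (L : T →L[ℝ] Rn n) : T →L[ℝ] T →L[ℝ] ℝ :=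
  ContinuousLinearMap.precomp ℝ L ∘L innerSL ℝ ∘L L

lemma pullbackInner_apply {T : Type*} [AddCommGroup T] [Module ℝ T] [TopologicalSpace T]
    [IsTopologicalAddGroup T] [ContinuousSMul ℝ T] (L : T →L[ℝ] Rn n) (v w : T) :
    pullbackInner L v w = inner ℝ (L v) (L w) := rfl

lemma contDiff_pullbackInner :
    ContDiff ℝ ∞ (fun L : Rn n →L[ℝ] Rn n => pullbackInner L) := by
  rw [contDiff_clm_apply_iff]
  intro v
  rw [contDiff_clm_apply_iff]
  intro w
  simp only [pullbackInner_apply]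
  exact (contDiff_id.clm_apply contDiff_const).inner ℝ (contDiff_id.clm_apply contDiff_const)

/-- In a trivialization the bilinear form depends smoothly on the matrix `a` of the differential of
the chart, and `a` is smooth. The remaining work unfolds the two nested hom-bundle trivializations.
-/
lemma contMDiffAt_pullbackInner (h : φ ∈ IsManifold.maximalAtlas (𝓡 n) ∞ M) (hp : p ∈ φ.source) :
    ContMDiffAt (𝓡 n) ((𝓡 n).prod 𝓘(ℝ, Rn n →L[ℝ] Rn n →L[ℝ] ℝ)) ∞
      (fun x => (⟨x, pullbackInner (chartDiff φ x)⟩ : Bundle.TotalSpace (Rn n →L[ℝ] Rn n →L[ℝ] ℝ)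
        fun x : M => TangentSpace (𝓡 n) x →L[ℝ] TangentSpace (𝓡 n) x →L[ℝ] ℝ)) p := by
  have : IsManifold (𝓡 n) 1 M := IsManifold.of_le (n := ∞) (by simp)
  have hφ : ContMDiffAt (𝓡 n) 𝓘(ℝ, Rn n) ∞ φ p := contMDiffAt_of_mem_maximalAtlas h hp
  have h1 : ContMDiffAt (𝓡 n) 𝓘(ℝ, Rn n →L[ℝ] Rn n) ∞ (inTangentCoordinates (𝓡 n) 𝓘(ℝ, Rn n)
      id φ (fun y => mfderiv (𝓡 n) 𝓘(ℝ, Rn n) φ y) p) p :=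
    ContMDiffAt.mfderiv_const (n := ∞) hφ (by simp)
  set a := inTangentCoordinates (𝓡 n) 𝓘(ℝ, Rn n)
      id φ (fun y => mfderiv (𝓡 n) 𝓘(ℝ, Rn n) φ y) p
  have h2 : ContMDiffAt (𝓡 n) 𝓘(ℝ, Rn n →L[ℝ] Rn n →L[ℝ] ℝ) ∞
      (fun x => pullbackInner (a x)) p :=
    contDiff_pullbackInner.contMDiff.contMDiffAt.comp p h1
  refine (contMDiffAt_hom_bundle (E₁ := fun p : M => TangentSpace (𝓡 n) p)
    (E₂ := fun p : M => TangentSpace (𝓡 n) p →L[ℝ] ℝ) _).2 ⟨contMDiffAt_id, ?_⟩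
  refine h2.congr_of_eventuallyEq ?_
  have hb : p ∈ (trivializationAt (Rn n →L[ℝ] ℝ)
      (fun p : M => TangentSpace (𝓡 n) p →L[ℝ] ℝ) p).baseSet :=
    FiberBundle.mem_baseSet_trivializationAt' p
  filter_upwards [Bundle.Trivialization.open_baseSet _ |>.mem_nhds hb] with x hx
  ext v w
  simp only [ContinuousLinearMap.inCoordinates, ContinuousLinearMap.comp_apply,
    Bundle.Trivialization.continuousLinearMapAt_apply]
  rw [Bundle.Trivialization.coe_linearMapAt_of_mem _ hx]
  have h3 (l : TangentSpace (𝓡 n) x →L[ℝ] ℝ) : (trivializationAt (Rn n →L[ℝ] ℝ)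
      (fun p : M => TangentSpace (𝓡 n) p →L[ℝ] ℝ) p ⟨x, l⟩).2 w =
      l (Bundle.Trivialization.symmL ℝ (trivializationAt (Rn n) (fun p : M => TangentSpace (𝓡 n) p) p) x w) := by
    have := congrArg (fun z => z.2 w) (hom_trivializationAt_apply (σ := RingHom.id ℝ) (F₁ := Rn n) (F₂ := ℝ)
      (E₁ := fun p : M => TangentSpace (𝓡 n) p) (E₂ := Bundle.Trivial M ℝ) p ⟨x, l⟩)
    refine this.trans ?_
    simp [ContinuousLinearMap.inCoordinates]
  refine (h3 _).trans ?_
  rw [pullbackInner_apply, pullbackInner_apply]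
  have h4 : a x = chartDiff φ x ∘L Bundle.Trivialization.symmL ℝ
      (trivializationAt (Rn n) (fun p : M => TangentSpace (𝓡 n) p) p) x := by
    ext1 u
    simp [a, inTangentCoordinates, ContinuousLinearMap.inCoordinates]
    rfl
  rw [h4]
  rfl

/-- The flat metric for which the coordinate frame is orthonormal. -/
def IsIntegrableParallelization.metric (hA : IsIntegrableParallelization A) : RiemMetric n M where
  inner p := pullbackInner (hA.baseCoframe p : TangentSpace (𝓡 n) p →L[ℝ] Rn n)
  symm p v w := by
    rw [pullbackInner_apply, pullbackInner_apply, real_inner_comm]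
  pos p v hv := by
    have h0 : hA.baseCoframe p v ≠ 0 := by simpa using hv
    exact real_inner_self_pos.2 h0
  isVonNBounded p := by
    -- The unit ball of the metric lies in the image of the Euclidean unit ball under the inverse
    -- coframe, hence is bounded.
    have h1 : {v | pullbackInner (hA.baseCoframe p : TangentSpace (𝓡 n) p →L[ℝ] Rn n) v v < 1} ⊆
        (hA.baseCoframe p).symm '' Metric.ball 0 1 := by
      intro v hv
      refine ⟨hA.baseCoframe p v, ?_, (hA.baseCoframe p).symm_apply_apply v⟩
      have hv' : inner ℝ (hA.baseCoframe p v) (hA.baseCoframe p v) < 1 := hv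
      rw [real_inner_self_eq_norm_sq] at hv'
      rw [mem_ball_zero_iff]
      nlinarith [norm_nonneg (hA.baseCoframe p v)]
    exact ((NormedSpace.isVonNBounded_ball ℝ (Rn n) 1).image
      (hA.baseCoframe p).symm.toContinuousLinearMap).subset h1
  contMDiff p := by
    refine (contMDiffAt_pullbackInner (hA.smooth (hA.chart_mem p))
      (hA.mem_chart_source p)).congr_of_eventuallyEq ?_
    filter_upwards [(hA.chart p).open_source.mem_nhds (hA.mem_chart_source p)] with x hx
    rw [hA.coe_baseCoframe (hA.chart_mem p) hx]

lemma IsIntegrableParallelization.metric_inner (hA : IsIntegrableParallelization A)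
    (hφ : φ ∈ A) (hp : p ∈ φ.source) (v w : TangentSpace (𝓡 n) p) :
    hA.metric.inner p v w = inner ℝ (chartDiff φ p v) (chartDiff φ p w) := by
  rw [← hA.coe_baseCoframe hφ hp]
  exact pullbackInner_apply _ v w

lemma IsIntegrableParallelization.isFrameMetric (hA : IsIntegrableParallelization A) :
    IsFrameMetric A hA.metric := by
  intro φ hφ p hp i j
  rw [hA.metric_inner hφ hp, chartDiff_coordVec (hA.smooth hφ) hp,
    chartDiff_coordVec (hA.smooth hφ) hp]
  simp [stdVec, EuclideanSpace.inner_single_left]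

/-- The orientation for which the coordinate frame is positive. -/
def IsIntegrableParallelization.orientation (hA : IsIntegrableParallelization A) (p : M) :
    Orientation ℝ (TangentSpace (𝓡 n) p) (Fin n) :=
  (coordBasis (hA.smooth (hA.chart_mem p)) (hA.mem_chart_source p)).orientation

lemma IsIntegrableParallelization.isFrameOrientation (hA : IsIntegrableParallelization A) :
    IsFrameOrientation A hA.orientation := by
  intro φ hφ p hp b hb
  unfold orientation
  congr 1
  apply Module.Basis.eq_of_apply_eq
  intro i
  rw [hb, coordBasis_apply, hA.coordVec_eq hφ (hA.chart_mem p) hp (hA.mem_chart_source p)]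

end FrameMetric

/-! ### Second derivatives and Gram matrices in `ℝⁿ`. -/

section EuclideanHessian

variable {n : ℕ}

/-- Second-order chain rule; its last term is the one that the Christoffel symbols compensate. -/
lemma fderiv_fderiv_comp {ψ : Rn n → Rn n} {v : Rn n → ℝ} {y : Rn n} (hψ : ContDiffAt ℝ 2 ψ y)
    (hv : ContDiffAt ℝ 2 v (ψ y)) (a b : Rn n) :
    fderiv ℝ (fun x => fderiv ℝ (v ∘ ψ) x b) y a =
      fderiv ℝ (fderiv ℝ v) (ψ y) (fderiv ℝ ψ y a) (fderiv ℝ ψ y b) +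
        fderiv ℝ v (ψ y) (fderiv ℝ (fderiv ℝ ψ) y a b) := by
  have h1 : (fun x => fderiv ℝ (v ∘ ψ) x b) =ᶠ[𝓝 y]
      fun x => fderiv ℝ v (ψ x) (fderiv ℝ ψ x b) := by
    filter_upwards [hψ.eventually (by simp), hψ.continuousAt.eventually (hv.eventually (by simp))]
      with x hx hx'
    rw [fderiv_comp x (hx'.differentiableAt (by simp)) (hx.differentiableAt (by simp))]
    rfl
  have h2 : HasFDerivAt (fderiv ℝ v) (fderiv ℝ (fderiv ℝ v) (ψ y)) (ψ y) :=
    ((hv.fderiv_right (m := 1) (by norm_num)).differentiableAt (by simp)).hasFDerivAt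
  have h3 : HasFDerivAt (fderiv ℝ ψ) (fderiv ℝ (fderiv ℝ ψ) y) y :=
    ((hψ.fderiv_right (m := 1) (by norm_num)).differentiableAt (by simp)).hasFDerivAt
  have h4 : HasFDerivAt ψ (fderiv ℝ ψ y) y := (hψ.differentiableAt (by simp)).hasFDerivAt
  have h5 := (h2.comp y h4).clm_apply (h3.clm_apply (hasFDerivAt_const b y))
  rw [h1.fderiv_eq]
  refine (congrArg (fun l : Rn n →L[ℝ] ℝ => l a) h5.fderiv).trans ?_
  simp [add_comm]

/-- The Gram matrix of the images of the standard basis under a linear map. -/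
def gramMatrix (L : Rn n →L[ℝ] Rn n) : Matrix (Fin n) (Fin n) ℝ :=
  Matrix.of fun i j => inner ℝ (L (stdVec n i)) (L (stdVec n j))

lemma clm_eq_sum_stdVec {F : Type*} [AddCommGroup F] [Module ℝ F] [TopologicalSpace F]
    (L : Rn n →L[ℝ] F) (x : Rn n) : L x = ∑ i, x i • L (stdVec n i) := by
  conv_lhs => rw [← sum_smul_stdVec x]
  simp

lemma det_gramMatrix_ne_zero (L : Rn n ≃L[ℝ] Rn n) : (gramMatrix (L : Rn n →L[ℝ] Rn n)).det ≠ 0 := by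
  intro h
  obtain ⟨c, hc, h0⟩ := Matrix.exists_mulVec_eq_zero_iff.2 h
  apply hc
  have h1 : inner ℝ (L (WithLp.toLp 2 c)) (L (WithLp.toLp 2 c)) = (0 : ℝ) := by
    have h2 := clm_eq_sum_stdVec (L : Rn n →L[ℝ] Rn n) (WithLp.toLp 2 c)
    rw [ContinuousLinearEquiv.coe_coe] at h2
    rw [h2, sum_inner]
    refine Finset.sum_eq_zero fun i _ => ?_
    have h3 := congrFun h0 i
    rw [inner_smul_left, inner_sum]
    simp only [Matrix.mulVec, dotProduct, gramMatrix, Matrix.of_apply, Pi.zero_apply,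
      ContinuousLinearEquiv.coe_coe] at h3
    simp only [inner_smul_right]
    rw [Finset.sum_congr rfl fun j _ => mul_comm _ _]
    erw [h3]
    rw [mul_zero]
  have h4 : WithLp.toLp 2 c = (0 : Rn n) := by
    simpa using inner_self_eq_zero.1 h1
  exact congrArg (fun x : Rn n => x.ofLp) h4

/-- The inverse Gram matrix computes coefficients in the basis `L eₖ`: both sides have the same
inner product with every `L eₘ`. This recovers the second derivative of the transition map from the
Christoffel symbols. -/
lemma sum_inv_gramMatrix_smul (L : Rn n ≃L[ℝ] Rn n) (z : Rn n) :
    ∑ k, (∑ l, (gramMatrix (L : Rn n →L[ℝ] Rn n))⁻¹ k l * inner ℝ z (L (stdVec n l))) •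
      L (stdVec n k) = z := by
  set G := gramMatrix (L : Rn n →L[ℝ] Rn n)
  set c : Fin n → ℝ := fun k => ∑ l, G⁻¹ k l * inner ℝ z (L (stdVec n l))
  have hc : c = G⁻¹.mulVec fun l => inner ℝ z (L (stdVec n l)) := rfl
  have hG : G.mulVec c = fun l => inner ℝ z (L (stdVec n l)) := by
    rw [hc, Matrix.mulVec_mulVec, Matrix.mul_nonsing_inv _
      (isUnit_iff_ne_zero.2 (det_gramMatrix_ne_zero L)), Matrix.one_mulVec]
  have h1 (m : Fin n) : inner ℝ (∑ k, c k • L (stdVec n k) - z) (L (stdVec n m)) = 0 := by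
    rw [inner_sub_left, ← congrFun hG m, sub_eq_zero, sum_inner]
    simp only [inner_smul_left, Matrix.mulVec, dotProduct]
    refine Finset.sum_congr rfl fun k _ => ?_
    rw [mul_comm, real_inner_comm]
    rfl
  have h2 (x : Rn n) : inner ℝ (∑ k, c k • L (stdVec n k) - z) (L x) = 0 := by
    have := clm_eq_sum_stdVec (L : Rn n →L[ℝ] Rn n) x
    rw [ContinuousLinearEquiv.coe_coe] at this
    rw [this, inner_sum]
    exact Finset.sum_eq_zero fun m _ => by
      rw [inner_smul_right, h1, mul_zero]
  have h3 := h2 (L.symm (∑ k, c k • L (stdVec n k) - z))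
  rw [L.apply_symm_apply] at h3
  exact sub_eq_zero.1 (inner_self_eq_zero.1 h3)

lemma fderiv_gramMatrix {ψ : Rn n → Rn n} {y : Rn n} (hψ : ContDiffAt ℝ 2 ψ y) (i j : Fin n)
    (a : Rn n) : fderiv ℝ (fun x => gramMatrix (fderiv ℝ ψ x) i j) y a =
      inner ℝ (fderiv ℝ (fderiv ℝ ψ) y a (stdVec n i)) (fderiv ℝ ψ y (stdVec n j)) +
      inner ℝ (fderiv ℝ (fderiv ℝ ψ) y a (stdVec n j)) (fderiv ℝ ψ y (stdVec n i)) := by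
  have h3 : HasFDerivAt (fderiv ℝ ψ) (fderiv ℝ (fderiv ℝ ψ) y) y :=
    ((hψ.fderiv_right (m := 1) (by norm_num)).differentiableAt (by simp)).hasFDerivAt
  have h4 := (h3.clm_apply (hasFDerivAt_const (stdVec n i) y)).inner ℝ
    (h3.clm_apply (hasFDerivAt_const (stdVec n j) y))
  have h5 : (fun x => gramMatrix (fderiv ℝ ψ x) i j) = fun x =>
    inner ℝ (fderiv ℝ ψ x (stdVec n i)) (fderiv ℝ ψ x (stdVec n j)) := rfl
  rw [h5, h4.fderiv]
  simp
  rw [real_inner_comm, add_comm]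

end EuclideanHessian

/-! ### The Riemannian Hessian is the plain Hessian in flat coordinates. -/

section RiemannianHessian

variable {n : ℕ} {M : Type*} [TopologicalSpace M] [ChartedSpace (Rn n) M] [IsManifold (𝓡 n) ∞ M]
  {φ : OpenPartialHomeomorph M (Rn n)} {A : Set (OpenPartialHomeomorph M (Rn n))} {p : M}

/-- The Hessian is defined in the preferred chart `χ`, which need not belong to `A`. With `ψ = φ ∘
χ⁻¹`, the metric is the Gram matrix of `dψ`, so `Γᵏᵢⱼ` are the coefficients of `∂ᵢ∂ⱼψ` in the basis
`dψ(eₖ)`. The Christoffel term then cancels the first-order term of the second-order chain rule,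
leaving the second derivative in `φ`. -/
lemma IsIntegrableParallelization.riemHess_eq (hA : IsIntegrableParallelization A)
    (hφ : φ ∈ A) (hp : p ∈ φ.source) {u : M → ℝ} (hu : ContDiffAt ℝ 2 (u ∘ φ.symm) (φ p))
    (a b : TangentSpace (𝓡 n) p) :
    riemHess hA.metric u p a b =
      fderiv ℝ (fderiv ℝ (u ∘ φ.symm)) (φ p) (chartDiff φ p a) (chartDiff φ p b) := by
  set χ := chartAt (Rn n) p with hχdef
  have hχ : χ ∈ IsManifold.maximalAtlas (𝓡 n) ∞ M := IsManifold.chart_mem_maximalAtlas p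
  have hpχ : p ∈ χ.source := ChartedSpace.mem_chart_source p
  have hext : (extChartAt (𝓡 n) p : M → Rn n) = χ := by simp [hχdef]
  have hext' : ((extChartAt (𝓡 n) p).symm : Rn n → M) = χ.symm := by simp [hχdef]
  set ψ : Rn n → Rn n := φ ∘ χ.symm
  set y₀ : Rn n := χ p
  have hy₀ : y₀ ∈ χ.target := χ.map_source hpχ
  have hψy₀ : ψ y₀ = φ p := by simp [ψ, y₀, χ.left_inv hpχ]
  have hO : ∀ᶠ y in 𝓝 y₀, y ∈ χ.target ∧ χ.symm y ∈ φ.source := by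
    have h1 : φ.source ∈ 𝓝 (χ.symm y₀) := by
      rw [χ.left_inv hpχ]
      exact φ.open_source.mem_nhds hp
    exact Filter.Eventually.and (χ.open_target.mem_nhds hy₀) ((χ.continuousAt_symm hy₀) h1)
  have hφ' := hA.smooth hφ
  have hmd (y : Rn n) (hy : y ∈ χ.target ∧ χ.symm y ∈ φ.source) :
      fderiv ℝ ψ y = chartDiff φ (χ.symm y) ∘L mfderiv 𝓘(ℝ, Rn n) (𝓡 n) χ.symm y := by
    rw [← mfderiv_eq_fderiv]
    exact mfderiv_comp y ((mdifferentiable_of_mem_maximalAtlas hφ').mdifferentiableAt hy.2)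
      ((mdifferentiable_of_mem_maximalAtlas hχ).mdifferentiableAt_symm hy.1)
  have hψ : ContDiffAt ℝ 2 ψ y₀ := by
    rw [← contMDiffAt_iff_contDiffAt]
    have h1 : ContMDiffAt 𝓘(ℝ, Rn n) (𝓡 n) 2 χ.symm y₀ :=
      (contMDiffAt_symm_of_mem_maximalAtlas hχ hy₀).of_le (by norm_cast)
    have h2 : ContMDiffAt (𝓡 n) 𝓘(ℝ, Rn n) 2 φ (χ.symm y₀) := by
      refine (contMDiffAt_of_mem_maximalAtlas hφ' ?_).of_le (by norm_cast)
      rwa [χ.left_inv hpχ]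
    exact h2.comp y₀ h1
  have hG : ∀ᶠ y in 𝓝 y₀, metricMatrix hA.metric p y = gramMatrix (fderiv ℝ ψ y) := by
    filter_upwards [hO] with y hy
    ext i j
    rw [metricMatrix, Matrix.of_apply, hext', hA.metric_inner hφ hy.2, gramMatrix,
      Matrix.of_apply, hmd y hy]
    rfl
  set L : Rn n ≃L[ℝ] Rn n := (chartEquiv hχ hpχ).symm.trans (chartEquiv hφ' hp)
  have hL : fderiv ℝ ψ y₀ = L := by
    rw [hmd y₀ hO.self_of_nhds]
    ext1 v
    change chartDiff φ (χ.symm (χ p)) (mfderiv 𝓘(ℝ, Rn n) (𝓡 n) χ.symm (χ p) v) =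
      chartDiff φ p (mfderiv 𝓘(ℝ, Rn n) (𝓡 n) χ.symm (χ p) v)
    rw [χ.left_inv hpχ]
  have hsymm (i j : Fin n) : fderiv ℝ (fderiv ℝ ψ) y₀ (stdVec n i) (stdVec n j) =
      fderiv ℝ (fderiv ℝ ψ) y₀ (stdVec n j) (stdVec n i) :=
    (hψ.isSymmSndFDerivAt (by simp)).eq _ _
  have hchr (k i j : Fin n) : christoffel hA.metric p y₀ k i j =
      ∑ l, (gramMatrix (L : Rn n →L[ℝ] Rn n))⁻¹ k l *
        inner ℝ (fderiv ℝ (fderiv ℝ ψ) y₀ (stdVec n i) (stdVec n j)) (L (stdVec n l)) := by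
    have h1 (i j : Fin n) : (fun y => metricMatrix hA.metric p y i j) =ᶠ[𝓝 y₀]
        fun y => gramMatrix (fderiv ℝ ψ y) i j := by
      filter_upwards [hG] with y hy
      rw [hy]
    rw [christoffel, Finset.mul_sum]
    refine Finset.sum_congr rfl fun l _ => ?_
    -- Of the six terms, four cancel in pairs by symmetry of the second derivative of `ψ`; the other
    -- two are equal, which absorbs the factor `1/2`.
    rw [hG.self_of_nhds, (h1 j l).fderiv_eq, (h1 i l).fderiv_eq, (h1 i j).fderiv_eq,
      fderiv_gramMatrix hψ, fderiv_gramMatrix hψ, fderiv_gramMatrix hψ, hL,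
      hsymm j i, hsymm l j, hsymm l i]
    simp only [ContinuousLinearEquiv.coe_coe]
    ring
  have hv : ContDiffAt ℝ 2 (u ∘ φ.symm) (ψ y₀) := by rwa [hψy₀]
  have hw : (u ∘ χ.symm) =ᶠ[𝓝 y₀] (u ∘ φ.symm) ∘ ψ := by
    filter_upwards [hO] with y hy
    simp [ψ, φ.left_inv hy.2]
  have hhess (i j : Fin n) : hessMatrix hA.metric u p i j =
      fderiv ℝ (fderiv ℝ (u ∘ φ.symm)) (φ p) (L (stdVec n i)) (L (stdVec n j)) := by
    have h1 : (fun y => fderiv ℝ (u ∘ χ.symm) y (stdVec n j)) =ᶠ[𝓝 y₀]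
        fun y => fderiv ℝ ((u ∘ φ.symm) ∘ ψ) y (stdVec n j) := by
      filter_upwards [hw.fderiv (𝕜 := ℝ)] with y hy
      rw [hy]
    have h2 : fderiv ℝ (u ∘ χ.symm) y₀ = fderiv ℝ (u ∘ φ.symm) (φ p) ∘L (L : Rn n →L[ℝ] Rn n) := by
      rw [hw.fderiv_eq, fderiv_comp y₀ (hv.differentiableAt (by simp))
        (hψ.differentiableAt (by simp)), hL, hψy₀]
    simp only [hessMatrix, hext, hext']
    change fderiv ℝ (fun y => fderiv ℝ (u ∘ χ.symm) y (stdVec n j)) y₀ (stdVec n i) -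
      ∑ k, christoffel hA.metric p y₀ k i j * fderiv ℝ (u ∘ χ.symm) y₀ (stdVec n k) = _
    rw [h1.fderiv_eq, fderiv_fderiv_comp hψ hv, h2, hψy₀, hL]
    simp only [hchr]
    have h3 := congrArg (fderiv ℝ (u ∘ φ.symm) (φ p))
      (sum_inv_gramMatrix_smul L (fderiv ℝ (fderiv ℝ ψ) y₀ (stdVec n i) (stdVec n j)))
    rw [map_sum] at h3
    simp only [map_smul, smul_eq_mul] at h3
    rw [← h3]
    simp
  have hvec (a : TangentSpace (𝓡 n) p) : L (chartVec p a) = chartDiff φ p a := by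
    have h1 : chartVec p a = chartEquiv hχ hpχ a := by
      rw [chartVec, hext]
      rfl
    rw [h1]
    change chartEquiv hφ' hp ((chartEquiv hχ hpχ).symm (chartEquiv hχ hpχ a)) = _
    rw [ContinuousLinearEquiv.symm_apply_apply]
    rfl
  rw [← hvec a, ← hvec b, riemHess]
  simp only [hhess]
  have h1 := clm_eq_sum_stdVec (L : Rn n →L[ℝ] Rn n) (chartVec p a)
  have h2 := clm_eq_sum_stdVec (L : Rn n →L[ℝ] Rn n) (chartVec p b)
  rw [ContinuousLinearEquiv.coe_coe] at h1 h2
  rw [h1, h2]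
  simp only [map_sum, sum_apply, map_smul, smul_apply,
    smul_eq_mul]
  rw [Finset.sum_comm]
  refine Finset.sum_congr rfl fun i _ => ?_
  rw [Finset.mul_sum]
  exact Finset.sum_congr rfl fun j _ => by ring

end RiemannianHessian

/-! ### Calculus on `[0,1] × O`, one-sided in time. -/

section Slab

variable {n : ℕ} {O : Set (Rn n)} {F : ℝ × Rn n → ℝ} {k m : WithTop ℕ∞}

/-- The set `[0,1] × O`. -/
def slab (O : Set (Rn n)) : Set (ℝ × Rn n) := Icc 0 1 ×ˢ O

lemma uniqueDiffOn_slab (hO : IsOpen O) : UniqueDiffOn ℝ (slab O) :=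
  (uniqueDiffOn_Icc zero_lt_one).prod hO.uniqueDiffOn

/-- The differential on `[0,1] × O`. -/
def slabD (F : ℝ × Rn n → ℝ) (O : Set (Rn n)) : ℝ × Rn n → (ℝ × Rn n →L[ℝ] ℝ) :=
  fderivWithin ℝ F (slab O)

/-- The second differential on `[0,1] × O`. -/
def slabDD (F : ℝ × Rn n → ℝ) (O : Set (Rn n)) :
    ℝ × Rn n → (ℝ × Rn n →L[ℝ] ℝ × Rn n →L[ℝ] ℝ) :=
  fderivWithin ℝ (slabD F O) (slab O)

lemma contDiffOn_slabD (hO : IsOpen O) (hF : ContDiffOn ℝ k F (slab O)) (hmk : m + 1 ≤ k) :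
    ContDiffOn ℝ m (slabD F O) (slab O) :=
  hF.fderivWithin (uniqueDiffOn_slab hO) hmk

lemma hasFDerivWithinAt_slabD (hF : ContDiffOn ℝ 2 F (slab O)) {z : ℝ × Rn n} (hz : z ∈ slab O) :
    HasFDerivWithinAt F (slabD F O z) (slab O) z :=
  ((hF z hz).differentiableWithinAt (by simp)).hasFDerivWithinAt

lemma hasFDerivWithinAt_slabDD (hO : IsOpen O) (hF : ContDiffOn ℝ 2 F (slab O)) {z : ℝ × Rn n}
    (hz : z ∈ slab O) : HasFDerivWithinAt (slabD F O) (slabDD F O z) (slab O) z :=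
  ((contDiffOn_slabD (m := 1) hO hF (by norm_num) z hz).differentiableWithinAt
    (by simp)).hasFDerivWithinAt

/-- Schwarz's theorem survives at the end points of time because the slab lies in the closure of its
interior. -/
lemma slabDD_symm (hO : IsOpen O) (hF : ContDiffOn ℝ 2 F (slab O)) {z : ℝ × Rn n}
    (hz : z ∈ slab O) (a b : ℝ × Rn n) : slabDD F O z a b = slabDD F O z b a := by
  have h1 : z ∈ closure (interior (slab O)) := by
    rw [slab, interior_prod_eq, closure_prod_eq, interior_Icc, closure_Ioo zero_ne_one,
      hO.interior_eq]
    exact ⟨hz.1, subset_closure hz.2⟩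
  exact ((hF z hz).isSymmSndFDerivWithinAt (by simp) (uniqueDiffOn_slab hO) h1 hz).eq a b

/-- As `O` is open, the space derivative is two-sided even at `t = 0` and `t = 1`. -/
lemma hasFDerivAt_slice {E : Type*} [NormedAddCommGroup E] [NormedSpace ℝ E] (hO : IsOpen O)
    {G : ℝ × Rn n → E} {G' : ℝ × Rn n →L[ℝ] E} {t : ℝ} (ht : t ∈ Icc (0 : ℝ) 1) {x : Rn n}
    (hx : x ∈ O) (hG : HasFDerivWithinAt G G' (slab O) (t, x)) :
    HasFDerivAt (fun y => G (t, y)) (G' ∘L ContinuousLinearMap.inr ℝ ℝ (Rn n)) x := by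
  have h1 : HasFDerivAt (fun y : Rn n => (t, y)) (ContinuousLinearMap.inr ℝ ℝ (Rn n)) x :=
    hasFDerivAt_prodMk_right t x
  exact (hG.comp x h1.hasFDerivWithinAt (s := O) (fun y hy => ⟨ht, hy⟩)).hasFDerivAt
    (hO.mem_nhds hx)

lemma fderiv_slice (hO : IsOpen O) (hF : ContDiffOn ℝ 2 F (slab O)) {t : ℝ}
    (ht : t ∈ Icc (0 : ℝ) 1) {x : Rn n} (hx : x ∈ O) :
    fderiv ℝ (fun y => F (t, y)) x = slabD F O (t, x) ∘L ContinuousLinearMap.inr ℝ ℝ (Rn n) :=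
  (hasFDerivAt_slice hO ht hx (hasFDerivWithinAt_slabD hF ⟨ht, hx⟩)).fderiv

lemma fderiv_fderiv_slice (hO : IsOpen O) (hF : ContDiffOn ℝ 2 F (slab O)) {t : ℝ}
    (ht : t ∈ Icc (0 : ℝ) 1) {x : Rn n} (hx : x ∈ O) (a b : Rn n) :
    fderiv ℝ (fderiv ℝ fun y => F (t, y)) x a b = slabDD F O (t, x) (0, a) (0, b) := by
  have h1 : (fderiv ℝ fun y => F (t, y)) =ᶠ[𝓝 x]
      fun y => slabD F O (t, y) ∘L ContinuousLinearMap.inr ℝ ℝ (Rn n) := by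
    filter_upwards [hO.mem_nhds hx] with y hy
    exact fderiv_slice hO hF ht hy
  have h2 := (hasFDerivAt_slice hO ht hx (hasFDerivWithinAt_slabDD hO hF ⟨ht, hx⟩)).clm_comp
    (hasFDerivAt_const (ContinuousLinearMap.inr ℝ ℝ (Rn n)) x)
  rw [h1.fderiv_eq, h2.fderiv]
  simp

/-- The curve is only known to stay in `O` near `t`, so the chain rule is applied on `Icc 0 1 ∩ x
⁻¹' O`, which gives the same derivative within `Icc 0 1`. -/
lemma hasDerivWithinAt_comp_curve {E : Type*} [NormedAddCommGroup E] [NormedSpace ℝ E]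
    {G : ℝ × Rn n → E} {G' : ℝ × Rn n →L[ℝ] E} {t : ℝ} {x : ℝ → Rn n} {v : Rn n}
    (hO : IsOpen O) (hxt : x t ∈ O) (hx : HasDerivWithinAt x v (Icc 0 1) t)
    (hG : HasFDerivWithinAt G G' (slab O) (t, x t)) :
    HasDerivWithinAt (fun s => G (s, x s)) (G' (1, v)) (Icc 0 1) t := by
  have h1 : HasDerivWithinAt (fun s => (s, x s)) (1, v) (Icc 0 1) t :=
    HasDerivWithinAt.prodMk (hasDerivWithinAt_id t _) hx
  have h2 : x ⁻¹' O ∈ 𝓝[Icc 0 1] t := hx.continuousWithinAt (hO.mem_nhds hxt)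
  have h4 : MapsTo (fun s => (s, x s)) (Icc 0 1 ∩ x ⁻¹' O) (slab O) := fun s hs => ⟨hs.1, hs.2⟩
  have h3 := hG.comp_hasDerivWithinAt t (h1.mono inter_subset_left) h4
  exact (hasDerivWithinAt_inter' h2).1 h3

end Slab

/-! ### The potential and its derivatives in a chart. -/

section LocalPotential

variable {n : ℕ} {M : Type*} [TopologicalSpace M] [ChartedSpace (Rn n) M] [IsManifold (𝓡 n) ∞ M]
  {φ : OpenPartialHomeomorph M (Rn n)} {p : M} {f : ℝ → M → ℝ} {t : ℝ}

/-- The expression of a time dependent function in a chart. -/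
def localPotential (f : ℝ → M → ℝ) (φ : OpenPartialHomeomorph M (Rn n)) (z : ℝ × Rn n) : ℝ :=
  f z.1 (φ.symm z.2)

/-- Time dependent functions of class `C^k` on `[0,1] × M`. -/
def IsTimeSmooth (k : WithTop ℕ∞) (f : ℝ → M → ℝ) : Prop :=
  ContMDiffOn (𝓘(ℝ, ℝ).prod (𝓡 n)) 𝓘(ℝ, ℝ) k (fun z : ℝ × M => f z.1 z.2) (Icc 0 1 ×ˢ univ)

lemma contDiffOn_localPotential {k : WithTop ℕ∞} (hk : k ≤ ∞)
    (h : φ ∈ IsManifold.maximalAtlas (𝓡 n) ∞ M)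
    (hf : IsTimeSmooth (n := n) k f) : ContDiffOn ℝ k (localPotential f φ) (slab φ.target) := by
  rw [← contMDiffOn_iff_contDiffOn]
  have h1 : ContMDiffOn 𝓘(ℝ, ℝ × Rn n) 𝓘(ℝ, ℝ) k (fun z : ℝ × Rn n => z.1) (slab φ.target) :=
    contDiff_fst.contMDiff.contMDiffOn
  have h2 : ContMDiffOn 𝓘(ℝ, ℝ × Rn n) (𝓡 n) k (fun z : ℝ × Rn n => φ.symm z.2)
      (slab φ.target) :=
    ((contMDiffOn_symm_of_mem_maximalAtlas h).of_le hk).comp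
      (contDiff_snd.contMDiff.contMDiffOn (s := slab φ.target)) fun z hz => hz.2
  exact hf.comp (h1.prodMk h2) fun z hz => ⟨hz.1, mem_univ _⟩

/-- The map `γ` serves for the base component of an arbitrary parametrisation of a graph; `γ = id`
gives the derivatives on `M` itself. -/
lemma mfderiv_slice_comp {E : Type*} [NormedAddCommGroup E] [NormedSpace ℝ E]
    (h : φ ∈ IsManifold.maximalAtlas (𝓡 n) ∞ M) {G : ℝ × Rn n → E} {G' : ℝ × Rn n →L[ℝ] E}
    (ht : t ∈ Icc (0 : ℝ) 1) {γ : M → M} (hγ : MDifferentiableAt (𝓡 n) (𝓡 n) γ p)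
    (hp : γ p ∈ φ.source) (hG : HasFDerivWithinAt G G' (slab φ.target) (t, φ (γ p)))
    (u : TangentSpace (𝓡 n) p) :
    mfderiv (𝓡 n) 𝓘(ℝ, E) (fun x => G (t, φ (γ x))) p u =
      G' (0, chartDiff φ (γ p) (mfderiv (𝓡 n) (𝓡 n) γ p u)) := by
  have h1 := hasFDerivAt_slice φ.open_target ht (φ.map_source hp) hG
  have h2 : MDifferentiableAt (𝓡 n) 𝓘(ℝ, Rn n) φ (γ p) :=
    (mdifferentiable_of_mem_maximalAtlas h).mdifferentiableAt hp
  have h3 : MDifferentiableAt (𝓡 n) 𝓘(ℝ, Rn n) (φ ∘ γ) p := h2.comp p hγ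
  have h4 : MDifferentiableAt 𝓘(ℝ, Rn n) 𝓘(ℝ, E) (fun y => G (t, y)) ((φ ∘ γ) p) :=
    h1.differentiableAt.mdifferentiableAt
  have h5 := mfderiv_comp p h4 h3
  have h6 : mfderiv 𝓘(ℝ, Rn n) 𝓘(ℝ, E) (fun y => G (t, y)) ((φ ∘ γ) p) =
      G' ∘L ContinuousLinearMap.inr ℝ ℝ (Rn n) := by
    rw [mfderiv_eq_fderiv]
    exact h1.fderiv
  rw [h6, mfderiv_comp p h2 hγ] at h5
  exact congrArg (fun L : TangentSpace (𝓡 n) p →L[ℝ] E => L u) h5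

lemma localPotential_apply (hp : p ∈ φ.source) (t : ℝ) : localPotential f φ (t, φ p) = f t p := by
  simp [localPotential, φ.left_inv hp]

lemma dt_eq (h : φ ∈ IsManifold.maximalAtlas (𝓡 n) ∞ M) (hf : IsTimeSmooth (n := n) 2 f)
    (ht : t ∈ Icc (0 : ℝ) 1) (hp : p ∈ φ.source) :
    dt f t p = slabD (localPotential f φ) φ.target (t, φ p) (1, 0) := by
  have hF := contDiffOn_localPotential (by norm_cast) h hf
  have h1 := hasDerivWithinAt_comp_curve (t := t) (x := fun _ => φ p) φ.open_target
    (φ.map_source hp) (hasDerivWithinAt_const t _ (φ p))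
    (hasFDerivWithinAt_slabD hF ⟨ht, φ.map_source hp⟩)
  simp only [localPotential_apply hp] at h1
  exact h1.derivWithin (uniqueDiffOn_Icc zero_lt_one t ht)

lemma dFun_eq (h : φ ∈ IsManifold.maximalAtlas (𝓡 n) ∞ M) (hf : IsTimeSmooth (n := n) 2 f)
    (ht : t ∈ Icc (0 : ℝ) 1) (hp : p ∈ φ.source) (u : TangentSpace (𝓡 n) p) :
    dFun (f t) p u = slabD (localPotential f φ) φ.target (t, φ p) (0, chartDiff φ p u) := by
  have hF := contDiffOn_localPotential (by norm_cast) h hf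
  have h1 : f t =ᶠ[𝓝 p] fun x => localPotential f φ (t, φ (id x)) := by
    filter_upwards [φ.open_source.mem_nhds hp] with x hx
    exact (localPotential_apply hx t).symm
  have h2 := mfderiv_slice_comp (γ := id) h ht mdifferentiableAt_id hp
    (hasFDerivWithinAt_slabD hF ⟨ht, φ.map_source hp⟩) u
  rw [dFun, h1.mfderiv_eq]
  refine h2.trans ?_
  rw [mfderiv_id]
  rfl

lemma dFun_dt_comp (h : φ ∈ IsManifold.maximalAtlas (𝓡 n) ∞ M) (hf : IsTimeSmooth (n := n) 2 f)
    (ht : t ∈ Icc (0 : ℝ) 1) {γ : M → M} (hγ : MDifferentiableAt (𝓡 n) (𝓡 n) γ p)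
    (hp : γ p ∈ φ.source) (u : TangentSpace (𝓡 n) p) :
    dFun (dt f t ∘ γ) p u = slabDD (localPotential f φ) φ.target (t, φ (γ p))
      (0, chartDiff φ (γ p) (mfderiv (𝓡 n) (𝓡 n) γ p u)) (1, 0) := by
  have hF := contDiffOn_localPotential (by norm_cast) h hf
  have h1 : dt f t ∘ γ =ᶠ[𝓝 p]
      fun x => slabD (localPotential f φ) φ.target (t, φ (γ x)) (1, 0) := by
    filter_upwards [hγ.continuousAt (φ.open_source.mem_nhds hp)] with x hx
    exact dt_eq h hf ht hx
  have h2 := mfderiv_slice_comp (G := fun z => slabD (localPotential f φ) φ.target z (1, 0)) h ht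
    hγ hp ((hasFDerivWithinAt_slabDD φ.open_target hF ⟨ht, φ.map_source hp⟩).clm_apply
      (hasFDerivWithinAt_const _ _ _)) u
  rw [dFun, h1.mfderiv_eq]
  refine h2.trans ?_
  simp
  rfl

lemma dFun_dt (h : φ ∈ IsManifold.maximalAtlas (𝓡 n) ∞ M) (hf : IsTimeSmooth (n := n) 2 f)
    (ht : t ∈ Icc (0 : ℝ) 1) (hp : p ∈ φ.source) (u : TangentSpace (𝓡 n) p) :
    dFun (dt f t) p u = slabDD (localPotential f φ) φ.target (t, φ p)
      (0, chartDiff φ p u) (1, 0) := by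
  refine (dFun_dt_comp (γ := id) h hf ht mdifferentiableAt_id hp u).trans ?_
  rw [mfderiv_id]
  rfl

lemma hasDerivWithinAt_dt_comp (h : φ ∈ IsManifold.maximalAtlas (𝓡 n) ∞ M)
    (hf : IsTimeSmooth (n := n) 2 f) (ht : t ∈ Icc (0 : ℝ) 1) {x : ℝ → M} {v : Rn n}
    (hp : x t ∈ φ.source) (hc : ContinuousWithinAt x (Icc 0 1) t)
    (hx : HasDerivWithinAt (φ ∘ x) v (Icc 0 1) t) :
    HasDerivWithinAt (fun s => dt f s (x s)) (slabDD (localPotential f φ) φ.target (t, φ (x t))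
      (1, v) (1, 0)) (Icc 0 1) t := by
  have hF := contDiffOn_localPotential (by norm_cast) h hf
  have h1 : (fun s => dt f s (x s)) =ᶠ[𝓝[Icc 0 1] t]
      fun s => slabD (localPotential f φ) φ.target (s, φ (x s)) (1, 0) := by
    filter_upwards [hc (φ.open_source.mem_nhds hp), self_mem_nhdsWithin] with s hs hs'
    exact dt_eq h hf hs' hs
  have h2 := hasDerivWithinAt_comp_curve (x := φ ∘ x)
    (G := fun z => slabD (localPotential f φ) φ.target z (1, 0)) φ.open_target
    (φ.map_source hp) hx ((hasFDerivWithinAt_slabDD φ.open_target hF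
      ⟨ht, φ.map_source hp⟩).clm_apply (hasFDerivWithinAt_const _ _ _))
  refine (h2.congr_of_eventuallyEq h1 (dt_eq h hf ht hp)).congr_deriv ?_
  simp

end LocalPotential

/-! ### Graphs of differentials in complex coordinates. -/

section GradientCoordinates

variable {n : ℕ} {O : Set (Rn n)} {F : ℝ × Rn n → ℝ} {k m : WithTop ℕ∞}

/-- The complex coordinates `x + √-1 ∂F/∂x` of the graph of the differential. -/
def gradCoord (F : ℝ × Rn n → ℝ) (O : Set (Rn n)) (z : ℝ × Rn n) : Fin n → ℂ :=
  fun i => ⟨z.2 i, slabD F O z (0, stdVec n i)⟩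

/-- The differential of `gradCoord`. -/
def gradCoordD (F : ℝ × Rn n → ℝ) (O : Set (Rn n)) (z : ℝ × Rn n) :
    ℝ × Rn n →L[ℝ] (Fin n → ℂ) :=
  ContinuousLinearMap.pi fun i => (Complex.equivRealProdCLM.symm : ℝ × ℝ →L[ℝ] ℂ) ∘L
    (((EuclideanSpace.proj i : Rn n →L[ℝ] ℝ) ∘L ContinuousLinearMap.snd ℝ ℝ (Rn n)).prod
      ((slabDD F O z).flip (0, stdVec n i)))

lemma gradCoordD_apply (z w : ℝ × Rn n) (i : Fin n) :
    gradCoordD F O z w i = ⟨w.2 i, slabDD F O z w (0, stdVec n i)⟩ := by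
  apply Complex.ext <;> simp [gradCoordD]

lemma gradCoord_eq : gradCoord F O = fun z i => Complex.equivRealProdCLM.symm
    ((EuclideanSpace.proj i : Rn n →L[ℝ] ℝ) z.2, slabD F O z (0, stdVec n i)) := by
  ext z i
  apply Complex.ext <;> simp [gradCoord]

lemma contDiffOn_gradCoord (hO : IsOpen O) (hF : ContDiffOn ℝ k F (slab O)) (hmk : m + 1 ≤ k) :
    ContDiffOn ℝ m (gradCoord F O) (slab O) := by
  rw [gradCoord_eq, contDiffOn_pi]
  intro i
  refine Complex.equivRealProdCLM.symm.contDiff.comp_contDiffOn (ContDiffOn.prodMk ?_ ?_)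
  · exact ((EuclideanSpace.proj i : Rn n →L[ℝ] ℝ).contDiff.comp contDiff_snd).contDiffOn
  · exact (contDiffOn_slabD hO hF hmk).clm_apply contDiffOn_const

lemma hasFDerivWithinAt_gradCoord (hO : IsOpen O) (hF : ContDiffOn ℝ 2 F (slab O))
    {z : ℝ × Rn n} (hz : z ∈ slab O) :
    HasFDerivWithinAt (gradCoord F O) (gradCoordD F O z) (slab O) z := by
  rw [gradCoord_eq, hasFDerivWithinAt_pi']
  intro i
  have h1 := (hasFDerivWithinAt_slabDD hO hF hz).clm_apply
    (hasFDerivWithinAt_const ((0, stdVec n i) : ℝ × Rn n) z (slab O))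
  have h2 : HasFDerivWithinAt (fun z : ℝ × Rn n => (EuclideanSpace.proj i : Rn n →L[ℝ] ℝ) z.2)
    ((EuclideanSpace.proj i : Rn n →L[ℝ] ℝ) ∘L ContinuousLinearMap.snd ℝ ℝ (Rn n)) (slab O) z :=
    ((EuclideanSpace.proj i : Rn n →L[ℝ] ℝ) ∘L
      ContinuousLinearMap.snd ℝ ℝ (Rn n)).hasFDerivWithinAt
  have h3 := (Complex.equivRealProdCLM.symm : ℝ × ℝ →L[ℝ] ℂ).hasFDerivAt.comp_hasFDerivWithinAt z
    (h2.prodMk h1)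
  refine h3.congr_fderiv ?_
  ext w
  all_goals simp [gradCoordD]

end GradientCoordinates

/-! ### Regularity of the section `df_t`. -/

section DifferentialSections

variable {n : ℕ} {M : Type*} [TopologicalSpace M] [ChartedSpace (Rn n) M] [IsManifold (𝓡 n) ∞ M]
  {φ : OpenPartialHomeomorph M (Rn n)} {p : M} {f : ℝ → M → ℝ} {t : ℝ} {k m : WithTop ℕ∞}

lemma cotCoord_dSection (h : φ ∈ IsManifold.maximalAtlas (𝓡 n) ∞ M)
    (hf : IsTimeSmooth (n := n) 2 f) (ht : t ∈ Icc (0 : ℝ) 1) (hp : p ∈ φ.source) :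
    cotCoord φ (dSection (f t) p) = gradCoord (localPotential f φ) φ.target (t, φ p) := by
  ext i
  apply Complex.ext
  · rfl
  · change dFun (f t) p (coordVec φ p i) = _
    rw [dFun_eq h hf ht hp, chartDiff_coordVec h hp]
    rfl

lemma IsTimeSmooth.of_le (hf : IsTimeSmooth (n := n) k f) (h : m ≤ k) :
    IsTimeSmooth (n := n) m f :=
  ContMDiffOn.of_le hf h

/-- In the induced chart the section is `gradCoord`, which involves one derivative of the potential;
hence the loss of one order. -/
lemma IsTimeSmooth.contMDiffOn_dSection (hf : IsTimeSmooth (n := n) k f) (hk : k ≤ ∞)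
    (h2 : 2 ≤ k) (hmk : m + 1 ≤ k) :
    ContMDiffOn (𝓘(ℝ, ℝ).prod (𝓡 n)) (cotModel n) m
      (fun z : ℝ × M => (dSection (f z.1) z.2 : CotangentBundle n M))
      (Icc 0 1 ×ˢ univ) := by
  rintro ⟨t, p⟩ ⟨ht, -⟩
  have ht : t ∈ Icc (0 : ℝ) 1 := ht
  set φ := chartAt (Rn n) p
  have h : φ ∈ IsManifold.maximalAtlas (𝓡 n) ∞ M := IsManifold.chart_mem_maximalAtlas p
  have hp : p ∈ φ.source := mem_chart_source (Rn n) p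
  have hmi : m ≤ ∞ := (le_self_add.trans hmk).trans hk
  have hφ : ContMDiffAt (𝓘(ℝ, ℝ).prod (𝓡 n)) 𝓘(ℝ, Rn n) m (fun z : ℝ × M => φ z.2) (t, p) :=
    ((contMDiffAt_of_mem_maximalAtlas h hp).of_le hmi).comp (t, p) contMDiffAt_snd
  have h3 : ContMDiffWithinAt (𝓘(ℝ, ℝ).prod (𝓡 n)) 𝓘(ℝ, ℝ × Rn n) m
      (fun z : ℝ × M => (z.1, φ z.2)) (Icc 0 1 ×ˢ φ.source) (t, p) :=
    contMDiffWithinAt_fst.prodMk_space hφ.contMDiffWithinAt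
  have h4 : ContMDiffWithinAt 𝓘(ℝ, ℝ × Rn n) 𝓘(ℝ, Fin n → ℂ) m
      (gradCoord (localPotential f φ) φ.target) (slab φ.target) (t, φ p) :=
    (contDiffOn_gradCoord φ.open_target (contDiffOn_localPotential hk h hf) hmk (t, φ p)
      (mk_mem_prod ht (φ.map_source hp))).contMDiffWithinAt
  have h5 := h4.comp (t, p) h3 fun z hz => mk_mem_prod hz.1 (φ.map_source hz.2)
  have hz : gradCoord (localPotential f φ) φ.target (t, φ p) = cotCoord φ (dSection (f t) p) :=
    (cotCoord_dSection h (hf.of_le h2) ht hp).symm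
  have h6 : ContMDiffAt 𝓘(ℝ, Fin n → ℂ) (cotModel n) m (cotChartSymm φ)
      (gradCoord (localPotential f φ) φ.target (t, φ p)) := by
    refine (contMDiffAt_cotChartSymm h ?_).of_le hmi
    rw [hz]
    exact φ.map_source hp
  have h7 := h6.comp_contMDiffWithinAt (t, p) h5
  have h8 : ContMDiffWithinAt (𝓘(ℝ, ℝ).prod (𝓡 n)) (cotModel n) m
      (fun z : ℝ × M => (dSection (f z.1) z.2 : CotangentBundle n M)) (Icc 0 1 ×ˢ φ.source) (t, p) := by
    have heq (z : ℝ × M) (hz : z ∈ Icc (0 : ℝ) 1 ×ˢ φ.source) : dSection (f z.1) z.2 =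
        cotChartSymm φ (gradCoord (localPotential f φ) φ.target (z.1, φ z.2)) := by
      rw [← cotCoord_dSection h (hf.of_le h2) hz.1 hz.2]
      exact ((cotChart h).left_inv (x := dSection (f z.1) z.2) hz.2).symm
    exact h7.congr heq (heq (t, p) ⟨ht, hp⟩)
  refine h8.mono_of_mem_nhdsWithin ?_
  rw [nhdsWithin_prod_eq, nhdsWithin_univ]
  exact Filter.prod_mem_prod self_mem_nhdsWithin (φ.open_source.mem_nhds hp)

lemma contMDiff_slice {V : Type*} [NormedAddCommGroup V] [NormedSpace ℝ V] {H : Type*}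
    [TopologicalSpace H] {I : ModelWithCorners ℝ V H} {X : Type*} [TopologicalSpace X]
    [ChartedSpace H X] {g : ℝ → M → X}
    (hg : ContMDiffOn (𝓘(ℝ, ℝ).prod (𝓡 n)) I m (fun z : ℝ × M => g z.1 z.2) (Icc 0 1 ×ˢ univ))
    (ht : t ∈ Icc (0 : ℝ) 1) : ContMDiff (𝓡 n) I m (g t) := by
  rw [← contMDiffOn_univ]
  exact hg.comp (f := fun p => (t, p)) (contMDiffOn_const.prodMk contMDiffOn_id)
    fun p _ => ⟨ht, mem_univ _⟩

lemma contMDiffOn_curve {V : Type*} [NormedAddCommGroup V] [NormedSpace ℝ V] {H : Type*}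
    [TopologicalSpace H] {I : ModelWithCorners ℝ V H} {X : Type*} [TopologicalSpace X]
    [ChartedSpace H X] {g : ℝ → M → X}
    (hg : ContMDiffOn (𝓘(ℝ, ℝ).prod (𝓡 n)) I m (fun z : ℝ × M => g z.1 z.2) (Icc 0 1 ×ˢ univ))
    (p : M) : ContMDiffOn 𝓘(ℝ, ℝ) I m (fun s => g s p) (Icc 0 1) :=
  hg.comp (f := fun s => (s, p)) (contMDiffOn_id.prodMk contMDiffOn_const)
    fun _ hs => ⟨hs, mem_univ _⟩

end DifferentialSections

/-! ### Derivatives of an arbitrary parametrisation of the graphs. -/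

section GraphPaths

variable {n : ℕ} {M : Type*} [TopologicalSpace M] [ChartedSpace (Rn n) M] [IsManifold (𝓡 n) ∞ M]
  {φ : OpenPartialHomeomorph M (Rn n)} {A : Set (OpenPartialHomeomorph M (Rn n))} {p : M}
  {f : ℝ → M → ℝ} {t : ℝ} {g : ℝ → M → CotangentBundle n M}

/-- A family of parametrizations of the graphs of `df_t`, of class `C¹`. -/
structure IsGraphFamily (f : ℝ → M → ℝ) (g : ℝ → M → CotangentBundle n M) : Prop where
  contMDiffOn : ContMDiffOn (𝓘(ℝ, ℝ).prod (𝓡 n)) (cotModel n) 1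
    (fun z : ℝ × M => g z.1 z.2) (Icc 0 1 ×ˢ univ)
  eq_dSection : ∀ t ∈ Icc (0 : ℝ) 1, ∀ p, g t p = dSection (f t) (g t p).proj

/-- The differential, in a chart, of the base component of a map into the cotangent bundle. -/
def baseDiff (φ : M → Rn n) (g : M → CotangentBundle n M) (p : M) : TangentSpace (𝓡 n) p →L[ℝ] Rn n :=
  chartDiff φ (g p).proj ∘L mfderiv (𝓡 n) (𝓡 n) (fun x => (g x).proj) p

lemma IsGraphFamily.mdifferentiableAt_proj (hg : IsGraphFamily f g) (ht : t ∈ Icc (0 : ℝ) 1) (p : M) :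
    MDifferentiableAt (𝓡 n) (𝓡 n) (fun x => (g t x).proj) p :=
  (((Bundle.contMDiff_proj (fun p : M => TangentSpace (𝓡 n) p →L[ℝ] ℝ)).comp (contMDiff_slice hg.contMDiffOn ht)) p).mdifferentiableAt
    one_ne_zero

lemma IsGraphFamily.contMDiffOn_proj (hg : IsGraphFamily f g) (p : M) :
    ContMDiffOn 𝓘(ℝ, ℝ) (𝓡 n) 1 (fun s => (g s p).proj) (Icc 0 1) :=
  (Bundle.contMDiff_proj (fun p : M => TangentSpace (𝓡 n) p →L[ℝ] ℝ)).comp_contMDiffOn (contMDiffOn_curve hg.contMDiffOn p)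

/-- Since `g t` lands on the graph, its complex coordinates are `gradCoord` composed with the base
component, and the chain rule involves that component alone. -/
lemma IsGraphFamily.coframe_mfderiv (hg : IsGraphFamily f g) (hA : IsIntegrableParallelization A)
    (hφ : φ ∈ A) (hf : IsTimeSmooth (n := n) 2 f) (ht : t ∈ Icc (0 : ℝ) 1)
    (hp : (g t p).proj ∈ φ.source) (u : TangentSpace (𝓡 n) p) :
    hA.coframe (g t p) (mfderiv (𝓡 n) (cotModel n) (g t) p u) =
      gradCoordD (localPotential f φ) φ.target (t, φ (g t p).proj) (0, baseDiff φ (g t) p u) := by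
  have h := hA.smooth hφ
  have hF := contDiffOn_localPotential (by norm_cast) h hf
  have hγ := hg.mdifferentiableAt_proj ht p
  rw [hA.coframe_apply hφ hp]
  have h1 : MDifferentiableAt (cotModel n) 𝓘(ℝ, Fin n → ℂ) (cotCoord φ) (g t p) :=
    (contMDiffAt_cotCoord h hp).mdifferentiableAt (by simp)
  have h2 : MDifferentiableAt (𝓡 n) (cotModel n) (g t) p :=
    (contMDiff_slice hg.contMDiffOn ht p).mdifferentiableAt one_ne_zero
  have h3 : cotCoord φ ∘ g t =ᶠ[𝓝 p] fun x =>
      gradCoord (localPotential f φ) φ.target (t, φ ((fun x => (g t x).proj) x)) := by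
    filter_upwards [hγ.continuousAt (φ.open_source.mem_nhds hp)] with x hx
    have := cotCoord_dSection h hf ht hx
    rw [← this, Function.comp_apply, hg.eq_dSection t ht x]
  have h4 := mfderiv_slice_comp h ht hγ hp (hasFDerivWithinAt_gradCoord φ.open_target hF
    ⟨ht, φ.map_source hp⟩) u
  refine Eq.trans ?_ h4
  rw [← h3.mfderiv_eq, mfderiv_comp p h1 h2]
  rfl

/-- As for the space derivative; the graph itself also moves, whence the time component `1` in `(1,
v)`. -/
lemma IsGraphFamily.coframe_timeDeriv (hg : IsGraphFamily f g)
    (hA : IsIntegrableParallelization A) (hφ : φ ∈ A) (hf : IsTimeSmooth (n := n) 2 f)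
    (ht : t ∈ Icc (0 : ℝ) 1) (hp : (g t p).proj ∈ φ.source) {v : Rn n}
    (hv : HasDerivWithinAt (fun s => φ (g s p).proj) v (Icc 0 1) t) :
    hA.coframe (g t p) (timeDeriv (cotModel n) g t p) =
      gradCoordD (localPotential f φ) φ.target (t, φ (g t p).proj) (1, v) := by
  have h := hA.smooth hφ
  have hF := contDiffOn_localPotential (by norm_cast) h hf
  rw [hA.coframe_apply hφ hp]
  have h1 : MDifferentiableAt (cotModel n) 𝓘(ℝ, Fin n → ℂ) (cotCoord φ) (g t p) :=
    (contMDiffAt_cotCoord h hp).mdifferentiableAt (by simp)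
  have h2 : MDifferentiableWithinAt 𝓘(ℝ, ℝ) (cotModel n) (fun s => g s p) (Icc 0 1) t :=
    (contMDiffOn_curve hg.contMDiffOn p t ht).mdifferentiableWithinAt one_ne_zero
  have hu : UniqueMDiffWithinAt 𝓘(ℝ, ℝ) (Icc (0 : ℝ) 1) t :=
    (uniqueDiffOn_Icc zero_lt_one t ht).uniqueMDiffWithinAt
  have h3 : ∀ s ∈ Icc (0 : ℝ) 1, (g s p).proj ∈ φ.source → cotCoord φ (g s p) =
      gradCoord (localPotential f φ) φ.target (s, φ (g s p).proj) := by
    intro s hs hx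
    have := cotCoord_dSection h hf hs hx
    rw [← this, hg.eq_dSection s hs p]
    rfl
  have h5 : cotCoord φ ∘ (fun s => g s p) =ᶠ[𝓝[Icc 0 1] t] fun s =>
      gradCoord (localPotential f φ) φ.target (s, φ (g s p).proj) := by
    filter_upwards [(hg.contMDiffOn_proj p t ht).continuousWithinAt (φ.open_source.mem_nhds hp),
      self_mem_nhdsWithin] with s hs hs'
    exact h3 s hs' hs
  have h4 := hasDerivWithinAt_comp_curve φ.open_target (φ.map_source hp) hv
    (hasFDerivWithinAt_gradCoord φ.open_target hF ⟨ht, φ.map_source hp⟩)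
  have h6 := (h4.congr_of_eventuallyEq h5 (h3 t ht hp)).hasFDerivWithinAt.fderivWithin
    (uniqueDiffOn_Icc zero_lt_one t ht)
  rw [← mfderivWithin_eq_fderivWithin, mfderiv_comp_mfderivWithin t h1 h2 hu] at h6
  have h7 := congrArg (fun l : ℝ →L[ℝ] (Fin n → ℂ) => l 1) h6
  refine Eq.trans h7 ?_
  simp

end GraphPaths

/-! ### The matrix `1 + √-1 Hess` as differential of the graph. -/

section SlabHessian

variable {n : ℕ} {O : Set (Rn n)} {F : ℝ × Rn n → ℝ}

/-- The Hessian in the space variables. -/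
def slabHess (F : ℝ × Rn n → ℝ) (O : Set (Rn n)) (z : ℝ × Rn n) : Matrix (Fin n) (Fin n) ℝ :=
  Matrix.of fun i j => slabDD F O z (0, stdVec n i) (0, stdVec n j)

/-- The space gradient of the time derivative. -/
def slabMixed (F : ℝ × Rn n → ℝ) (O : Set (Rn n)) (z : ℝ × Rn n) (i : Fin n) : ℝ :=
  slabDD F O z (0, stdVec n i) (1, 0)

/-- The matrix `1 + √-1 Hess F`. -/
def cayley (F : ℝ × Rn n → ℝ) (O : Set (Rn n)) (z : ℝ × Rn n) : Matrix (Fin n) (Fin n) ℂ :=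
  1 + Complex.I • (slabHess F O z).map Complex.ofReal

lemma slabDD_space_left (z w : ℝ × Rn n) (y : Rn n) :
    slabDD F O z (0, y) w = ∑ i, y i * slabDD F O z (0, stdVec n i) w := by
  have h := clm_eq_sum_stdVec ((slabDD F O z).flip w ∘L ContinuousLinearMap.inr ℝ ℝ (Rn n)) y
  simpa using h

lemma slabDD_space_mixed (z : ℝ × Rn n) (y : Rn n) :
    slabDD F O z (0, y) (1, 0) = ∑ i, slabMixed F O z i * y i := by
  rw [slabDD_space_left]
  exact Finset.sum_congr rfl fun i _ => mul_comm _ _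

lemma slabDD_space_space (hO : IsOpen O) (hF : ContDiffOn ℝ 2 F (slab O)) {z : ℝ × Rn n}
    (hz : z ∈ slab O) (y : Rn n) (i : Fin n) :
    slabDD F O z (0, y) (0, stdVec n i) = (slabHess F O z).mulVec y i := by
  rw [slabDD_space_left, Matrix.mulVec, dotProduct]
  refine Finset.sum_congr rfl fun j _ => ?_
  rw [mul_comm, slabDD_symm hO hF hz]
  rfl

lemma slabDD_space_space' (z : ℝ × Rn n) (x y : Rn n) :
    slabDD F O z (0, x) (0, y) = ∑ i, ∑ j, x i * slabHess F O z i j * y j := by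
  rw [slabDD_space_left]
  refine Finset.sum_congr rfl fun i _ => ?_
  have h := clm_eq_sum_stdVec ((slabDD F O z (0, stdVec n i)) ∘L
    ContinuousLinearMap.inr ℝ ℝ (Rn n)) y
  simp only [ContinuousLinearMap.comp_apply, ContinuousLinearMap.inr_apply] at h
  rw [h, Finset.mul_sum]
  exact Finset.sum_congr rfl fun j _ => by simp [slabHess]; ring

lemma gradCoordD_space (hO : IsOpen O) (hF : ContDiffOn ℝ 2 F (slab O)) {z : ℝ × Rn n}
    (hz : z ∈ slab O) (y : Rn n) :
    gradCoordD F O z (0, y) = (cayley F O z).mulVec fun i => (y i : ℂ) := by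
  ext i
  rw [gradCoordD_apply, slabDD_space_space hO hF hz, cayley, Matrix.add_mulVec, Matrix.one_mulVec,
    Matrix.smul_mulVec]
  have h : ((slabHess F O z).map Complex.ofReal).mulVec (fun i => (y i : ℂ)) i =
      (((slabHess F O z).mulVec y i : ℝ) : ℂ) := by
    simp [Matrix.mulVec, dotProduct]
  rw [Pi.add_apply, Pi.smul_apply, h]
  apply Complex.ext <;> simp

lemma gradCoordD_time (hO : IsOpen O) (hF : ContDiffOn ℝ 2 F (slab O)) {z : ℝ × Rn n}
    (hz : z ∈ slab O) (v : Rn n) :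
    gradCoordD F O z (1, v) = (cayley F O z).mulVec (fun i => (v i : ℂ)) +
      Complex.I • fun i => (slabMixed F O z i : ℂ) := by
  have h1 : ((1, v) : ℝ × Rn n) = (0, v) + (1, 0) := by simp
  rw [h1, map_add, gradCoordD_space hO hF hz]
  congr 1
  ext i
  rw [gradCoordD_apply, slabDD_symm hO hF hz]
  apply Complex.ext <;> simp [slabMixed]

end SlabHessian

/-! ### The forms `ω` and `Re (e^{-√-1 θ} Ω)` along the path of graphs. -/

section GraphGeometry

variable {n : ℕ} {M : Type*} [TopologicalSpace M] [ChartedSpace (Rn n) M] [IsManifold (𝓡 n) ∞ M]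
  {φ : OpenPartialHomeomorph M (Rn n)} {A : Set (OpenPartialHomeomorph M (Rn n))} {p : M}
  {f : ℝ → M → ℝ} {t θ : ℝ} {g : ℝ → M → CotangentBundle n M}

lemma IsIntegrableParallelization.omega_apply (hA : IsIntegrableParallelization A)
    (q : CotangentBundle n M) (u w : TangentSpace (cotModel n) q) :
    hA.calabiYau.omega q ![u, w] = ∑ i, ((hA.coframe q u i).re * (hA.coframe q w i).im -
      (hA.coframe q u i).im * (hA.coframe q w i).re) := rfl

lemma IsIntegrableParallelization.reForm_apply (hA : IsIntegrableParallelization A) (θ : ℝ)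
    (q : CotangentBundle n M) (u : Fin n → TangentSpace (cotModel n) q) :
    reForm hA.calabiYau θ q u = (Complex.exp (-(θ : ℂ) * Complex.I) *
      (Matrix.of fun i j => hA.coframe q (u j) i).det).re := rfl

lemma IsGraphFamily.exists_hasDerivWithinAt (hg : IsGraphFamily f g)
    (h : φ ∈ IsManifold.maximalAtlas (𝓡 n) ∞ M) (ht : t ∈ Icc (0 : ℝ) 1)
    (hp : (g t p).proj ∈ φ.source) :
    ∃ v, HasDerivWithinAt (fun s => φ (g s p).proj) v (Icc 0 1) t := by
  have h1 : ContMDiffWithinAt 𝓘(ℝ, ℝ) 𝓘(ℝ, Rn n) 1 (fun s => φ (g s p).proj) (Icc 0 1) t :=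
    ((contMDiffAt_of_mem_maximalAtlas h hp).of_le (by norm_cast)).comp_contMDiffWithinAt t
      (hg.contMDiffOn_proj p t ht)
  exact ⟨_, (h1.contDiffWithinAt.differentiableWithinAt one_ne_zero).hasDerivWithinAt⟩

/-- Graphs of differentials are Lagrangian by symmetry of the Hessian. -/
lemma IsGraphFamily.omega_mfderiv (hg : IsGraphFamily f g) (hA : IsIntegrableParallelization A)
    (hf : IsTimeSmooth (n := n) 2 f) (ht : t ∈ Icc (0 : ℝ) 1) (u w : TangentSpace (𝓡 n) p) :
    hA.calabiYau.omega (g t p) ![mfderiv (𝓡 n) (cotModel n) (g t) p u,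
      mfderiv (𝓡 n) (cotModel n) (g t) p w] = 0 := by
  obtain ⟨φ, hφ, hp⟩ := hA.cover (g t p).proj
  have hF := contDiffOn_localPotential (by norm_cast) (hA.smooth hφ) hf
  set x := baseDiff φ (g t) p u
  set y := baseDiff φ (g t) p w
  rw [hA.omega_apply, hg.coframe_mfderiv hA hφ hf ht hp, hg.coframe_mfderiv hA hφ hf ht hp]
  simp only [gradCoordD_apply]
  rw [Finset.sum_sub_distrib, sub_eq_zero]
  have h1 := slabDD_space_left (F := localPotential f φ) (O := φ.target)
    (t, φ (g t p).proj) (0, y) x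
  have h2 := slabDD_space_left (F := localPotential f φ) (O := φ.target)
    (t, φ (g t p).proj) (0, x) y
  rw [slabDD_symm φ.open_target hF ⟨ht, φ.map_source hp⟩, h2] at h1
  rw [Finset.sum_congr rfl fun i _ => mul_comm _ (y i),
    Finset.sum_congr rfl fun i _ => congrArg (x i * ·)
      (slabDD_symm φ.open_target hF ⟨ht, φ.map_source hp⟩ (0, y) (0, stdVec n i)),
    Finset.sum_congr rfl fun i _ => congrArg (y i * ·)
      (slabDD_symm φ.open_target hF ⟨ht, φ.map_source hp⟩ (0, x) (0, stdVec n i))]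
  exact h1.symm

/-- With `x` the base component of `u`, the left side is `F''((0,x),(0,v)) - F''((1,v),(0,x))`. By
symmetry the contribution of `v` cancels, so reparametrising the graphs does not matter, and
`-F''((0,x),(1,0))` remains. -/
lemma IsGraphFamily.omega_timeDeriv (hg : IsGraphFamily f g) (hA : IsIntegrableParallelization A)
    (hf : IsTimeSmooth (n := n) 2 f) (ht : t ∈ Icc (0 : ℝ) 1) (u : TangentSpace (𝓡 n) p) :
    hA.calabiYau.omega (g t p) ![timeDeriv (cotModel n) g t p,
      mfderiv (𝓡 n) (cotModel n) (g t) p u] = - dFun (dt f t ∘ fun x => (g t x).proj) p u := by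
  obtain ⟨φ, hφ, hp⟩ := hA.cover (g t p).proj
  have hF := contDiffOn_localPotential (by norm_cast) (hA.smooth hφ) hf
  obtain ⟨v, hv⟩ := hg.exists_hasDerivWithinAt (hA.smooth hφ) ht hp
  rw [hA.omega_apply, hg.coframe_mfderiv hA hφ hf ht hp, hg.coframe_timeDeriv hA hφ hf ht hp hv,
    dFun_dt_comp (hA.smooth hφ) hf ht (hg.mdifferentiableAt_proj ht p) hp]
  change _ = - slabDD _ _ _ (0, baseDiff φ (g t) p u) (1, 0)
  set x := baseDiff φ (g t) p u
  simp only [gradCoordD_apply]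
  have hz : ((t, φ (g t p).proj) : ℝ × Rn n) ∈ slab φ.target := ⟨ht, φ.map_source hp⟩
  have h1 := slabDD_space_left (F := localPotential f φ) (O := φ.target)
    (t, φ (g t p).proj) (1, v) x
  have h2 := slabDD_space_left (F := localPotential f φ) (O := φ.target)
    (t, φ (g t p).proj) (0, x) v
  rw [Finset.sum_sub_distrib, Finset.sum_congr rfl fun i _ => mul_comm _ (x i),
    Finset.sum_congr rfl fun i _ => congrArg (v i * ·)
      (slabDD_symm φ.open_target hF hz (0, x) (0, stdVec n i)),
    Finset.sum_congr rfl fun i _ => congrArg (x i * ·)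
      (slabDD_symm φ.open_target hF hz (1, v) (0, stdVec n i))]
  rw [← h1, ← h2, slabDD_symm φ.open_target hF hz (0, v), ← map_sub, ← map_neg]
  congr 1
  ext <;> simp

lemma IsGraphFamily.reForm_mfderiv (hg : IsGraphFamily f g) (hA : IsIntegrableParallelization A)
    (hφ : φ ∈ A) (hf : IsTimeSmooth (n := n) 2 f) (ht : t ∈ Icc (0 : ℝ) 1)
    (hp : (g t p).proj ∈ φ.source) (u : Fin n → TangentSpace (𝓡 n) p) :
    reForm hA.calabiYau θ (g t p) (fun j => mfderiv (𝓡 n) (cotModel n) (g t) p (u j)) =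
      (Complex.exp (-(θ : ℂ) * Complex.I) * (cayley (localPotential f φ) φ.target
        (t, φ (g t p).proj) *
        (Matrix.of fun i j => baseDiff φ (g t) p (u j) i).map Complex.ofReal).det).re := by
  have hF := contDiffOn_localPotential (by norm_cast) (hA.smooth hφ) hf
  rw [hA.reForm_apply]
  congr 3
  ext i j
  rw [Matrix.of_apply, hg.coframe_mfderiv hA hφ hf ht hp,
    gradCoordD_space φ.open_target hF ⟨ht, φ.map_source hp⟩]
  rfl

lemma IsGraphFamily.reForm_update (hg : IsGraphFamily f g) (hA : IsIntegrableParallelization A)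
    (hφ : φ ∈ A) (hf : IsTimeSmooth (n := n) 2 f) (ht : t ∈ Icc (0 : ℝ) 1)
    (hp : (g t p).proj ∈ φ.source) (u : Fin n → TangentSpace (𝓡 n) p) (i : Fin n)
    (w : TangentSpace (cotModel n) (g t p)) :
    reForm hA.calabiYau θ (g t p)
        (Function.update (fun j => mfderiv (𝓡 n) (cotModel n) (g t) p (u j)) i w) =
      (Complex.exp (-(θ : ℂ) * Complex.I) * ((cayley (localPotential f φ) φ.target
        (t, φ (g t p).proj) * (Matrix.of fun i j => baseDiff φ (g t) p (u j) i).map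
          Complex.ofReal).updateCol i (hA.coframe (g t p) w)).det).re := by
  have hF := contDiffOn_localPotential (by norm_cast) (hA.smooth hφ) hf
  rw [hA.reForm_apply]
  congr 3
  ext k j
  rw [Matrix.of_apply]
  by_cases hj : j = i
  · subst hj
    simp
  · rw [Function.update_of_ne hj, Matrix.updateCol_ne hj, hg.coframe_mfderiv hA hφ hf ht hp,
      gradCoordD_space φ.open_target hF ⟨ht, φ.map_source hp⟩]
    rfl

/-- The determinant is additive in the `i`-th column, so the two contractions merge into one. In
particular `ζ` and `v` enter only through the sum `baseDiff ζ + v`. -/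
lemma IsGraphFamily.isCorrectionVector_iff (hg : IsGraphFamily f g)
    (hA : IsIntegrableParallelization A)
    (hφ : φ ∈ A) (hf : IsTimeSmooth (n := n) 2 f) (ht : t ∈ Icc (0 : ℝ) 1)
    (hp : (g t p).proj ∈ φ.source) {v : Rn n}
    (hv : HasDerivWithinAt (fun s => φ (g s p).proj) v (Icc 0 1) t)
    (ζ : TangentSpace (𝓡 n) p) :
    IsCorrectionVector hA.calabiYau θ g t p ζ ↔ ∀ (u : Fin n → TangentSpace (𝓡 n) p) (i : Fin n),
      (Complex.exp (-(θ : ℂ) * Complex.I) * ((cayley (localPotential f φ) φ.target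
        (t, φ (g t p).proj) * (Matrix.of fun i j => baseDiff φ (g t) p (u j) i).map
          Complex.ofReal).updateCol i ((cayley (localPotential f φ) φ.target
        (t, φ (g t p).proj)).mulVec (fun j => ((baseDiff φ (g t) p ζ + v) j : ℂ)) +
        Complex.I • fun j => (slabMixed (localPotential f φ) φ.target
          (t, φ (g t p).proj) j : ℂ))).det).re = 0 := by
  have hF := contDiffOn_localPotential (by norm_cast) (hA.smooth hφ) hf
  have hz : ((t, φ (g t p).proj) : ℝ × Rn n) ∈ slab φ.target := ⟨ht, φ.map_source hp⟩
  refine forall_congr' fun u => forall_congr' fun i => ?_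
  have h1 : (fun j => mfderiv (𝓡 n) (cotModel n) (g t) p (Function.update u i ζ j)) =
      Function.update (fun j => mfderiv (𝓡 n) (cotModel n) (g t) p (u j)) i
        (mfderiv (𝓡 n) (cotModel n) (g t) p ζ) := by
    ext1 j
    by_cases hj : j = i
    · subst hj; simp
    · simp [hj]
  rw [h1, hg.reForm_update hA hφ hf ht hp, hg.reForm_update hA hφ hf ht hp,
    hg.coframe_mfderiv hA hφ hf ht hp, hg.coframe_timeDeriv hA hφ hf ht hp hv,
    gradCoordD_space φ.open_target hF hz, gradCoordD_time φ.open_target hF hz,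
    ← add_eq_zero_iff_eq_neg, ← Complex.add_re, ← mul_add, ← Matrix.det_updateCol_add,
    ← add_assoc, ← Matrix.mulVec_add]
  have h2 : ((fun j => (baseDiff φ (g t) p ζ j : ℂ)) + fun j => (v j : ℂ)) =
      fun j => ((baseDiff φ (g t) p ζ + v) j : ℂ) := by
    ext j; simp
  rw [h2]

/-- A vector killed by the base differential is killed by the differential of `g t`, because the
graph is determined by its base point. Equality of dimensions gives surjectivity. -/
lemma IsGraphFamily.bijective_baseDiff (hg : IsGraphFamily f g)
    (hA : IsIntegrableParallelization A)
    (hφ : φ ∈ A) (hf : IsTimeSmooth (n := n) 2 f) (ht : t ∈ Icc (0 : ℝ) 1)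
    (hp : (g t p).proj ∈ φ.source)
    (hi : Function.Injective (mfderiv (𝓡 n) (cotModel n) (g t) p)) :
    Function.Bijective (baseDiff φ (g t) p) := by
  have h1 : Function.Injective (baseDiff φ (g t) p) := by
    rw [injective_iff_map_eq_zero]
    intro u hu
    have h2 := hg.coframe_mfderiv hA hφ hf ht hp u
    rw [hu] at h2
    have h3 : ((0 : ℝ), (0 : Rn n)) = 0 := rfl
    rw [h3, map_zero, map_eq_zero_iff _ (hA.coframe (g t p)).injective] at h2
    exact (map_eq_zero_iff _ hi).1 h2
  have h4 : Module.finrank ℝ (TangentSpace (𝓡 n) p) = Module.finrank ℝ (Rn n) := rfl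
  have : FiniteDimensional ℝ (TangentSpace (𝓡 n) p) :=
    inferInstanceAs (FiniteDimensional ℝ (Rn n))
  exact ⟨h1, (LinearMap.injective_iff_surjective_of_finrank_eq_finrank
    (f := (baseDiff φ (g t) p).toLinearMap) h4).1 h1⟩

end GraphGeometry

/-! ### The correction vector and the local DSL. -/

section Corrections

variable {n : ℕ} {M : Type*} [TopologicalSpace M] [ChartedSpace (Rn n) M] [IsManifold (𝓡 n) ∞ M]
  {φ : OpenPartialHomeomorph M (Rn n)} {A : Set (OpenPartialHomeomorph M (Rn n))} {p : M}
  {f : ℝ → M → ℝ} {t θ : ℝ} {g : ℝ → M → CotangentBundle n M}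

/-- The left hand side of the local form of the degenerate special Lagrangian equation. -/
def localDSL (θ : ℝ) (f : ℝ → M → ℝ) (φ : OpenPartialHomeomorph M (Rn n)) (t : ℝ) (p : M) : ℝ :=
  (Complex.exp (-(θ : ℂ) * Complex.I) * (degId n + Complex.I • (Matrix.fromBlocks
    (Matrix.of fun _ _ : Unit => slabDD (localPotential f φ) φ.target (t, φ p) (1, 0) (1, 0))
    (Matrix.of fun _ j => slabMixed (localPotential f φ) φ.target (t, φ p) j)
    (Matrix.of fun i _ => slabMixed (localPotential f φ) φ.target (t, φ p) i)
    (slabHess (localPotential f φ) φ.target (t, φ p))).map Complex.ofReal).det).im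

/-- The real part of the phase of the graph of `df_t`, in a chart. -/
def localPhase (θ : ℝ) (f : ℝ → M → ℝ) (φ : OpenPartialHomeomorph M (Rn n)) (t : ℝ) (p : M) : ℝ :=
  (Complex.exp (-(θ : ℂ) * Complex.I) *
    (cayley (localPotential f φ) φ.target (t, φ p)).det).re

/-- The central identity: the DSL operator is the positive phase times the expression that the
geodesic equation requires to vanish, for any parametrisation of the graphs. -/
lemma IsGraphFamily.localDSL_eq (hg : IsGraphFamily f g)
    (hA : IsIntegrableParallelization A) (hφ : φ ∈ A) (hf : IsTimeSmooth (n := n) 2 f)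
    (ht : t ∈ Icc (0 : ℝ) 1) (hp : (g t p).proj ∈ φ.source)
    (hi : Function.Injective (mfderiv (𝓡 n) (cotModel n) (g t) p))
    (hpos : 0 < localPhase θ f φ t (g t p).proj)
    {ζ : TangentSpace (𝓡 n) p} (hζ : IsCorrectionVector hA.calabiYau θ g t p ζ) :
    localDSL θ f φ t (g t p).proj =
      (derivWithin (fun s => dt f s (g s p).proj) (Icc 0 1) t +
        dFun (dt f t ∘ fun x => (g t x).proj) p ζ) * localPhase θ f φ t (g t p).proj := by
  obtain ⟨v, hv⟩ := hg.exists_hasDerivWithinAt (hA.smooth hφ) ht hp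
  have hD := hg.bijective_baseDiff hA hφ hf ht hp hi
  have hdet : (cayley (localPotential f φ) φ.target (t, φ (g t p).proj)).det ≠ 0 := by
    intro h
    rw [localPhase, h, mul_zero] at hpos
    exact lt_irrefl _ hpos
  rw [hg.isCorrectionVector_iff hA hφ hf ht hp hv] at hζ
  -- In the frame which projects to the standard basis the matrix `U` is the identity, so the
  -- equations for the components of `w` decouple.
  choose e he using fun j => hD.2 (stdVec n j)
  have hU : (Matrix.of fun i j => baseDiff φ (g t) p (e j) i) = 1 := by
    ext i j
    rw [Matrix.of_apply, he, stdVec_apply, Matrix.one_apply]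
  set w := baseDiff φ (g t) p ζ + v
  have hw := fun j => hζ e j
  rw [hU] at hw
  simp only [re_det_updateCol _ _ _ _ _ _ hdet, Matrix.adjugate_one] at hw
  have hw' (j : Fin n) := hw j
  simp only [Matrix.one_apply, ite_mul, one_mul, zero_mul, Finset.sum_ite_eq, Finset.mem_univ,
    if_true] at hw'
  have h1 := im_det_degId_add (Complex.exp (-(θ : ℂ) * Complex.I))
    (slabDD (localPotential f φ) φ.target (t, φ (g t p).proj) (1, 0) (1, 0))
    (slabMixed (localPotential f φ) φ.target (t, φ (g t p).proj)) w
    (slabHess (localPotential f φ) φ.target (t, φ (g t p).proj)) hdet hw'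
  refine h1.trans ?_
  rw [localPhase, cayley]
  congr 1
  have hc : ContinuousWithinAt (fun s => (g s p).proj) (Icc 0 1) t :=
    (hg.contMDiffOn_proj p t ht).continuousWithinAt
  have h2 := (hasDerivWithinAt_dt_comp (hA.smooth hφ) hf ht (x := fun s => (g s p).proj)
    hp hc hv).derivWithin (uniqueDiffOn_Icc zero_lt_one t ht)
  rw [h2, dFun_dt_comp (hA.smooth hφ) hf ht (hg.mdifferentiableAt_proj ht p) hp]
  change _ = _ + slabDD _ _ _ (0, baseDiff φ (g t) p ζ) (1, 0)
  -- The time derivative contributes `s + a·v` and the differential contributes `a·(baseDiff ζ)`;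
  -- together they make `s + a·w`.
  have h3 : ((1, v) : ℝ × Rn n) = (1, 0) + (0, v) := by simp
  rw [h3, map_add, add_apply, slabDD_space_mixed, slabDD_space_mixed,
    add_assoc, ← Finset.sum_add_distrib]
  congr 1
  refine Finset.sum_congr rfl fun i _ => ?_
  simp only [w, PiLp.add_apply]
  ring

/-- The decoupled equations for `w` are solved on dividing by the phase, and the bijective base
differential yields `ζ` from `w - v`. -/
lemma IsGraphFamily.exists_isCorrectionVector (hg : IsGraphFamily f g)
    (hA : IsIntegrableParallelization A) (hφ : φ ∈ A) (hf : IsTimeSmooth (n := n) 2 f)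
    (ht : t ∈ Icc (0 : ℝ) 1) (hp : (g t p).proj ∈ φ.source)
    (hi : Function.Injective (mfderiv (𝓡 n) (cotModel n) (g t) p))
    (hpos : 0 < localPhase θ f φ t (g t p).proj) :
    ∃ ζ, IsCorrectionVector hA.calabiYau θ g t p ζ := by
  obtain ⟨v, hv⟩ := hg.exists_hasDerivWithinAt (hA.smooth hφ) ht hp
  have hD := hg.bijective_baseDiff hA hφ hf ht hp hi
  have hdet : (cayley (localPotential f φ) φ.target (t, φ (g t p).proj)).det ≠ 0 := by
    intro h
    rw [localPhase, h, mul_zero] at hpos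
    exact lt_irrefl _ hpos
  set B := cayley (localPotential f φ) φ.target (t, φ (g t p).proj) with hB
  set a := slabMixed (localPotential f φ) φ.target (t, φ (g t p).proj)
  set w : Rn n := WithLp.toLp 2 fun j => (Complex.exp (-(θ : ℂ) * Complex.I) *
    B.adjugate.mulVec (fun j => (a j : ℂ)) j).im / localPhase θ f φ t (g t p).proj
  obtain ⟨ζ, hζ⟩ := hD.2 (w - v)
  refine ⟨ζ, ?_⟩
  rw [hg.isCorrectionVector_iff hA hφ hf ht hp hv]
  intro u i
  rw [hζ, sub_add_cancel, re_det_updateCol _ _ _ _ _ _ hdet]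
  refine Finset.sum_eq_zero fun j _ => ?_
  have h1 : w j * localPhase θ f φ t (g t p).proj = (Complex.exp (-(θ : ℂ) * Complex.I) *
    B.adjugate.mulVec (fun j => (a j : ℂ)) j).im := div_mul_cancel₀ _ hpos.ne'
  rw [localPhase] at h1
  rw [h1, sub_self, mul_zero]

end Corrections

/-! ### Reduction of the Riemannian DSL to the charts of the parallelization. -/

section DSL

variable {n : ℕ} {M : Type*} [TopologicalSpace M] [ChartedSpace (Rn n) M] [IsManifold (𝓡 n) ∞ M]
  {φ : OpenPartialHomeomorph M (Rn n)} {A : Set (OpenPartialHomeomorph M (Rn n))} {p : M}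
  {f : ℝ → M → ℝ} {t θ : ℝ}

lemma IsIntegrableParallelization.riemHess_eq_slabDD (hA : IsIntegrableParallelization A)
    (hφ : φ ∈ A) (hf : IsTimeSmooth (n := n) 2 f) (ht : t ∈ Icc (0 : ℝ) 1) (hp : p ∈ φ.source)
    (a b : TangentSpace (𝓡 n) p) : riemHess hA.metric (f t) p a b =
      slabDD (localPotential f φ) φ.target (t, φ p) (0, chartDiff φ p a) (0, chartDiff φ p b) := by
  have hF := contDiffOn_localPotential (by norm_cast) (hA.smooth hφ) hf
  have h1 : ContDiffAt ℝ 2 (f t ∘ φ.symm) (φ p) := by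
    have h2 : ContDiffOn ℝ 2 (fun y => localPotential f φ (t, y)) φ.target :=
      hF.comp (contDiff_prodMk_right t).contDiffOn fun y hy => mk_mem_prod ht hy
    exact h2.contDiffAt (φ.open_target.mem_nhds (φ.map_source hp))
  rw [hA.riemHess_eq hφ hp h1]
  exact fderiv_fderiv_slice φ.open_target hF ht (φ.map_source hp) _ _

lemma IsIntegrableParallelization.transpose_mul_eq_one (hA : IsIntegrableParallelization A)
    (hφ : φ ∈ A) (hp : p ∈ φ.source) (e : Fin n → TangentSpace (𝓡 n) p)
    (he : ∀ i j, hA.metric.inner p (e i) (e j) = if i = j then 1 else 0) :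
    (Matrix.of fun i j => chartDiff φ p (e j) i).transpose *
      (Matrix.of fun i j => chartDiff φ p (e j) i) = 1 := by
  ext i j
  rw [Matrix.one_apply, ← he i j, hA.metric_inner hφ hp, Matrix.mul_apply, PiLp.inner_apply]
  refine Finset.sum_congr rfl fun k _ => ?_
  simp [mul_comm]

lemma IsIntegrableParallelization.riemHess_frame (hA : IsIntegrableParallelization A)
    (hφ : φ ∈ A) (hf : IsTimeSmooth (n := n) 2 f) (ht : t ∈ Icc (0 : ℝ) 1) (hp : p ∈ φ.source)
    (e : Fin n → TangentSpace (𝓡 n) p) :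
    (Matrix.of fun i j => riemHess hA.metric (f t) p (e i) (e j)) =
      (Matrix.of fun i j => chartDiff φ p (e j) i).transpose *
        slabHess (localPotential f φ) φ.target (t, φ p) *
        (Matrix.of fun i j => chartDiff φ p (e j) i) := by
  ext i j
  rw [Matrix.of_apply, hA.riemHess_eq_slabDD hφ hf ht hp, slabDD_space_space', Matrix.mul_apply]
  simp only [Matrix.mul_apply, Matrix.transpose_apply, Matrix.of_apply, Finset.sum_mul]
  exact Finset.sum_comm

lemma IsIntegrableParallelization.spaceTimeHess_frame (hA : IsIntegrableParallelization A)
    (hφ : φ ∈ A) (hf : IsTimeSmooth (n := n) 2 f) (ht : t ∈ Icc (0 : ℝ) 1) (hp : p ∈ φ.source)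
    (e : Fin n → TangentSpace (𝓡 n) p) :
    spaceTimeHess hA.metric f t p e = Matrix.fromBlocks
      (Matrix.of fun _ _ : Unit => slabDD (localPotential f φ) φ.target (t, φ p) (1, 0) (1, 0))
      (Matrix.of fun _ j => ∑ i, slabMixed (localPotential f φ) φ.target (t, φ p) i *
        (Matrix.of fun i j => chartDiff φ p (e j) i) i j)
      (Matrix.of fun j _ => ∑ i, slabMixed (localPotential f φ) φ.target (t, φ p) i *
        (Matrix.of fun i j => chartDiff φ p (e j) i) i j)
      ((Matrix.of fun i j => chartDiff φ p (e j) i).transpose *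
        slabHess (localPotential f φ) φ.target (t, φ p) *
        (Matrix.of fun i j => chartDiff φ p (e j) i)) := by
  have h1 : derivWithin (fun s => dt f s p) (Icc 0 1) t =
      slabDD (localPotential f φ) φ.target (t, φ p) (1, 0) (1, 0) :=
    (hasDerivWithinAt_dt_comp (hA.smooth hφ) hf ht (x := fun _ => p) hp
      continuousWithinAt_const (hasDerivWithinAt_const t _ (φ p))).derivWithin
      (uniqueDiffOn_Icc zero_lt_one t ht)
  rw [spaceTimeHess, hA.riemHess_frame hφ hf ht hp, h1]
  congr 1 <;> ext <;>
  · rw [Matrix.of_apply, dFun_dt (hA.smooth hφ) hf ht hp, slabDD_space_mixed]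
    rfl

/-- Both determinants take the same value in all orthonormal frames, and the coordinate frame of a
chart of `A` is one of them. -/
lemma IsIntegrableParallelization.riemannianDSL_iff (hA : IsIntegrableParallelization A)
    (hf : IsTimeSmooth (n := n) 2 f) :
    RiemannianDSL hA.metric θ f ↔ ∀ t ∈ Icc (0 : ℝ) 1, ∀ φ ∈ A, ∀ p ∈ φ.source,
      localDSL θ f φ t p = 0 ∧ 0 < localPhase θ f φ t p := by
  have key (t : ℝ) (ht : t ∈ Icc (0 : ℝ) 1) (φ) (hφ : φ ∈ A) (p) (hp : p ∈ φ.source)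
      (e : Fin n → TangentSpace (𝓡 n) p)
      (he : ∀ i j, hA.metric.inner p (e i) (e j) = if i = j then 1 else 0) :
      (Complex.exp (-(θ : ℂ) * Complex.I) *
      (degId n + Complex.I • (spaceTimeHess hA.metric f t p e).map Complex.ofReal).det).im =
        localDSL θ f φ t p ∧ (Complex.exp (-(θ : ℂ) * Complex.I) *
      (1 + Complex.I • (Matrix.of fun i j : Fin n =>
        ((riemHess hA.metric (f t) p (e i) (e j) : ℝ) : ℂ))).det).re = localPhase θ f φ t p := by
    have hP := hA.transpose_mul_eq_one hφ hp e he
    constructor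
    · rw [hA.spaceTimeHess_frame hφ hf ht hp, det_degId_add_congr _ _ _ _ hP]
      rfl
    · have h1 : (Matrix.of fun i j : Fin n => ((riemHess hA.metric (f t) p (e i) (e j) : ℝ) : ℂ)) =
        (Matrix.of fun i j : Fin n => riemHess hA.metric (f t) p (e i) (e j)).map Complex.ofReal :=
        rfl
      rw [h1, hA.riemHess_frame hφ hf ht hp, det_one_add_congr _ _ hP]
      rfl
  constructor
  · intro h t ht φ hφ p hp
    have h1 := h t ht p (coordVec φ p) (hA.isFrameMetric φ hφ p hp)
    have h2 := key t ht φ hφ p hp (coordVec φ p) (hA.isFrameMetric φ hφ p hp)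
    rwa [h2.1, h2.2] at h1
  · intro h t ht p e he
    obtain ⟨φ, hφ, hp⟩ := hA.cover p
    have h2 := key t ht φ hφ p hp e he
    rw [h2.1, h2.2]
    exact h t ht φ hφ p hp

end DSL

/-! ### The canonical parametrisation `df_t` and positivity. -/

section GraphsOfDifferentials

variable {n : ℕ} {M : Type*} [TopologicalSpace M] [ChartedSpace (Rn n) M] [IsManifold (𝓡 n) ∞ M]
  {φ : OpenPartialHomeomorph M (Rn n)} {A : Set (OpenPartialHomeomorph M (Rn n))} {p : M}
  {f : ℝ → M → ℝ} {t θ : ℝ}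

lemma IsTimeSmooth.isGraphFamily (hf : IsTimeSmooth (n := n) 2 f) :
    IsGraphFamily f (fun t => dSection (n := n) (f t)) where
  contMDiffOn := hf.contMDiffOn_dSection (by norm_cast) le_rfl (by norm_num)
  eq_dSection _ _ _ := rfl

lemma baseDiff_dSection (φ : M → Rn n) (u : M → ℝ) (p : M) :
    baseDiff φ (dSection (n := n) u) p = chartDiff φ p := by
  have h : mfderiv (𝓡 n) (𝓡 n) (fun x => (dSection (n := n) u x).proj) p =
      ContinuousLinearMap.id ℝ (TangentSpace (𝓡 n) p) := mfderiv_id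
  unfold baseDiff
  rw [h]
  rfl

lemma IsTimeSmooth.injective_mfderiv_dSection (hf : IsTimeSmooth (n := n) 2 f)
    (ht : t ∈ Icc (0 : ℝ) 1) (p : M) :
    Function.Injective (mfderiv (𝓡 n) (cotModel n) (dSection (n := n) (f t)) p) := by
  have h1 : MDifferentiableAt (𝓡 n) (cotModel n) (dSection (n := n) (f t)) p :=
    (contMDiff_slice (g := fun t => dSection (n := n) (f t)) hf.isGraphFamily.contMDiffOn
      ht p).mdifferentiableAt one_ne_zero
  have h2 : MDifferentiableAt (cotModel n) (𝓡 n) (fun q : CotangentBundle n M => q.proj)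
      (dSection (n := n) (f t) p) :=
    (Bundle.contMDiff_proj (n := 1) _ _).mdifferentiableAt one_ne_zero
  have h3 := mfderiv_comp p h2 h1
  have h4 : mfderiv (𝓡 n) (𝓡 n) ((fun q : CotangentBundle n M => q.proj) ∘
      dSection (n := n) (f t)) p = ContinuousLinearMap.id ℝ (TangentSpace (𝓡 n) p) := mfderiv_id
  rw [h4] at h3
  intro u w huw
  have h5 := congrArg (fun L : TangentSpace (𝓡 n) p →L[ℝ] TangentSpace (𝓡 n) p => L u) h3
  have h6 := congrArg (fun L : TangentSpace (𝓡 n) p →L[ℝ] TangentSpace (𝓡 n) p => L w) h3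
  refine h5.trans (Eq.trans ?_ h6.symm)
  exact congrArg (mfderiv (cotModel n) (𝓡 n) (fun q : CotangentBundle n M => q.proj)
    (dSection (n := n) (f t) p)) huw

lemma isEmbedding_dSection {u : M → ℝ} (hu : Continuous (dSection (n := n) u)) :
    IsEmbedding (dSection (n := n) u) :=
  Function.LeftInverse.isEmbedding (f := fun q : CotangentBundle n M => q.proj)
    (fun _ => rfl) (Bundle.contMDiff_proj (n := 0) (IB := 𝓡 n) _).continuous hu

lemma two_le_succ {r : ℕ∞} (hr : 1 ≤ r) : (2 : WithTop ℕ∞) ≤ ((r + 1 : ℕ∞) : WithTop ℕ∞) := by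
  have h : (2 : ℕ∞) ≤ r + 1 := by
    rw [← one_add_one_eq_two]
    gcongr
  exact WithTop.coe_le_coe.2 h

lemma IsTimeSmooth.isParametrization {r : ℕ∞} (hr : 1 ≤ r)
    (hf : IsTimeSmooth (n := n) ((r + 1 : ℕ∞) : WithTop ℕ∞) f) (ht : t ∈ Icc (0 : ℝ) 1)
    (o : ∀ p : M, Orientation ℝ (TangentSpace (𝓡 n) p) (Fin n)) :
    IsParametrization (I := cotModel n) o r (gradGraph o f t) (dSection (n := n) (f t)) := by
  have h2 := two_le_succ hr
  have h1 : ContMDiff (𝓡 n) (cotModel n) r (dSection (n := n) (f t)) :=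
    contMDiff_slice (g := fun t => dSection (n := n) (f t))
      (hf.contMDiffOn_dSection (m := r) (by exact_mod_cast le_top) h2 (by norm_cast)) ht
  exact ⟨h1, isEmbedding_dSection h1.continuous,
    (hf.of_le h2).injective_mfderiv_dSection ht, rfl⟩

/-- On the graph the form is the determinant of the frame in coordinates times the phase, and the
determinant is positive exactly on positively oriented frames. -/
lemma IsIntegrableParallelization.forall_reForm_pos_iff (hA : IsIntegrableParallelization A)
    (hf : IsTimeSmooth (n := n) 2 f) (ht : t ∈ Icc (0 : ℝ) 1) :
    (∀ z ∈ gradGraph hA.orientation f t, 0 < reForm hA.calabiYau θ z.1 z.2) ↔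
      ∀ φ ∈ A, ∀ p ∈ φ.source, 0 < localPhase θ f φ t p := by
  have key (φ) (hφ : φ ∈ A) (p : M) (hp : p ∈ φ.source) (u : Fin n → TangentSpace (𝓡 n) p) :
      reForm hA.calabiYau θ (dSection (f t) p)
        (fun j => mfderiv (𝓡 n) (cotModel n) (dSection (f t)) p (u j)) =
      (Matrix.of fun i j => chartDiff φ p (u j) i).det * localPhase θ f φ t p := by
    have h1 := hf.isGraphFamily.reForm_mfderiv hA hφ hf ht (p := p) (θ := θ) hp u
    refine h1.trans ?_
    rw [Matrix.det_mul, baseDiff_dSection]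
    have h2 := (RingHom.map_det Complex.ofRealHom
      (Matrix.of fun i j => chartDiff φ p (u j) i)).symm
    have h3 : ((Matrix.of fun i j => chartDiff φ p (u j) i).map Complex.ofReal).det =
      (((Matrix.of fun i j => chartDiff φ p (u j) i).det : ℝ) : ℂ) := h2
    rw [h3, ← mul_assoc, mul_comm, Complex.re_ofReal_mul]
    rfl
  constructor
  · intro h φ hφ p hp
    have h1 := h ⟨dSection (f t) p, fun j => mfderiv (𝓡 n) (cotModel n) (dSection (f t)) p
      (coordBasis (hA.smooth hφ) hp j)⟩ ⟨p, coordBasis (hA.smooth hφ) hp,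
        hA.isFrameOrientation φ hφ p hp _ (coordBasis_apply _ hp), rfl⟩
    dsimp only at h1
    rw [key φ hφ p hp] at h1
    have h2 : (Matrix.of fun i j => chartDiff φ p (coordBasis (hA.smooth hφ) hp j) i) = 1 := by
      ext i j
      rw [Matrix.of_apply, coordBasis_apply, chartDiff_coordVec (hA.smooth hφ) hp, stdVec_apply,
        Matrix.one_apply]
    rwa [h2, Matrix.det_one, one_mul] at h1
  · rintro h z ⟨p, b, hb, rfl⟩
    obtain ⟨φ, hφ, hp⟩ := hA.cover p
    dsimp only
    rw [key φ hφ p hp]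
    refine mul_pos ?_ (h φ hφ p hp)
    rw [← hA.isFrameOrientation φ hφ p hp (coordBasis (hA.smooth hφ) hp)
      (coordBasis_apply _ hp), eq_comm, Module.Basis.orientation_eq_iff_det_pos,
      Module.Basis.det_apply] at hb
    convert hb using 2
    ext i j
    simp [coordBasis, Module.Basis.toMatrix_apply]
    rfl

end GraphsOfDifferentials

/-! ### Linearity and positivity of the integral. -/

section FormIntegral

variable {V : Type*} [NormedAddCommGroup V] [NormedSpace ℝ V] {H : Type*} [TopologicalSpace H]
  {I : ModelWithCorners ℝ V H} {X : Type*} [TopologicalSpace X] [ChartedSpace H X] {n : ℕ}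
  {L : Type*} [TopologicalSpace L] [ChartedSpace (Rn n) L] {Y : CalabiYauStructure I X n} {θ : ℝ}
  {g : L → X} {ρ : SmoothPartitionOfUnity L (𝓡 n) L univ} {k l : L → ℝ}

variable (Y θ g) in
/-- The density of `g^* Re (e^{-√-1 θ} Ω)` in the preferred chart at `i`. -/
def formDensity (i : L) (y : Rn n) : ℝ :=
  reForm Y θ (g ((extChartAt (𝓡 n) i).symm y)) (fun j =>
    mfderiv (𝓡 n) I g ((extChartAt (𝓡 n) i).symm y)
      (mfderiv 𝓘(ℝ, Rn n) (𝓡 n) (extChartAt (𝓡 n) i).symm y (stdVec n j)))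

variable (Y θ g ρ k) in
/-- The integrand of `formIntegral` in the preferred chart at `i`. -/
def formIntegrand (i : L) (y : Rn n) : ℝ :=
  ρ i ((extChartAt (𝓡 n) i).symm y) * k ((extChartAt (𝓡 n) i).symm y) * |formDensity Y θ g i y|

lemma formIntegral_eq : formIntegral Y θ g ρ k =
    ∑ᶠ i : L, ∫ y in (extChartAt (𝓡 n) i).target, formIntegrand Y θ g ρ k i y := rfl

lemma continuousOn_formIntegrand (hd : ∀ i, ContinuousOn (formDensity Y θ g i)
    (extChartAt (𝓡 n) i).target) (hk : Continuous k) (i : L) :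
    ContinuousOn (formIntegrand Y θ g ρ k i) (extChartAt (𝓡 n) i).target := by
  have h1 := continuousOn_extChartAt_symm (I := 𝓡 n) i
  exact (((ρ i).contMDiff.continuous.comp_continuousOn h1).mul (hk.comp_continuousOn h1)).mul (hd i).abs

/-- Subordination and compactness of `L` make the integrand vanish outside a compact subset of the
chart target, on which it is continuous. -/
lemma integrableOn_formIntegrand [CompactSpace L]
    (hρ : ρ.IsSubordinate fun i => (chartAt (Rn n) i).source)
    (hd : ∀ i, ContinuousOn (formDensity Y θ g i) (extChartAt (𝓡 n) i).target)
    (hk : Continuous k) (i : L) :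
    IntegrableOn (formIntegrand Y θ g ρ k i) (extChartAt (𝓡 n) i).target := by
  set χ := extChartAt (𝓡 n) i
  have hs : tsupport (ρ i) ⊆ χ.source := by
    rw [extChartAt_source]
    exact hρ i
  have hK : IsCompact (χ '' tsupport (ρ i)) :=
    (isClosed_tsupport _).isCompact.image_of_continuousOn ((continuousOn_extChartAt i).mono hs)
  have hKt : χ '' tsupport (ρ i) ⊆ χ.target := by
    rintro _ ⟨x, hx, rfl⟩
    exact χ.map_source (hs hx)
  refine IntegrableOn.of_forall_sdiff_eq_zero
    (((continuousOn_formIntegrand hd hk i).mono hKt).integrableOn_compact hK)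
    (isOpen_extChartAt_target i).measurableSet fun y hy => ?_
  have h0 : ρ i (χ.symm y) = 0 := by
    by_contra h
    exact hy.2 ⟨χ.symm y, subset_tsupport _ h, χ.right_inv hy.1⟩
  rw [formIntegrand, h0, zero_mul, zero_mul]

lemma finite_support_formIntegral [CompactSpace L] :
    (Function.support fun i => ∫ y in (extChartAt (𝓡 n) i).target,
      formIntegrand Y θ g ρ k i y).Finite := by
  refine (ρ.locallyFinite.finite_nonempty_of_compact).subset fun i hi => ?_
  by_contra h
  apply hi
  have h0 (x : L) : ρ i x = 0 := by
    by_contra hx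
    exact h ⟨x, hx⟩
  simp [formIntegrand, h0]

lemma formIntegral_sub [CompactSpace L] (hρ : ρ.IsSubordinate fun i => (chartAt (Rn n) i).source)
    (hd : ∀ i, ContinuousOn (formDensity Y θ g i) (extChartAt (𝓡 n) i).target)
    (hk : Continuous k) (hl : Continuous l) :
    formIntegral Y θ g ρ (fun x => k x - l x) =
      formIntegral Y θ g ρ k - formIntegral Y θ g ρ l := by
  simp only [formIntegral_eq]
  rw [← finsum_sub_distrib finite_support_formIntegral finite_support_formIntegral]
  refine finsum_congr fun i => ?_
  rw [← integral_sub (integrableOn_formIntegrand hρ hd hk i)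
    (integrableOn_formIntegrand hρ hd hl i)]
  congr 1
  ext y
  simp only [formIntegrand]
  ring

lemma formIntegral_const [CompactSpace L] (c : ℝ) :
    formIntegral Y θ g ρ (fun _ => c) = c * formIntegral Y θ g ρ (fun _ => 1) := by
  simp only [formIntegral_eq]
  rw [mul_finsum]
  refine finsum_congr fun i => ?_
  rw [← integral_const_mul]
  congr 1
  ext y
  simp only [formIntegrand]
  ring

/-- All the integrals are nonnegative, and the one for a `ρ i` positive at some point has an
integrand whose support meets the chart target in a nonempty open set. -/
lemma formIntegral_one_pos [CompactSpace L] [Nonempty L]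
    (hρ : ρ.IsSubordinate fun i => (chartAt (Rn n) i).source)
    (hd : ∀ i, ContinuousOn (formDensity Y θ g i) (extChartAt (𝓡 n) i).target)
    (hd0 : ∀ i, ∀ y ∈ (extChartAt (𝓡 n) i).target, formDensity Y θ g i y ≠ 0) :
    0 < formIntegral Y θ g ρ (fun _ => 1) := by
  have hnn (i : L) (y : Rn n) : 0 ≤ formIntegrand Y θ g ρ (fun _ => 1) i y := by
    rw [formIntegrand, mul_one]
    exact mul_nonneg (ρ.nonneg i _) (abs_nonneg _)
  obtain ⟨x⟩ := ‹Nonempty L›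
  obtain ⟨i, hi⟩ := ρ.exists_pos_of_mem (mem_univ x)
  rw [formIntegral_eq]
  refine lt_of_lt_of_le ?_ (single_le_finsum i finite_support_formIntegral
    fun j => integral_nonneg (hnn j))
  set χ := extChartAt (𝓡 n) i
  have hx : x ∈ χ.source := by
    rw [extChartAt_source]
    exact hρ i (subset_tsupport _ hi.ne')
  have hc := continuousOn_formIntegrand (ρ := ρ) hd (continuous_const (y := (1 : ℝ))) i
  rw [setIntegral_pos_iff_support_of_nonneg_ae
    (Filter.Eventually.of_forall fun y => hnn i y) (integrableOn_formIntegrand hρ hd continuous_const i)]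
  have hopen : IsOpen (Function.support (formIntegrand Y θ g ρ (fun _ => 1) i) ∩ χ.target) := by
    rw [inter_comm]
    exact hc.isOpen_inter_preimage (isOpen_extChartAt_target i) isOpen_ne
  refine hopen.measure_pos _ ⟨χ x, ?_, χ.map_source hx⟩
  rw [Function.mem_support, formIntegrand, mul_one, χ.left_inv hx]
  exact mul_ne_zero hi.ne' (abs_ne_zero.2 (hd0 i _ (χ.map_source hx)))

end FormIntegral

/-! ### Continuity and nonvanishing of the density on graphs. -/

section GraphDensity

variable {n : ℕ} {M : Type*} [TopologicalSpace M] [ChartedSpace (Rn n) M] [IsManifold (𝓡 n) ∞ M]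
  {φ : OpenPartialHomeomorph M (Rn n)} {A : Set (OpenPartialHomeomorph M (Rn n))} {p : M}
  {f : ℝ → M → ℝ} {t θ : ℝ} {g : ℝ → M → CotangentBundle n M}

/-- In the coordinates `z` the density is `Re(c det(∂zᵢ/∂yⱼ))`, a continuous function of the first
derivatives. -/
lemma IsIntegrableParallelization.continuousOn_formDensity (hA : IsIntegrableParallelization A)
    {γ : M → CotangentBundle n M} (hγ : ContMDiff (𝓡 n) (cotModel n) 1 γ) (i : M) :
    ContinuousOn (formDensity hA.calabiYau θ γ i) (extChartAt (𝓡 n) i).target := by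
  set χ := chartAt (Rn n) i with hχdef
  have hext' : ((extChartAt (𝓡 n) i).symm : Rn n → M) = χ.symm := by simp [hχdef]
  have hext : (extChartAt (𝓡 n) i).target = χ.target := by simp [hχdef]
  have hχ : χ ∈ IsManifold.maximalAtlas (𝓡 n) ∞ M := IsManifold.chart_mem_maximalAtlas i
  intro y hy
  refine ContinuousAt.continuousWithinAt ?_
  rw [hext] at hy
  obtain ⟨φ, hφ, hp⟩ := hA.cover (γ (χ.symm y)).proj
  have h := hA.smooth hφ
  have hc : ContinuousAt (fun y => (γ (χ.symm y)).proj) y :=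
    ((Bundle.contMDiff_proj (n := 1) (IB := 𝓡 n)
      (fun p : M => TangentSpace (𝓡 n) p →L[ℝ] ℝ)).continuous.comp
      hγ.continuous).continuousAt.comp (χ.continuousAt_symm hy)
  have hs : ContMDiffAt 𝓘(ℝ, Rn n) (𝓡 n) 1 χ.symm y :=
    (contMDiffAt_symm_of_mem_maximalAtlas hχ hy).of_le (by norm_cast)
  have h1 : ContDiffAt ℝ 1 (cotCoord φ ∘ γ ∘ χ.symm) y := by
    rw [← contMDiffAt_iff_contDiffAt]
    exact ((contMDiffAt_cotCoord h hp).of_le (by norm_cast)).comp y ((hγ _).comp y hs)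
  have h2 : ContinuousAt (fderiv ℝ (cotCoord φ ∘ γ ∘ χ.symm)) y :=
    (h1.fderiv_right (m := 0) (by norm_num)).continuousAt
  have h3 : ContinuousAt (fun y => (Complex.exp (-(θ : ℂ) * Complex.I) *
      (Matrix.of fun i j => fderiv ℝ (cotCoord φ ∘ γ ∘ χ.symm) y (stdVec n j) i).det).re) y := by
    refine Complex.continuous_re.continuousAt.comp (continuousAt_const.mul ?_)
    have hm : Continuous fun l : Rn n →L[ℝ] (Fin n → ℂ) =>
        (Matrix.of fun i j => l (stdVec n j) i).det := by
      refine Continuous.matrix_det (continuous_matrix fun i j => ?_)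
      exact (continuous_apply i).comp (ContinuousLinearMap.apply ℝ (Fin n → ℂ) (stdVec n j)).continuous
    exact hm.continuousAt.comp h2
  refine h3.congr ?_
  filter_upwards [hc (φ.open_source.mem_nhds hp), χ.open_target.mem_nhds hy] with x hx hx'
  rw [formDensity, hA.reForm_apply, hext']
  congr 3
  ext k j
  have h4 : MDifferentiableAt 𝓘(ℝ, Rn n) (𝓡 n) χ.symm x :=
    (mdifferentiable_of_mem_maximalAtlas hχ).mdifferentiableAt_symm hx'
  have h5 : MDifferentiableAt (𝓡 n) (cotModel n) γ (χ.symm x) :=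
    (hγ _).mdifferentiableAt one_ne_zero
  have h6 : MDifferentiableAt (cotModel n) 𝓘(ℝ, Fin n → ℂ) (cotCoord φ) (γ (χ.symm x)) :=
    (contMDiffAt_cotCoord h hx).mdifferentiableAt (by simp)
  rw [Matrix.of_apply, Matrix.of_apply, ← mfderiv_eq_fderiv, hA.coframe_apply hφ hx,
    mfderiv_comp x h6 (h5.comp x h4), mfderiv_comp x h5 h4]
  rfl

/-- The density is `det U` times the phase, and `U` is invertible because the base differential and
the differential of the inverse chart are injective. -/
lemma IsGraphFamily.formDensity_ne_zero (hg : IsGraphFamily f g)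
    (hA : IsIntegrableParallelization A) (hf : IsTimeSmooth (n := n) 2 f)
    (ht : t ∈ Icc (0 : ℝ) 1) (hi : ∀ p, Function.Injective (mfderiv (𝓡 n) (cotModel n) (g t) p))
    (hpos : ∀ φ ∈ A, ∀ p ∈ φ.source, 0 < localPhase θ f φ t p) (i : M) (y : Rn n)
    (hy : y ∈ (extChartAt (𝓡 n) i).target) :
    formDensity hA.calabiYau θ (g t) i y ≠ 0 := by
  set χ := chartAt (Rn n) i with hχdef
  have hext' : ((extChartAt (𝓡 n) i).symm : Rn n → M) = χ.symm := by simp [hχdef]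
  have hext : (extChartAt (𝓡 n) i).target = χ.target := by simp [hχdef]
  have hχ : χ ∈ IsManifold.maximalAtlas (𝓡 n) ∞ M := IsManifold.chart_mem_maximalAtlas i
  rw [hext] at hy
  obtain ⟨φ, hφ, hp⟩ := hA.cover (g t (χ.symm y)).proj
  rw [formDensity, hext', hg.reForm_mfderiv hA hφ hf ht hp]
  set u : Fin n → TangentSpace (𝓡 n) (χ.symm y) :=
    fun j => mfderiv 𝓘(ℝ, Rn n) (𝓡 n) χ.symm y (stdVec n j)
  set U : Matrix (Fin n) (Fin n) ℝ :=
    Matrix.of fun i j => baseDiff φ (g t) (χ.symm y) (u j) i with hUdef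
  have hU : U.det ≠ 0 := by
    intro h0
    obtain ⟨c, hc, hc0⟩ := Matrix.exists_mulVec_eq_zero_iff.2 h0
    apply hc
    let D : Rn n →L[ℝ] Rn n := baseDiff φ (g t) (χ.symm y) ∘L mfderiv 𝓘(ℝ, Rn n) (𝓡 n) χ.symm y
    have hD : D (WithLp.toLp 2 c) = 0 := by
      rw [clm_eq_sum_stdVec D]
      ext k
      have := congrFun hc0 k
      simp only [Matrix.mulVec, dotProduct, Pi.zero_apply] at this
      rw [PiLp.zero_apply, ← this]
      simp only [WithLp.ofLp_sum, Finset.sum_apply, PiLp.smul_apply, smul_eq_mul]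
      exact Finset.sum_congr rfl fun j _ => mul_comm _ _
    have h1 := (hg.bijective_baseDiff hA hφ hf ht hp (hi _)).1
    have h2 : Function.Injective (mfderiv 𝓘(ℝ, Rn n) (𝓡 n) χ.symm y) :=
      ((mdifferentiable_of_mem_maximalAtlas hχ).symm.mfderiv_bijective hy).1
    have h3 : WithLp.toLp 2 c = (0 : Rn n) := by
      have h4 : D (WithLp.toLp 2 c) = D 0 := by rw [hD, map_zero]
      exact h2 (h1 h4)
    exact congrArg (fun x : Rn n => x.ofLp) h3
  have h5 : (U.map Complex.ofReal).det = ((U.det : ℝ) : ℂ) :=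
    (RingHom.map_det Complex.ofRealHom U).symm
  rw [Matrix.det_mul, h5, ← mul_assoc, mul_comm, Complex.re_ofReal_mul]
  exact mul_ne_zero hU (hpos φ hφ _ hp).ne'

end GraphDensity

/-- On a closed interval, a `C^m` function has a primitive of class `C^{m+1}`. -/
lemma exists_contDiffOn_primitive {m : ℕ∞} {b : ℝ → ℝ} (hb : ContDiffOn ℝ m b (Icc 0 1)) :
    ∃ c : ℝ → ℝ, ContDiffOn ℝ ((m + 1 : ℕ∞) : WithTop ℕ∞) c (Icc 0 1) ∧
      ∀ t ∈ Icc (0 : ℝ) 1, HasDerivWithinAt c (b t) (Icc 0 1) t := by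
  -- A continuous extension to the line allows the fundamental theorem of calculus at the end points
  -- as well.
  set e : ℝ → ℝ := IccExtend zero_le_one ((Icc (0 : ℝ) 1).domRestrict b) with he
  have hc : Continuous e := hb.continuousOn.domRestrict.Icc_extend'
  have heb (t : ℝ) (ht : t ∈ Icc (0 : ℝ) 1) : e t = b t := by
    rw [he, IccExtend_of_mem _ _ ht, domRestrict_apply]
  have hd (t : ℝ) (ht : t ∈ Icc (0 : ℝ) 1) :
      HasDerivWithinAt (fun u => ∫ x in (0 : ℝ)..u, e x) (b t) (Icc 0 1) t := by
    rw [← heb t ht]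
    exact (hc.integral_hasStrictDerivAt 0 t).hasDerivAt.hasDerivWithinAt
  have hu := uniqueDiffOn_Icc (zero_lt_one (α := ℝ))
  refine ⟨_, ?_, hd⟩
  rw [WithTop.coe_add, WithTop.coe_one, contDiffOn_succ_iff_derivWithin hu]
  -- The middle component is the analytic case, void because `m` lies in `ℕ∞`.
  exact ⟨fun t ht => (hd t ht).differentiableWithinAt, fun h => by simp at h,
    hb.congr fun t ht => (hd t ht).derivWithin (hu t ht)⟩

/-! ### Vanishing differentials, time derivatives and addition of functions of time. -/

section Manifold

variable {n : ℕ} {M : Type*} [TopologicalSpace M] [ChartedSpace (Rn n) M] [IsManifold (𝓡 n) ∞ M]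
  {φ : OpenPartialHomeomorph M (Rn n)} {p : M} {f : ℝ → M → ℝ} {t : ℝ} {k m : WithTop ℕ∞}

/-- A function with vanishing differential on a connected manifold is constant. -/
lemma apply_eq_of_dFun_eq_zero [PreconnectedSpace M] {u : M → ℝ}
    (hu : MDifferentiable (𝓡 n) 𝓘(ℝ, ℝ) u) (h : ∀ p, dFun (n := n) u p = 0) (p q : M) :
    u p = u q := by
  refine IsLocallyConstant.apply_eq_of_preconnectedSpace ?_ p q
  rw [IsLocallyConstant.iff_eventually_eq]
  intro x
  set χ := chartAt (Rn n) x
  have hχ : χ ∈ IsManifold.maximalAtlas (𝓡 n) ∞ M := IsManifold.chart_mem_maximalAtlas x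
  have hx : x ∈ χ.source := mem_chart_source _ x
  obtain ⟨ε, hε, hB⟩ := Metric.isOpen_iff.1 χ.open_target _ (χ.map_source hx)
  have h1 (y : Rn n) (hy : y ∈ Metric.ball (χ x) ε) : HasFDerivAt (u ∘ χ.symm) (0 : Rn n →L[ℝ] ℝ) y := by
    have h2 := (hu (χ.symm y)).hasMFDerivAt.comp y
      ((mdifferentiable_of_mem_maximalAtlas hχ).mdifferentiableAt_symm (hB hy)).hasMFDerivAt
    have h3 : mfderiv (𝓡 n) 𝓘(ℝ, ℝ) u (χ.symm y) = 0 := h _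
    rw [h3, ContinuousLinearMap.zero_comp] at h2
    exact h2.hasFDerivAt
  have h4 : χ ⁻¹' Metric.ball (χ x) ε ∈ 𝓝 x :=
    (χ.continuousAt hx) (Metric.ball_mem_nhds _ hε)
  filter_upwards [h4, χ.open_source.mem_nhds hx] with y hy hy'
  have h5 := Metric.isOpen_ball.is_const_of_fderiv_eq_zero (𝕜 := ℝ)
    (convex_ball (χ x) ε).isPreconnected
    (fun z hz => (h1 z hz).differentiableAt.differentiableWithinAt)
    (fun z hz => (h1 z hz).fderiv) hy (Metric.mem_ball_self hε)
  simpa [χ.left_inv hx, χ.left_inv hy'] using h5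

lemma IsTimeSmooth.dt (hf : IsTimeSmooth (n := n) k f) (hk : k ≤ ∞) (h2 : 2 ≤ k)
    (hmk : m + 1 ≤ k) : IsTimeSmooth (n := n) m (dt f) := by
  rintro ⟨t, p⟩ ⟨ht, -⟩
  have ht : t ∈ Icc (0 : ℝ) 1 := ht
  set φ := chartAt (Rn n) p
  have h : φ ∈ IsManifold.maximalAtlas (𝓡 n) ∞ M := IsManifold.chart_mem_maximalAtlas p
  have hp : p ∈ φ.source := mem_chart_source (Rn n) p
  have hmi : m ≤ ∞ := (le_self_add.trans hmk).trans hk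
  have hφ : ContMDiffAt (𝓘(ℝ, ℝ).prod (𝓡 n)) 𝓘(ℝ, Rn n) m (fun z : ℝ × M => φ z.2) (t, p) :=
    ((contMDiffAt_of_mem_maximalAtlas h hp).of_le hmi).comp (t, p) contMDiffAt_snd
  have h3 : ContMDiffWithinAt (𝓘(ℝ, ℝ).prod (𝓡 n)) 𝓘(ℝ, ℝ × Rn n) m
      (fun z : ℝ × M => (z.1, φ z.2)) (Icc 0 1 ×ˢ φ.source) (t, p) :=
    contMDiffWithinAt_fst.prodMk_space hφ.contMDiffWithinAt
  have h4 : ContMDiffWithinAt 𝓘(ℝ, ℝ × Rn n) 𝓘(ℝ, ℝ) m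
      (fun z => slabD (localPotential f φ) φ.target z (1, 0)) (slab φ.target) (t, φ p) :=
    ((contDiffOn_slabD φ.open_target (contDiffOn_localPotential hk h hf) hmk).clm_apply
      contDiffOn_const (t, φ p) (mk_mem_prod ht (φ.map_source hp))).contMDiffWithinAt
  have h5 := h4.comp (t, p) h3 fun z hz => mk_mem_prod hz.1 (φ.map_source hz.2)
  have heq (z : ℝ × M) (hz : z ∈ Icc (0 : ℝ) 1 ×ˢ φ.source) : PosLag.dt f z.1 z.2 =
      slabD (localPotential f φ) φ.target (z.1, φ z.2) (1, 0) :=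
    dt_eq h (hf.of_le h2) hz.1 hz.2
  refine (h5.congr heq (heq (t, p) ⟨ht, hp⟩)).mono_of_mem_nhdsWithin ?_
  rw [nhdsWithin_prod_eq, nhdsWithin_univ]
  exact Filter.prod_mem_prod self_mem_nhdsWithin (φ.open_source.mem_nhds hp)

lemma IsTimeSmooth.dt_add (hf : IsTimeSmooth (n := n) 1 f) (ht : t ∈ Icc (0 : ℝ) 1) {c : ℝ → ℝ}
    {c' : ℝ} (hc : HasDerivWithinAt c c' (Icc 0 1) t) (p : M) :
    PosLag.dt (fun t p => f t p + c t) t p = PosLag.dt f t p + c' := by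
  have h1 : DifferentiableWithinAt ℝ (fun s => f s p) (Icc 0 1) t :=
    (contMDiffOn_curve hf p t ht).contDiffWithinAt.differentiableWithinAt one_ne_zero
  exact (h1.hasDerivWithinAt.add hc).derivWithin (uniqueDiffOn_Icc zero_lt_one t ht)

lemma dSection_add_const {u : M → ℝ} (hu : MDifferentiable (𝓡 n) 𝓘(ℝ, ℝ) u) (c : ℝ) :
    dSection (n := n) (fun p => u p + c) = dSection u := by
  ext1 p
  have h : dFun (n := n) (fun p => u p + c) p = dFun u p := by
    have h1 := (hu p).hasMFDerivAt.add (hasMFDerivAt_const c p)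
    exact h1.mfderiv.trans (add_zero (M := Rn n →L[ℝ] ℝ) _)
  rw [dSection, dSection, h]

lemma IsTimeSmooth.gradGraph_add_const (hf : IsTimeSmooth (n := n) 1 f) (ht : t ∈ Icc (0 : ℝ) 1)
    (c : ℝ → ℝ) (o : ∀ p : M, Orientation ℝ (TangentSpace (𝓡 n) p) (Fin n)) :
    gradGraph o (fun t p => f t p + c t) t = gradGraph o f t := by
  have h : MDifferentiable (𝓡 n) 𝓘(ℝ, ℝ) (f t) := (contMDiff_slice hf ht).mdifferentiable one_ne_zero
  rw [gradGraph, gradGraph, dSection_add_const h]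

end Manifold

/-! ### Tangent fields depend only on values on the submanifolds. -/

section TangentFields

variable {V : Type*} [NormedAddCommGroup V] [NormedSpace ℝ V] {H : Type*} [TopologicalSpace H]
  {I : ModelWithCorners ℝ V H} {X : Type*} [TopologicalSpace X] [ChartedSpace H X] {n : ℕ}
  {M : Type*} [TopologicalSpace M] [ChartedSpace (Rn n) M] [IsManifold (𝓡 n) ∞ M]
  {A : Set (OpenPartialHomeomorph M (Rn n))} {Y : CalabiYauStructure I X n} {θ : ℝ} {r : ℕ∞}

/-- Every tangent space has a positive basis, the coordinate frame, so no point is lost on passing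
to the set of frames. -/
lemma IsIntegrableParallelization.points_orientedImage (hA : IsIntegrableParallelization A)
    (γ : M → X) : points (orientedImage I hA.orientation γ) = range γ := by
  ext x
  constructor
  · rintro ⟨_, ⟨p, b, -, rfl⟩, rfl⟩
    exact ⟨p, rfl⟩
  · rintro ⟨p, rfl⟩
    obtain ⟨φ, hφ, hp⟩ := hA.cover p
    exact ⟨_, ⟨p, coordBasis (hA.smooth hφ) hp,
      hA.isFrameOrientation φ hφ p hp _ (coordBasis_apply _ hp), rfl⟩, rfl⟩

lemma IsIntegrableParallelization.range_eq_points (hA : IsIntegrableParallelization A)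
    {Γ : FrameSet I X n} {γ : M → X} (hγ : IsParametrization hA.orientation r Γ γ) :
    range γ = points Γ := by
  rw [← hγ.image_eq, hA.points_orientedImage]

lemma IsTangentField.congr (hA : IsIntegrableParallelization A) {Λ Λ' : ℝ → FrameSet I X n}
    {h h' : ℝ → X → ℝ} (hT : IsTangentField Y θ hA.orientation r Λ h)
    (hΛ : ∀ t ∈ Icc (0 : ℝ) 1, Λ' t = Λ t)
    (hh : ∀ t ∈ Icc (0 : ℝ) 1, ∀ x ∈ points (Λ t), h' t x = h t x) :
    IsTangentField Y θ hA.orientation r Λ' h' where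
  tangent t ht γ hγ := by
    rw [hΛ t ht] at hγ
    have h1 : h' t ∘ γ = h t ∘ γ := by
      ext p
      refine hh t ht _ ?_
      rw [← hA.range_eq_points hγ]
      exact mem_range_self p
    rw [h1]
    exact hT.tangent t ht γ hγ
  support hM := by
    obtain ⟨K, hK, h1⟩ := hT.support hM
    refine ⟨K, hK, fun t ht x hx hxK => ?_⟩
    rw [hΛ t ht] at hx
    rw [hh t ht x hx, h1 t ht x hx hxK]

end TangentFields

/-! ### Velocities, normalisation and the geodesic equation. -/

section Paths

variable {n : ℕ} {M : Type*} [TopologicalSpace M] [ChartedSpace (Rn n) M] [IsManifold (𝓡 n) ∞ M]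
  {A : Set (OpenPartialHomeomorph M (Rn n))} {f : ℝ → M → ℝ} {t θ : ℝ} {r : ℕ∞}
  {g : ℝ → M → CotangentBundle n M} {h : ℝ → CotangentBundle n M → ℝ}

lemma IsIntegrableParallelization.points_gradGraph (hA : IsIntegrableParallelization A) (t : ℝ) :
    points (gradGraph hA.orientation f t) = range (dSection (n := n) (f t)) :=
  hA.points_orientedImage _

lemma IsPathWithVelocity.isGraphFamily {hA : IsIntegrableParallelization A} (hr : 1 ≤ r)
    (hP : IsPathWithVelocity hA.calabiYau θ hA.orientation r (gradGraph hA.orientation f) g h) :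
    IsGraphFamily f g where
  contMDiffOn := hP.contMDiffOn.of_le (by exact_mod_cast hr)
  eq_dSection t ht p := by
    have h1 : g t p ∈ range (dSection (n := n) (f t)) := by
      rw [← hA.points_gradGraph, ← hA.range_eq_points (hP.parametrization t ht)]
      exact mem_range_self p
    obtain ⟨q, hq⟩ := h1
    rw [← hq]
    rfl

lemma IsPathWithVelocity.exists_apply_eq {hA : IsIntegrableParallelization A}
    (hP : IsPathWithVelocity hA.calabiYau θ hA.orientation r (gradGraph hA.orientation f) g h)
    (ht : t ∈ Icc (0 : ℝ) 1) (q : M) : ∃ p, g t p = dSection (f t) q := by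
  have h1 : dSection (f t) q ∈ range (g t) := by
    rw [hA.range_eq_points (hP.parametrization t ht), hA.points_gradGraph]
    exact mem_range_self q
  exact h1

/-- By `IsGraphFamily.omega_timeDeriv` the sum of the velocity and `∂_t f` has zero differential
along each `g t`, hence is constant on the connected `M`. Evaluation at a fixed `p₀` shows that this
constant is `C^r` in time. -/
lemma IsPathWithVelocity.exists_velocity_eq [ConnectedSpace M]
    {hA : IsIntegrableParallelization A} (hr : 1 ≤ r)
    (hf : IsTimeSmooth (n := n) ((r + 1 : ℕ∞) : WithTop ℕ∞) f)
    (hP : IsPathWithVelocity hA.calabiYau θ hA.orientation r (gradGraph hA.orientation f) g h) :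
    ∃ b : ℝ → ℝ, ContDiffOn ℝ r b (Icc 0 1) ∧
      ∀ t ∈ Icc (0 : ℝ) 1, ∀ p, h t (g t p) = b t - dt f t (g t p).proj := by
  have h2 := two_le_succ hr
  have hf2 := hf.of_le h2
  have hg := hP.isGraphFamily hr
  have hdt : IsTimeSmooth (n := n) r (dt f) :=
    hf.dt (by exact_mod_cast le_top) h2 (by norm_cast)
  have hproj : ContMDiffOn (𝓘(ℝ, ℝ).prod (𝓡 n)) (𝓡 n) r
      (fun z : ℝ × M => (g z.1 z.2).proj) (Icc 0 1 ×ˢ univ) :=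
    (Bundle.contMDiff_proj (fun p : M => TangentSpace (𝓡 n) p →L[ℝ] ℝ)).comp_contMDiffOn
      hP.contMDiffOn
  have hD : ContMDiffOn (𝓘(ℝ, ℝ).prod (𝓡 n)) 𝓘(ℝ, ℝ) r
      (fun z : ℝ × M => dt f z.1 (g z.1 z.2).proj) (Icc 0 1 ×ˢ univ) :=
    ContMDiffOn.comp (g := fun z : ℝ × M => dt f z.1 z.2) hdt (contMDiffOn_fst.prodMk hproj)
      fun z hz => ⟨hz.1, mem_univ _⟩
  have hr0 : (r : WithTop ℕ∞) ≠ 0 := by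
    have : r ≠ 0 := (zero_lt_one.trans_le hr).ne'
    exact_mod_cast this
  obtain ⟨p₀⟩ : Nonempty M := inferInstance
  refine ⟨fun t => h t (g t p₀) + dt f t (g t p₀).proj, ?_, fun t ht p => ?_⟩
  · rw [← contMDiffOn_iff_contDiffOn]
    exact (contMDiffOn_curve (g := fun t p => h t (g t p)) hP.contMDiffOn_velocity p₀).add
      (contMDiffOn_curve (g := fun t p => dt f t (g t p).proj) hD p₀)
  · have h3 : MDifferentiable (𝓡 n) 𝓘(ℝ, ℝ) (h t ∘ g t) :=
      (contMDiff_slice (g := fun t p => h t (g t p)) hP.contMDiffOn_velocity ht).mdifferentiable hr0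
    have h4 : MDifferentiable (𝓡 n) 𝓘(ℝ, ℝ) (dt f t ∘ fun x => (g t x).proj) :=
      (contMDiff_slice (g := fun t p => dt f t (g t p).proj) hD ht).mdifferentiable hr0
    have h5 (p : M) : dFun (n := n) ((h t ∘ g t) + dt f t ∘ fun x => (g t x).proj) p = 0 := by
      ext u
      have h6 := hP.velocity t ht p u
      rw [hg.omega_timeDeriv hA hf2 ht] at h6
      have h7 : dFun (n := n) ((h t ∘ g t) + dt f t ∘ fun x => (g t x).proj) p u =
          dFun (h t ∘ g t) p u + dFun (dt f t ∘ fun x => (g t x).proj) p u := by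
        rw [dFun, mfderiv_add (h3 p) (h4 p)]
        rfl
      rw [h7, ← h6]
      exact neg_add_cancel _
    have h8 := apply_eq_of_dFun_eq_zero (h3.add h4) h5 p p₀
    simp only [Pi.add_apply, Function.comp_apply] at h8
    linarith

/-- If `graph(df_t)` is a path of positive Lagrangians, then `f` can be normalised by adding a
function of time. -/
theorem IsIntegrableParallelization.exists_isNormalised_add [ConnectedSpace M]
    (hA : IsIntegrableParallelization A) (hr : 1 ≤ r)
    (hf : IsTimeSmooth (n := n) ((r + 1 : ℕ∞) : WithTop ℕ∞) f)
    (hP : IsPath hA.calabiYau θ hA.orientation r (gradGraph hA.orientation f)) :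
    ∃ c : ℝ → ℝ, ContDiffOn ℝ ((r + 1 : ℕ∞) : WithTop ℕ∞) c (Icc 0 1) ∧
      IsNormalised hA.calabiYau θ hA.orientation r (fun t p => f t p + c t) := by
  obtain ⟨g, h, hP⟩ := hP
  obtain ⟨b, hb, hb'⟩ := hP.exists_velocity_eq hr hf
  -- With `c' = -b`, the function `-∂_t(f + c) = b - ∂_t f` is the velocity of the path, a tangent
  -- field by assumption.
  obtain ⟨c, hc, hc'⟩ := exists_contDiffOn_primitive hb.neg
  have hf1 : IsTimeSmooth (n := n) 1 f := hf.of_le (le_trans (by norm_num) (two_le_succ hr))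
  refine ⟨c, hc, hP.tangentField.congr hA (fun t ht => hf1.gradGraph_add_const ht c _)
    fun t ht x hx => ?_⟩
  rw [← hA.range_eq_points (hP.parametrization t ht)] at hx
  obtain ⟨p, rfl⟩ := hx
  rw [hf1.dt_add ht (hc' t ht), hb' t ht p]
  ring

lemma IsIntegrableParallelization.isTangentField_of_isNormalised
    (hA : IsIntegrableParallelization A)
    (hf : IsTimeSmooth (n := n) 1 f) {k : ℝ}
    (hN : IsNormalised hA.calabiYau θ hA.orientation r (fun t p => f t p + k * t)) :
    IsTangentField hA.calabiYau θ hA.orientation r (gradGraph hA.orientation f)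
      (fun t q => -dt f t q.proj - k) := by
  refine IsTangentField.congr hA hN
    (fun t ht => (hf.gradGraph_add_const ht (fun t => k * t) _).symm) fun t ht x _ => ?_
  have h1 : HasDerivWithinAt (fun t : ℝ => k * t) k (Icc 0 1) t := by
    simpa using ((hasDerivAt_id t).const_mul k).hasDerivWithinAt
  rw [hf.dt_add ht h1]
  ring

/-- Two tangent vectors at a positive gradient graph which differ by a constant are equal. -/
lemma IsGraphFamily.eq_zero_of_isTangentVector [T2Space M] [SecondCountableTopology M] [Nonempty M]
    (hg : IsGraphFamily f g) (hA : IsIntegrableParallelization A)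
    (hf : IsTimeSmooth (n := n) 2 f) (ht : t ∈ Icc (0 : ℝ) 1)
    (hpos : ∀ φ ∈ A, ∀ p ∈ φ.source, 0 < localPhase θ f φ t p)
    {Γ : FrameSet (cotModel n) (CotangentBundle n M) n}
    (hγ : IsParametrization hA.orientation r Γ (g t)) {k l : CotangentBundle n M → ℝ}
    (hk : IsTangentVector hA.calabiYau θ hA.orientation r Γ k)
    (hl : IsTangentVector hA.calabiYau θ hA.orientation r Γ l) {c : ℝ}
    (hc : ∀ p, k (g t p) - l (g t p) = c) : c = 0 := by
  obtain ⟨hk1, hk2, hk3⟩ := hk _ hγ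
  obtain ⟨hl1, hl2, hl3⟩ := hl _ hγ
  have heq : (fun p => (k ∘ g t) p - (l ∘ g t) p) = fun _ => c := funext hc
  by_cases hM : CompactSpace M
  · have : LocallyCompactSpace M := ChartedSpace.locallyCompactSpace (Rn n) M
    obtain ⟨ρ, hρ⟩ := SmoothPartitionOfUnity.exists_isSubordinate_chartAt_source (𝓡 n) M
    -- In the compact case `c` times the positive total volume is a difference of two zero
    -- integrals.
    have hd := hA.continuousOn_formDensity (θ := θ) (contMDiff_slice hg.contMDiffOn ht)
    have h1 := formIntegral_sub hρ hd hk1.continuous hl1.continuous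
    rw [heq, hk2 hM ρ hρ, hl2 hM ρ hρ, sub_zero, formIntegral_const] at h1
    have h2 := formIntegral_one_pos hρ hd
      (hg.formDensity_ne_zero hA hf ht hγ.immersion hpos)
    exact (mul_eq_zero.1 h1).resolve_right h2.ne'
  -- A nonzero constant has full support, which would make `M` compact.
  · by_contra hc0
    apply hM
    have h1 : HasCompactSupport fun _ : M => c := by
      rw [← heq]
      exact (hk3 hM).sub (hl3 hM)
    have h2 : tsupport (fun _ : M => c) = univ := by
      rw [tsupport, Function.support_const hc0, closure_univ]
    rw [HasCompactSupport, h2] at h1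
    exact ⟨h1⟩

/-- For a potential normalised up to an affine function of time, the geodesic equation for the
path of gradient graphs is the Riemannian degenerate special Lagrangian equation. -/
theorem IsIntegrableParallelization.isGeodesic_iff [T2Space M] [SecondCountableTopology M]
    [ConnectedSpace M] (hA : IsIntegrableParallelization A) (hr : 1 ≤ r)
    (hf : IsTimeSmooth (n := n) ((r + 1 : ℕ∞) : WithTop ℕ∞) f) {k : ℝ}
    (hN : IsNormalised hA.calabiYau θ hA.orientation r (fun t p => f t p + k * t)) :
    IsGeodesic hA.calabiYau θ hA.orientation r (gradGraph hA.orientation f) ↔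
      RiemannianDSL hA.metric θ f := by
  have h2 := two_le_succ hr
  have hf2 := hf.of_le h2
  have hT := hA.isTangentField_of_isNormalised (hf.of_le (le_trans (by norm_num) h2)) hN
  rw [hA.riemannianDSL_iff hf2]
  constructor
  · rintro ⟨g, h, hP, hgeo⟩ t ht φ hφ q hq
    have hg := hP.isGraphFamily hr
    obtain ⟨b, -, hb⟩ := hP.exists_velocity_eq hr hf
    have hpos (t : ℝ) (ht : t ∈ Icc (0 : ℝ) 1) :=
      (hA.forall_reForm_pos_iff hf2 ht).1 (hP.positiveLagrangian t ht).2
    -- The velocity and `-∂_t f - k` are both tangent vectors at `Λ_t` and differ by this constant.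
    have hbk (t : ℝ) (ht : t ∈ Icc (0 : ℝ) 1) : b t + k = 0 :=
      hg.eq_zero_of_isTangentVector hA hf2 ht (hpos t ht) (hP.parametrization t ht)
        (hP.tangentField.tangent t ht) (hT.tangent t ht) fun p => by
          rw [hb t ht p]
          ring
    obtain ⟨p, hp⟩ := hP.exists_apply_eq ht q
    have hpq : (g t p).proj = q := by
      rw [hp]
      rfl
    obtain ⟨ζ, hζ, hζ0⟩ := hgeo t ht p
    refine ⟨?_, hpos t ht φ hφ q hq⟩
    -- The velocity is `-k - ∂_t f`, so no derivative of `b` appears.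
    have h3 : derivWithin (fun s => h s (g s p)) (Icc 0 1) t =
        - derivWithin (fun s => dt f s (g s p).proj) (Icc 0 1) t := by
      rw [← derivWithin_const_sub (-k)]
      refine derivWithin_congr (fun s hs => ?_) ?_
      · rw [hb s hs p, eq_neg_of_add_eq_zero_left (hbk s hs)]
      · rw [hb t ht p, eq_neg_of_add_eq_zero_left (hbk t ht)]
    have h4 := hP.velocity t ht p ζ
    rw [hg.omega_timeDeriv hA hf2 ht] at h4
    rw [h3, ← h4] at hζ0
    subst hpq
    rw [hg.localDSL_eq hA hφ hf2 ht hq ((hP.parametrization t ht).immersion p)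
      (hpos t ht φ hφ _ hq) hζ, mul_eq_zero]
    left
    linarith
  · intro hD
    have hg := hf2.isGraphFamily
    have hdt : IsTimeSmooth (n := n) r (dt f) :=
      hf.dt (by exact_mod_cast le_top) h2 (by norm_cast)
    have hr0 : (r : WithTop ℕ∞) ≠ 0 := by
      have : r ≠ 0 := (zero_lt_one.trans_le hr).ne'
      exact_mod_cast this
    have hv (t : ℝ) (ht : t ∈ Icc (0 : ℝ) 1) (p : M) :
        dFun (n := n) ((fun q : CotangentBundle n M => -dt f t q.proj - k) ∘ dSection (f t)) p =
          - dFun (n := n) (dt f t) p := by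
      have h3 := (((contMDiff_slice hdt ht).mdifferentiable hr0 p).hasMFDerivAt.neg).sub
        (hasMFDerivAt_const k p)
      exact h3.mfderiv.trans (sub_zero (G := Rn n →L[ℝ] ℝ) _)
    -- For the converse the canonical parametrisation suffices. The shift by `k` is what makes the
    -- velocity a tangent vector when only `f + k t` is normalised.
    refine ⟨fun t => dSection (f t), fun t q => -dt f t q.proj - k, ⟨fun t ht =>
      ⟨⟨_, hf.isParametrization hr ht _, fun p => hg.omega_mfderiv hA hf2 ht⟩,
        (hA.forall_reForm_pos_iff hf2 ht).2 fun φ hφ p hp => (hD t ht φ hφ p hp).2⟩,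
      fun t ht => hf.isParametrization hr ht _,
      hf.contMDiffOn_dSection (by exact_mod_cast le_top) h2 (by norm_cast),
      ContMDiffOn.sub (ContMDiffOn.neg hdt) contMDiffOn_const, hT, fun t ht p u => ?_⟩,
      fun t ht p => ?_⟩
    · rw [hv t ht p]
      exact hg.omega_timeDeriv hA hf2 ht u
    · obtain ⟨φ, hφ, hp⟩ := hA.cover p
      obtain ⟨hD0, hpos⟩ := hD t ht φ hφ p hp
      have hi := hf2.injective_mfderiv_dSection ht p
      obtain ⟨ζ, hζ⟩ := hg.exists_isCorrectionVector hA hφ hf2 ht (p := p) hp hi hpos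
      refine ⟨ζ, hζ, ?_⟩
      have h3 := hg.localDSL_eq hA hφ hf2 ht (p := p) hp hi hpos hζ
      have h4 : derivWithin (fun s => dt f s p) (Icc 0 1) t + dFun (dt f t) p ζ = 0 :=
        (mul_eq_zero.1 (h3.symm.trans hD0)).resolve_right hpos.ne'
      rw [hv t ht p]
      have h5 : derivWithin (fun s => -dt f s p - k) (Icc 0 1) t =
          - derivWithin (fun s => dt f s p) (Icc 0 1) t := by
        rw [derivWithin_sub_const, derivWithin.fun_neg]
      change derivWithin (fun s => -dt f s p - k) (Icc 0 1) t + - dFun (dt f t) p ζ = 0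
      rw [h5]
      linarith

end Paths

end PosLag

end

theorem theorem1p1p2 {n : ℕ} {M : Type*} [TopologicalSpace M] [ChartedSpace (Rn n) M]
    [IsManifold (𝓡 n) ∞ M] [T2Space M] [SecondCountableTopology M]
    (A : Set (OpenPartialHomeomorph M (Rn n))) (hA : IsIntegrableParallelization A) :
    ∃ (Y : CalabiYauStructure (cotModel n) (CotangentBundle n M) n) (g : RiemMetric n M)
      (o : ∀ p : M, Orientation ℝ (TangentSpace (𝓡 n) p) (Fin n)),
      IsFrameCalabiYau A Y ∧ IsFrameMetric A g ∧ IsFrameOrientation A o ∧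
      (ConnectedSpace M → ∀ (r : ℕ∞), 1 ≤ r → ∀ θ ∈ Ioc (-Real.pi) Real.pi, ∀ f : ℝ → M → ℝ,
        ContMDiffOn (𝓘(ℝ, ℝ).prod (𝓡 n)) 𝓘(ℝ, ℝ) ((r + 1 : ℕ∞) : WithTop ℕ∞)
          (fun z : ℝ × M => f z.1 z.2) (Icc 0 1 ×ˢ univ) →
        (IsPath Y θ o r (gradGraph o f) →
          ∃ c : ℝ → ℝ, ContDiffOn ℝ ((r + 1 : ℕ∞) : WithTop ℕ∞) c (Icc 0 1) ∧
            IsNormalised Y θ o r (fun t p => f t p + c t)) ∧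
        ((∃ k : ℝ, IsNormalised Y θ o r (fun t p => f t p + k * t)) →
          (IsGeodesic Y θ o r (gradGraph o f) ↔ RiemannianDSL g θ f))) := by
  refine ⟨hA.calabiYau, hA.metric, hA.orientation, hA.isFrameCalabiYau, hA.isFrameMetric,
    hA.isFrameOrientation, fun _ r hr θ _ f hf => ⟨hA.exists_isNormalised_add hr hf, ?_⟩⟩
  rintro ⟨k, hk⟩
  exact hA.isGeodesic_iff hr hf hk
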